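/- **Setting.** Let $\Sigma,\Pi$ be alphabets. For a string $X$ let $X[i]$ be its $i$-th symbol (counting from 1), $X[i:j]$ the substring at positions $i,\dots,j$ and $X[i:]=X[i:|X|]$. A *substring consistent equivalence relation* (SCER) is an equivalence relation $\approx$ on $\Sigma^*$ such that $X\approx Y$ implies $|X|=|Y|$ and $X[i:j]\approx Y[i:j]$ for all $1\le i\le j\le |X|$. An *$\approx$-encoding* is a map $f:\Sigma^*\to\Pi^*$ with (1) $|f(X)|=|X|$; (2) $f(X[1:i])=f(X)[1:i]$; (3) for $|X|=|Y|$ and $j<i\le |X|$, $f(X)[i]=f(Y)[i]$ implies $f(X[j+1:])[i-j]=f(Y[j+1:])[i-j]$; (4) $f(X)=f(Y)$ iff $X\approx Y$. Write $\widetilde X=f(X)$ and $\widetilde X_x[i]=f(X[x:])[i]$. Suppose that there is a subroutine which, given $\widetilde X$ and $x,i\ge 1$ with $x+i\le |X|+1$, returns $\widetilde X_x[i]$ in at most $\xi^{\mathrm t}_{|X|}$ time and $\xi^{\mathrm w}_{|X|}$ work (every call takes at least one step). Let $P$ be a pattern of length $m$. For $0\le a<m$ let $\mathcal W_P(a)=\{w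 : 1\le w\le m-a,\ \widetilde P_{a+1}[w]\ne\widetilde P[w]\}$ be the set of witnesses for the offset $a$. A *(border-based) period* of $P$ is an $a$ with $0<a<m$ and $P[1:m-a]\approx P[a+1:m]$. A *witness table* is an array $W[0:m-1]$ with $W[a]=0$ if $\mathcal W_P(a)=\emptyset$ and $W[a]\in\mathcal W_P(a)$ otherwise. A position $i$ is *finalized* if $W[i]=0$ implies $\mathcal W_P(i)=\emptyset$ and $W[i]\neq0$ implies $W[i]\in\mathcal W_P(i)$. A prefix $W[0:h-1]$ is *$2^k$-sparse* if, when it is cut into blocks of length $2^k$ from the left, each full block contains exactly one zero and the shorter remaining block contains at most one. The machine is the priority CRCW PRAM (concurrent reads and writes; of several processors that write to one cell, the one with the smallest index succeeds), with unit-cost arithmetic and the above subroutine. **Algorithm.** $\mathrm{Check}(a)$ compares $\widetilde P[1:m-a]$ with $\widetilde P_{a+1}[1:m-a]$ in parallel and returns the smallest $w$ at which they differ, or $0$. Initially $W\equiv0$, $\mathit{tail}=m$, $k=0$; the *head* is $W[0:\mathit{tail}-1]$ and the *tail* is $W[\mathit{tail}:m-1]$. While $2^k<\mathit{tail}$, do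 the following round: find the zero $p$ of $W$ in $[2^k,\min(2^{k+1},\mathit{tail})-1]$. If there is none, only increase $k$ by 1. Otherwise: 1. Set $W[p]\leftarrow\mathrm{Check}(p)$; let $\mathit{lcp}=m-p$ if $W[p]=0$ and $\mathit{lcp}=W[p]-1$ otherwise; set $\mathit{old}\leftarrow\mathit{tail}$ and $\mathit{tail}\leftarrow\min(\mathit{old}-2^k,\,m-\mathit{lcp})$. 2. In parallel, for each $2^{k+1}$-block of $W[0:\mathit{tail}-1]$ except the first: if both its halves contain a zero, say $j_1<j_2$, put $a=j_2-j_1$, $w=W[a]$; if $\widetilde P_{j_2+1}[w]=\widetilde P[w]$ set $W[j_1]\leftarrow w+a$, otherwise set $W[j_2]\leftarrow w$. 3. If $\mathit{old}-\mathit{tail}=2^k$, set $W[z]\leftarrow\mathrm{Check}(z)$ for each zero $z$ of $W$ in $[\mathit{tail},\mathit{old}-1]$. Otherwise, first in parallel for $i\in[\mathit{tail},\mathit{old}-1]$, with $q\in[\mathit{old}-p,\mathit{old}-1]$, $q\equiv i\pmod p$: if $W[i]=0\ne W[q]$ set $W[i]\leftarrow W[q]+q-i$. Then, for each zero $z$ of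 $W$ in $[\mathit{old}-p,\mathit{old}-1]$, find by binary search with $\mathrm{Check}$ the largest $b<\mathit{old}$ with $b\equiv z\pmod p$ and $\mathrm{Check}(b)\ne0$ among those $\geq \mathit{tail}$ (if there is none, the search ends below $\mathit{tail}$ and nothing is updated), and in parallel set $W[i]\leftarrow\mathrm{Check}(b)+b-i$ for all $i\in[\mathit{tail},b]$ with $i\equiv b\pmod p$ and $W[i]=0$. 4. Increase $k$ by 1. **Theorem.** There is an absolute constant $C$ such that, for every SCER $\approx$, every $\approx$-encoding, every re-encoding subroutine as above and every pattern $P$ of length $m$, the algorithm, given $\widetilde P$ (and $m$), halts with a witness table $W$ of $P$: for every $a<m$, $W[a]=0$ if $a=0$ or $a$ is a period of $P$, and $W[a]\in\mathcal W_P(a)$ otherwise. If $m\ge2$, it takes at most $C\,\xi^{\mathrm t}_m\log_2^2m$ time and at most $C\,\xi^{\mathrm w}_m\,m\log_2^2m$ work on the P-CRCW PRAM. Moreover, after every number $k\geq 0$ of completed rounds, the head is $2^k$-sparse, every nonzero entry $W[i]$ of the head lies in $\mathcal W_P(i)$, every entry of the head is at most $2^k$ plus the length of the tail, and every position of the tail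 is finalized. -/

import Mathlib

namespace WitnessPRAM

/-! ## Strings, substring consistent equivalence relations, encodings

Strings are lists.  Positions are 1-based, as usual in stringology: the symbol `X[i]` is
`X[i - 1]?`, and the suffix `X[x:]` is `X.drop (x - 1)`. -/

section Strings

variable {α β : Type*}

/-- The substring `X[i:j]` (positions `i, …, j`, 1-based; empty if `j < i`). -/
def substr (X : List α) (i j : ℕ) : List α := (X.take j).drop (i - 1)

/-- Substring consistent equivalence relation (SCER). -/
structure IsSCER (r : List α → List α → Prop) : Prop where
  equiv : Equivalence r
  length_eq : ∀ X Y, r X Y → X.length = Y.length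
  substr_rel : ∀ X Y, r X Y → ∀ i j, 1 ≤ i → i ≤ j → j ≤ X.length → r (substr X i j) (substr Y i j)

/-- `f` is an encoding for the relation `r`. -/
structure IsEncoding (r : List α → List α → Prop) (f : List α → List β) : Prop where
  length_eq : ∀ X, (f X).length = X.length
  prefix_eq : ∀ X i, i ≤ X.length → f (X.take i) = (f X).take i
  suffix_eq : ∀ X Y : List α, X.length = Y.length → ∀ i j, j < i → i ≤ X.length →
    (f X)[i - 1]? = (f Y)[i - 1]? →
      (f (X.drop j))[i - j - 1]? = (f (Y.drop j))[i - j - 1]?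
  eq_iff : ∀ X Y, f X = f Y ↔ r X Y

/-- Border-based periods: `0 < p < |X|` and `X[1 : |X| - p] ≈ X[p + 1 : |X|]`. -/
def IsPeriod (r : List α → List α → Prop) (X : List α) (p : ℕ) : Prop :=
  0 < p ∧ p < X.length ∧ r (X.take (X.length - p)) (X.drop p)

/-- The symbol at position `i` of the encoding of the suffix `X[x:]`, for `x, i ≥ 1`. -/
def reencoded (f : List α → List β) (X : List α) (x i : ℕ) : Option β :=
  (f (X.drop (x - 1)))[i - 1]?

/-- The set of witnesses for the offset `a`: positions `w` of the overlap of `P` with its copy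
shifted by `a` at which the encoding of `P[a+1:]` differs from that of `P`. -/
def witnesses (f : List α → List β) (P : List α) (a : ℕ) : Set ℕ :=
  {w | 1 ≤ w ∧ a + w ≤ P.length ∧ reencoded f P (a + 1) w ≠ (f P)[w - 1]?}

/-- `W[0 : |P| - 1]` is a witness table. -/
def IsWitnessTable (f : List α → List β) (P : List α) (W : ℤ → ℤ) : Prop :=
  ∀ a : ℕ, a < P.length →
    (witnesses f P a = ∅ → W a = 0) ∧
    (witnesses f P a ≠ ∅ → ∃ w ∈ witnesses f P a, W a = w)

/-- Position `i` of the table `W` is finalized. -/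
def Finalized (f : List α → List β) (P : List α) (W : ℤ → ℤ) (i : ℕ) : Prop :=
  (W i = 0 → witnesses f P i = ∅) ∧ (W i ≠ 0 → ∃ w ∈ witnesses f P i, W i = w)

/-- `W[0 : n - 1]` is `s`-sparse: every full `s`-block has exactly one zero, and the remaining
shorter block at the end has at most one. -/
def IsSparse (W : ℤ → ℤ) (n s : ℕ) : Prop :=
  (∀ b : ℕ, (b + 1) * s ≤ n → ∃! i : ℕ, b * s ≤ i ∧ i < (b + 1) * s ∧ W i = 0) ∧
  (∀ i j : ℕ, n / s * s ≤ i → i < n → n / s * s ≤ j → j < n → W i = 0 → W j = 0 → i = j)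

end Strings

/-! ## The P-CRCW PRAM

Programs are built from synchronous parallel blocks by sequencing, branching and looping.  Shared
memory consists of named integer arrays (a scalar is the cell `0` of its array) and of a read-only
array holding the encoded input.  Besides, every processor has private registers.  In a parallel
block all processors run the same list of instructions in lockstep: in each instruction all reads
precede all writes, and if several processors write to the same cell, the one with the smallest
index succeeds.  Time and work are counted as in the work-time framework: an instruction of a
parallel block takes the maximum of the times of the processors, and its work is the sum of
their works. -/

/-- Names of shared arrays. -/
inductive Name
  | m | W | A | size | tail | oldTail | block | p | lcp | check | count | z | rem | l | r | mid | j
  | b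
  deriving DecidableEq

/-- Names of private integer registers. -/
inductive Reg
  | j₁ | j₂ | w | surv | a | q
  deriving DecidableEq

/-- Names of private registers for symbols of the encoding. -/
inductive SymReg
  | p | q
  deriving DecidableEq

/-- Integer arrays of the shared memory. -/
abbrev Mem := Name → ℤ → ℤ

/-- Private registers of one processor. -/
structure Priv (β : Type*) where
  int : Reg → ℤ
  sym : SymReg → Option β

/-- Integer expressions. -/
inductive Expr
  | lit (c : ℤ)
  | idx
  | reg (x : Reg)
  | get (a : Name) (i : Expr)
  | add (e₁ e₂ : Expr)
  | sub (e₁ e₂ : Expr)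
  | mul (e₁ e₂ : Expr)
  | div (e₁ e₂ : Expr)
  | mod (e₁ e₂ : Expr)
  | min (e₁ e₂ : Expr)

/-- Conditions. -/
inductive Cond
  | always
  | eq (e₁ e₂ : Expr)
  | lt (e₁ e₂ : Expr)
  | symEq (s₁ s₂ : SymReg)
  | not (c : Cond)
  | and (c₁ c₂ : Cond)

/-- Number of elementary operations in an expression. -/
def Expr.size : Expr → ℕ
  | .lit _ => 1
  | .idx => 1
  | .reg _ => 1
  | .get _ i => i.size + 1
  | .add e₁ e₂ => e₁.size + e₂.size + 1
  | .sub e₁ e₂ => e₁.size + e₂.size + 1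
  | .mul e₁ e₂ => e₁.size + e₂.size + 1
  | .div e₁ e₂ => e₁.size + e₂.size + 1
  | .mod e₁ e₂ => e₁.size + e₂.size + 1
  | .min e₁ e₂ => e₁.size + e₂.size + 1

/-- Number of elementary operations in a condition. -/
def Cond.size : Cond → ℕ
  | .always => 1
  | .eq e₁ e₂ => e₁.size + e₂.size + 1
  | .lt e₁ e₂ => e₁.size + e₂.size + 1
  | .symEq _ _ => 1
  | .not c => c.size + 1
  | .and c₁ c₂ => c₁.size + c₂.size + 1

section Semantics

variable {β : Type*}

/-- Value of an expression for the processor with index `i` and private registers `ρ`. -/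
def Expr.eval (μ : Mem) (ρ : Priv β) (i : ℤ) : Expr → ℤ
  | .lit c => c
  | .idx => i
  | .reg x => ρ.int x
  | .get a e => μ a (e.eval μ ρ i)
  | .add e₁ e₂ => e₁.eval μ ρ i + e₂.eval μ ρ i
  | .sub e₁ e₂ => e₁.eval μ ρ i - e₂.eval μ ρ i
  | .mul e₁ e₂ => e₁.eval μ ρ i * e₂.eval μ ρ i
  | .div e₁ e₂ => e₁.eval μ ρ i / e₂.eval μ ρ i
  | .mod e₁ e₂ => e₁.eval μ ρ i % e₂.eval μ ρ i
  | .min e₁ e₂ => Min.min (e₁.eval μ ρ i) (e₂.eval μ ρ i)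

/-- Value of a condition. -/
def Cond.eval [DecidableEq β] (μ : Mem) (ρ : Priv β) (i : ℤ) : Cond → Bool
  | .always => true
  | .eq e₁ e₂ => decide (e₁.eval μ ρ i = e₂.eval μ ρ i)
  | .lt e₁ e₂ => decide (e₁.eval μ ρ i < e₂.eval μ ρ i)
  | .symEq s₁ s₂ => decide (ρ.sym s₁ = ρ.sym s₂)
  | .not c => !(c.eval μ ρ i)
  | .and c₁ c₂ => c₁.eval μ ρ i && c₂.eval μ ρ i

/-- A re-encoding subroutine.  Its input is an encoded string `E` and two numbers `x` and `i`; it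
returns a symbol and takes a certain time and work. -/
structure Subroutine (β : Type*) where
  val : List β → ℕ → ℕ → Option β
  time : List β → ℕ → ℕ → ℕ
  work : List β → ℕ → ℕ → ℕ

/-- Given the encoding of a string `X`, the subroutine `R` returns the symbol at position `i` of
the encoding of the suffix `X[x:]`, in at most `ξt |X|` time and at most `ξw |X|` work.  (Every
call takes at least one step.) -/
structure Subroutine.Reencodes {α : Type*} (R : Subroutine β) (f : List α → List β)
    (ξt ξw : ℕ → ℕ) : Prop where
  val_eq : ∀ X x i, 1 ≤ x → 1 ≤ i → x + i ≤ X.length + 1 →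
    R.val (f X) x i = reencoded f X x i
  time_pos : ∀ E x i, 1 ≤ R.time E x i
  work_pos : ∀ E x i, 1 ≤ R.work E x i
  time_le : ∀ X x i, 1 ≤ x → 1 ≤ i → x + i ≤ X.length + 1 → R.time (f X) x i ≤ ξt X.length
  work_le : ∀ X x i, 1 ≤ x → 1 ≤ i → x + i ≤ X.length + 1 → R.work (f X) x i ≤ ξw X.length

/-- Instructions of a processor. -/
inductive Op
  /-- assign to a private register -/
  | set (x : Reg) (e : Expr)
  /-- read the symbol at a position (1-based) of the encoded input -/
  | load (s : SymReg) (i : Expr)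
  /-- call the re-encoding subroutine: position `i` with respect to the suffix from `x` on -/
  | reenc (s : SymReg) (x i : Expr)
  /-- write the value `v` to the cell `a[i]` of the shared memory -/
  | write (a : Name) (i v : Expr)

/-- A guarded instruction; processors for which the guard fails are idle. -/
structure Instr where
  guard : Cond
  op : Op

/-- Cost of an instruction for a processor; `call x i` is the cost of a call. -/
def Op.cost (call : ℕ → ℕ → ℕ) (μ : Mem) (ρ : Priv β) (i : ℤ) : Op → ℕ
  | .set _ e => e.size + 1
  | .load _ e => e.size + 1
  | .reenc _ x e => x.size + e.size + 1 + call (x.eval μ ρ i).toNat (e.eval μ ρ i).toNat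
  | .write _ e v => e.size + v.size + 1

/-- Cost of a guarded instruction for a processor. -/
def Instr.cost [DecidableEq β] (call : ℕ → ℕ → ℕ) (μ : Mem) (ρ : Priv β) (i : ℤ)
    (s : Instr) : ℕ :=
  s.guard.size + if s.guard.eval μ ρ i then s.op.cost call μ ρ i else 0

/-- Effect of a guarded instruction on the private registers of a processor. -/
def Instr.priv [DecidableEq β] (E : List β) (R : Subroutine β) (μ : Mem) (ρ : Priv β) (i : ℤ)
    (s : Instr) : Priv β :=
  if s.guard.eval μ ρ i then
    match s.op with
    | .set v e => { ρ with int := Function.update ρ.int v (e.eval μ ρ i) }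
    | .load s e => { ρ with sym := Function.update ρ.sym s E[(e.eval μ ρ i).toNat - 1]? }
    | .reenc s x e => { ρ with
        sym := Function.update ρ.sym s (R.val E (x.eval μ ρ i).toNat (e.eval μ ρ i).toNat) }
    | .write _ _ _ => ρ
  else ρ

/-- The write request (array, index, value) of a processor, if any. -/
def Instr.request [DecidableEq β] (μ : Mem) (ρ : Priv β) (i : ℤ) (s : Instr) :
    Option (Name × ℤ × ℤ) :=
  if s.guard.eval μ ρ i then
    match s.op with
    | .write a e v => some (a, e.eval μ ρ i, v.eval μ ρ i)
    | _ => none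
  else none

/-- Priority write: for every cell, the first request for it in the list is granted. -/
def grant (μ : Mem) (reqs : List (Name × ℤ × ℤ)) : Mem := fun a j =>
  match reqs.find? (fun q => decide (q.1 = a ∧ q.2.1 = j)) with
  | some q => q.2.2
  | none => μ a j

/-- The processors `lo, lo + 1, …, hi` in increasing order. -/
def procs (lo hi : ℤ) : List ℤ := (List.range (hi + 1 - lo).toNat).map fun n => lo + n

/-- Lockstep execution of a list of instructions by the processors in the list `I`, with private
registers `ρ i`.  Returns the final memory, the time and the work. -/
def runBlock [DecidableEq β] (E : List β) (R : Subroutine β) (I : List ℤ) :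
    List Instr → Mem → (ℤ → Priv β) → Mem × ℕ × ℕ
  | [], μ, _ => (μ, 0, 0)
  | s :: ss, μ, ρ =>
    let next := runBlock E R I ss (grant μ (I.filterMap fun i => s.request μ (ρ i) i))
      (fun i => s.priv E R μ (ρ i) i)
    (next.1,
      1 + (I.map fun i => s.cost (R.time E) μ (ρ i) i).foldr max 0 + next.2.1,
      1 + (I.map fun i => s.cost (R.work E) μ (ρ i) i).sum + next.2.2)

/-- Initial private registers. -/
def Priv.init : Priv β := ⟨fun _ => 0, fun _ => none⟩

end Semantics

/-- Programs. -/
inductive Prog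
  | skip
  /-- `for each i ∈ {lo, …, hi} do in parallel` -/
  | par (lo hi : Expr) (block : List Instr)
  | seq (c₁ c₂ : Prog)
  | ite (g : Cond) (c₁ c₂ : Prog)
  | while (g : Cond) (c : Prog)

/-- `Exec E R c μ μ' t w`: with encoded input `E` and re-encoding subroutine `R`, the program `c`
started in the memory `μ` halts in the memory `μ'` after `t` time and `w` work. -/
inductive Exec {β : Type*} [DecidableEq β] (E : List β) (R : Subroutine β) :
    Prog → Mem → Mem → ℕ → ℕ → Prop
  | skip (μ : Mem) : Exec E R .skip μ μ 0 0
  | par (lo hi : Expr) (block : List Instr) (μ μ' : Mem) (t w : ℕ) :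
      runBlock E R (procs (lo.eval μ (Priv.init (β := β)) 0) (hi.eval μ (Priv.init (β := β)) 0))
        block μ (fun _ => Priv.init) = (μ', t, w) →
      Exec E R (.par lo hi block) μ μ' (lo.size + hi.size + t) (lo.size + hi.size + w)
  | seq (c₁ c₂ : Prog) (μ μ₁ μ₂ : Mem) (t₁ w₁ t₂ w₂ : ℕ) :
      Exec E R c₁ μ μ₁ t₁ w₁ → Exec E R c₂ μ₁ μ₂ t₂ w₂ →
      Exec E R (.seq c₁ c₂) μ μ₂ (t₁ + t₂) (w₁ + w₂)
  | iteTrue (g : Cond) (c₁ c₂ : Prog) (μ μ' : Mem) (t w : ℕ) :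
      g.eval μ (Priv.init (β := β)) 0 = true → Exec E R c₁ μ μ' t w →
      Exec E R (.ite g c₁ c₂) μ μ' (g.size + t) (g.size + w)
  | iteFalse (g : Cond) (c₁ c₂ : Prog) (μ μ' : Mem) (t w : ℕ) :
      g.eval μ (Priv.init (β := β)) 0 = false → Exec E R c₂ μ μ' t w →
      Exec E R (.ite g c₁ c₂) μ μ' (g.size + t) (g.size + w)
  | whileTrue (g : Cond) (c : Prog) (μ μ₁ μ₂ : Mem) (t₁ w₁ t₂ w₂ : ℕ) :
      g.eval μ (Priv.init (β := β)) 0 = true → Exec E R c μ μ₁ t₁ w₁ →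
      Exec E R (.while g c) μ₁ μ₂ t₂ w₂ →
      Exec E R (.while g c) μ μ₂ (g.size + t₁ + t₂) (g.size + w₁ + w₂)
  | whileFalse (g : Cond) (c : Prog) (μ : Mem) :
      g.eval μ (Priv.init (β := β)) 0 = false →
      Exec E R (.while g c) μ μ g.size g.size

/-! ## The preprocessing algorithm -/

section Algorithm

/-- The scalar variable `a`. -/
def Name.val (a : Name) : Expr := .get a (.lit 0)

def Cond.ne (e₁ e₂ : Expr) : Cond := .not (.eq e₁ e₂)

/-- Sequential assignment `a[i] ← e`, by a single processor. -/
def store (a : Name) (i e : Expr) : Prog := .par (.lit 0) (.lit 0) [⟨.always, .write a i e⟩]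

/-- Sequential assignment `a ← e` to a scalar. -/
def assign (a : Name) (e : Expr) : Prog := store a (.lit 0) e

/-- Sequential composition of a list of programs. -/
def block : List Prog → Prog
  | [] => .skip
  | c :: cs => .seq c (block cs)

/-- `check ←` the tight mismatch position of `P` and `P[x+1:]` on their overlap, or `0`. -/
def checkParallel (x : Expr) : Prog := block [
  assign .check (.lit 0),
  .par (.lit 1) (.sub Name.m.val x) [
    ⟨.always, .load .p .idx⟩,
    ⟨.always, .reenc .q (.add x (.lit 1)) .idx⟩,
    ⟨.not (.symEq .p .q), .write .check (.lit 0) .idx⟩]]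

/-- With `block = 2^k`: create the array `A[0 : size - 1]`, where
`size = ⌊r / 2^k⌋ - ⌊l / 2^k⌋ + 1`, of the zero positions of `W[l : r]`, one per `2^k`-block;
`-1` stands for none. -/
def getZeros (l r : Expr) : Prog := block [
  assign .size (.add (.sub (.div r Name.block.val) (.div l Name.block.val)) (.lit 1)),
  .par (.lit 0) (.sub Name.size.val (.lit 1)) [⟨.always, .write .A .idx (.lit (-1))⟩],
  .par l r [
    ⟨.eq (.get .W .idx) (.lit 0),
      .write .A (.sub (.div .idx Name.block.val) (.div l Name.block.val)) .idx⟩]]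

/-- Both private registers `j₁` and `j₂` hold positions. -/
def bothFound : Cond := .and (.ne (.reg .j₁) (.lit (-1))) (.ne (.reg .j₂) (.lit (-1)))

/-- Duels between the zeros of neighbouring `2^k`-blocks of `W[2^(k+1) : x]`, which make
`W[0 : x]` a `2^(k+1)`-sparse table. -/
def satisfySparsity (x : Expr) : Prog := block [
  getZeros (.mul (.lit 2) Name.block.val) x,
  .par (.lit 0) (.sub (.div Name.size.val (.lit 2)) (.lit 1)) [
    ⟨.always, .set .j₁ (.get .A (.mul (.lit 2) .idx))⟩,
    ⟨.always, .set .j₂ (.get .A (.add (.mul (.lit 2) .idx) (.lit 1)))⟩,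
    ⟨bothFound, .set .w (.get .W (.sub (.reg .j₂) (.reg .j₁)))⟩,
    ⟨bothFound, .load .p (.reg .w)⟩,
    ⟨bothFound, .reenc .q (.add (.reg .j₂) (.lit 1)) (.reg .w)⟩,
    ⟨.and bothFound (.symEq .p .q), .set .surv (.reg .j₂)⟩,
    ⟨.and bothFound (.not (.symEq .p .q)), .set .surv (.reg .j₁)⟩,
    ⟨bothFound, .set .a (.sub (.reg .j₂) (.reg .j₁))⟩,
    ⟨.and bothFound (.eq (.reg .surv) (.reg .j₁)), .write .W (.reg .j₂) (.get .W (.reg .a))⟩,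
    ⟨.and bothFound (.eq (.reg .surv) (.reg .j₂)),
      .write .W (.reg .j₁) (.add (.get .W (.reg .a)) (.reg .a))⟩]]

/-- Finalize the positions `i` with `tail ≤ i < oldTail` and `i ≡ z (mod p)`, by a binary search
for the largest one that is not a period. -/
def finalizeClass : Prog := block [
  assign .rem (.mod Name.z.val Name.p.val),
  assign .l (.sub (.div (.sub (.add (.sub Name.tail.val Name.rem.val) Name.p.val) (.lit 1))
    Name.p.val) (.lit 1)),
  assign .r (.add (.div (.sub (.sub Name.oldTail.val (.lit 1)) Name.rem.val) Name.p.val)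
    (.lit 1)),
  .while (.lt (.lit 1) (.sub Name.r.val Name.l.val)) (block [
    assign .mid (.div (.add Name.l.val Name.r.val) (.lit 2)),
    assign .j (.add (.mul Name.mid.val Name.p.val) Name.rem.val),
    checkParallel Name.j.val,
    .ite (.eq Name.check.val (.lit 0)) (assign .r Name.mid.val) (assign .l Name.mid.val)]),
  assign .b (.add (.mul Name.l.val Name.p.val) Name.rem.val),
  checkParallel Name.b.val,
  .par Name.tail.val Name.b.val [
    ⟨.and (.eq (.get .W .idx) (.lit 0))
        (.eq (.mod .idx Name.p.val) (.mod Name.b.val Name.p.val)),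
      .write .W .idx (.sub (.add Name.check.val Name.b.val) .idx)⟩]]

/-- `for i = 0 to size - 1: z ← A[i]; if z ≠ -1 then c`. -/
def forFound (c : Prog) : Prog := block [
  assign .count (.lit 0),
  .while (.lt Name.count.val Name.size.val) (block [
    assign .z (.get .A Name.count.val),
    .ite (.ne Name.z.val (.lit (-1))) c .skip,
    assign .count (.add Name.count.val (.lit 1))])]

/-- Finalize the positions `tail, …, oldTail - 1`.  In the second case, the register `q` of
processor `i` is the number in `{oldTail - p, …, oldTail - 1}` congruent to `i` modulo `p`. -/
def finalizeTail : Prog :=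
  .ite (.eq (.sub Name.oldTail.val Name.tail.val) Name.block.val)
    (block [
      getZeros Name.tail.val (.sub Name.oldTail.val (.lit 1)),
      forFound (block [checkParallel Name.z.val, store .W Name.z.val Name.check.val])])
    (block [
      .par Name.tail.val (.sub Name.oldTail.val (.lit 1)) [
        ⟨.always, .set .q (.sub (.sub Name.oldTail.val (.lit 1))
          (.mod (.sub (.sub Name.oldTail.val (.lit 1)) .idx) Name.p.val))⟩,
        ⟨.and (.eq (.get .W .idx) (.lit 0)) (.ne (.get .W (.reg .q)) (.lit 0)),
          .write .W .idx (.sub (.add (.get .W (.reg .q)) (.reg .q)) .idx)⟩],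
      getZeros (.sub Name.oldTail.val Name.p.val) (.sub Name.oldTail.val (.lit 1)),
      forFound finalizeClass])

/-- Initialization: the whole table is zero and is the head. -/
def setup : Prog := block [
  .par (.lit 0) (.sub Name.m.val (.lit 1)) [⟨.always, .write .W .idx (.lit 0)⟩],
  assign .tail Name.m.val,
  assign .block (.lit 1)]

/-- The loop condition `2^k < tail`, where `block = 2^k`. -/
def roundGuard : Cond := .lt Name.block.val Name.tail.val

/-- One round.  The suspected period `p` is the zero in the second `2^k`-block of the head, if
there is one. -/
def roundBody : Prog := block [
  getZeros Name.block.val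
    (.sub (.min (.mul (.lit 2) Name.block.val) Name.tail.val) (.lit 1)),
  assign .p (.get .A (.lit 0)),
  .ite (.ne Name.p.val (.lit (-1)))
    (block [
      checkParallel Name.p.val,
      store .W Name.p.val Name.check.val,
      .ite (.eq (.get .W Name.p.val) (.lit 0))
        (assign .lcp (.sub Name.m.val Name.p.val))
        (assign .lcp (.sub (.get .W Name.p.val) (.lit 1))),
      assign .oldTail Name.tail.val,
      assign .tail (.min (.sub Name.oldTail.val Name.block.val)
        (.sub Name.m.val Name.lcp.val)),
      satisfySparsity (.sub Name.tail.val (.lit 1)),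
      finalizeTail])
    .skip,
  assign .block (.mul (.lit 2) Name.block.val)]

/-- The pattern preprocessing algorithm.  Its input is the encoded pattern and, in the variable
`m`, the length of the pattern; its output is the array `W[0 : m - 1]`. -/
def preprocessing : Prog := .seq setup (.while roundGuard roundBody)

/-- `AtRound E R μ k μ'`: started in the memory `μ`, the algorithm evaluates the loop condition
after `k` complete rounds in the memory `μ'`. -/
inductive AtRound {β : Type*} [DecidableEq β] (E : List β) (R : Subroutine β) (μ : Mem) :
    ℕ → Mem → Prop
  | zero (μ' : Mem) (t w : ℕ) : Exec E R setup μ μ' t w → AtRound E R μ 0 μ'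
  | succ (k : ℕ) (μ₁ μ₂ : Mem) (t w : ℕ) : AtRound E R μ k μ₁ →
      roundGuard.eval μ₁ (Priv.init (β := β)) 0 = true → Exec E R roundBody μ₁ μ₂ t w →
      AtRound E R μ (k + 1) μ₂

/-- The state of the table after `k` rounds: the head `W[0 : h - 1]` is `2^k`-sparse, its nonzero
entries are witnesses and are at most `|tail| + 2^k`, and the tail `W[h : m - 1]` is finalized. -/
def RoundInvariant {α β : Type*} (f : List α → List β) (P : List α) (k : ℕ) (μ : Mem) : Prop :=
  ∃ h : ℕ, μ .tail 0 = h ∧ h ≤ P.length ∧ μ .block 0 = 2 ^ k ∧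
    IsSparse (μ .W) h (2 ^ k) ∧
    (∀ i : ℕ, i < h →
      (μ .W i ≠ 0 → ∃ w ∈ witnesses f P i, μ .W i = w) ∧
      μ .W i ≤ ((P.length - h + 2 ^ k : ℕ) : ℤ)) ∧
    (∀ i : ℕ, h ≤ i → i < P.length → Finalized f P (μ .W) i)

end Algorithm

end WitnessPRAM

open WitnessPRAM

/-! Everything rests on one property of encodings, `Transfers`: if two suffixes of the pattern have
the same code symbol at position w, they still have the same symbol there after both lose their
first j < w symbols. Two ways of making new witnesses from old ones follow. In a duel (`Wit.duel`),
a witness w for j₂ - j₁ with j₂ + w ≤ m is a witness for j₂ or, shifted by j₂ - j₁, for j₁. In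
propagation (`Wit.of_dvd`), if the pattern and its copy shifted by p agree on lcp symbols, a witness
for b yields one for every smaller i ≥ m - lcp in the class of b modulo p. A round doubles the block
length s = 2^k. Once p has been checked, every offset 0 < a < 2s inside the new head has a witness
(`RoundInv.first_blocks`), so any two zeros in one later 2s-block can be played against each other.
The duel needs j₂ + w ≤ m. For this reason the head gives up at least s positions and all positions
from m - lcp on: old entries are at most m - old + s ≤ m - tail, and the entry at p, if p stays in
the head, is lcp + 1 ≤ m - tail + 1. A duel adds less than 2s to such a value, which restores the
size bound for the next round (`RoundInv.succ_of_found`). The positions given up must be finalized.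
If there are exactly s of them, they contain at most two zeros, and each is checked. Otherwise tail
= m - lcp, so propagation applies to all of them: in each class modulo p the offsets with a witness
form an initial segment. Copying from the last p positions settles all classes whose representative
there is nonzero. Since p < 2s, at most three zeros lie among these positions, and a binary search
settles each of their classes (`runs_finalizeClass`). When 2^k ≥ tail, the head lies in a single
block, whose only zero is the offset 0, so the whole table is final. As 2^k < tail ≤ m in each
executed round, there are at most ⌈log₂ m⌉ rounds, each of O(log m) parallel checks. The judgement
`Runs` counts such steps in units of one subroutine call for time, and of one call on each of N
processors for work. One count thus gives both bounds, with N = m + 1. -/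

namespace WitnessPRAM

/-! ## A program logic with time and work bounds -/

section Logic

variable {β : Type*} [DecidableEq β]

/-- Static bound for the cost of an operation, in units of the cost of a subroutine call. -/
def Op.bound : Op → ℕ
  | .set _ e => e.size + 1
  | .load _ e => e.size + 1
  | .reenc _ x e => x.size + e.size + 2
  | .write _ e v => e.size + v.size + 1

/-- Static bound for the cost of an instruction, in units of the cost of a subroutine call. -/
def Instr.bound (s : Instr) : ℕ := s.guard.size + s.op.bound

/-- Encoded input, subroutine, bounds for the time and work of a call of the subroutine, and a
bound for the number of processors. -/
structure Env (β : Type*) where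
  E : List β
  R : Subroutine β
  τ : ℕ
  ω : ℕ
  N : ℕ
  τ_pos : 1 ≤ τ
  ω_pos : 1 ≤ ω
  N_pos : 1 ≤ N

variable (V : Env β)

/-- If the instruction calls the subroutine, the cost of the call is within the bounds. -/
def Instr.CallsLe (μ : Mem) (ρ : Priv β) (i : ℤ) (s : Instr) : Prop :=
  s.guard.eval μ ρ i = true →
    match s.op with
    | .reenc _ x e =>
        V.R.time V.E (x.eval μ ρ i).toNat (e.eval μ ρ i).toNat ≤ V.τ ∧
        V.R.work V.E (x.eval μ ρ i).toNat (e.eval μ ρ i).toNat ≤ V.ω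
    | _ => True

lemma le_mul_of_pos_bound {a K : ℕ} (hK : 1 ≤ K) : a ≤ a * K := Nat.le_mul_of_pos_right _ hK

/-- Since K ≥ 1, all elementary operations are covered by their number times K. The extra unit that
`Op.bound` grants to `reenc` pays for the call. -/
lemma Instr.cost_le (call : ℕ → ℕ → ℕ) (K : ℕ) (hK : 1 ≤ K) (μ : Mem) (ρ : Priv β) (i : ℤ)
    (s : Instr) (h : s.guard.eval μ ρ i = true →
      match s.op with
      | .reenc _ x e => call (x.eval μ ρ i).toNat (e.eval μ ρ i).toNat ≤ K
      | _ => True) :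
    s.cost call μ ρ i ≤ s.bound * K := by
  obtain ⟨g, op⟩ := s
  unfold Instr.cost Instr.bound
  rw [Nat.add_mul]
  refine Nat.add_le_add (le_mul_of_pos_bound hK) ?_
  split_ifs with hg
  · have h := h hg
    cases op with
    | reenc s x e =>
      simp only [Op.cost, Op.bound] at h ⊢
      have := le_mul_of_pos_bound (a := x.size + e.size + 1) hK
      rw [show x.size + e.size + 2 = (x.size + e.size + 1) + 1 from rfl, Nat.add_mul, Nat.one_mul]
      exact Nat.add_le_add this h
    | _ => exact le_mul_of_pos_bound hK
  · exact Nat.zero_le _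

/-- Weakest precondition of a parallel block. -/
def wp (I : List ℤ) : List Instr → Mem → (ℤ → Priv β) → (Mem → Prop) → Prop
  | [], μ, _, Q => Q μ
  | s :: ss, μ, ρ, Q =>
    (∀ i ∈ I, s.CallsLe V μ (ρ i) i) ∧
      wp I ss (grant μ (I.filterMap fun i => s.request μ (ρ i) i))
        (fun i => s.priv V.E V.R μ (ρ i) i) Q

/-- Static cost bound for a parallel block. -/
def blockBound (ss : List Instr) : ℕ := (ss.map fun s => s.bound + 1).sum

lemma foldr_max_le {l : List ℕ} {K : ℕ} (h : ∀ x ∈ l, x ≤ K) : l.foldr max 0 ≤ K := by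
  induction l with
  | nil => exact Nat.zero_le _
  | cons a l ih =>
    simp only [List.foldr_cons]
    exact max_le (h a (by simp)) (ih fun x hx => h x (by simp [hx]))

/-- Time is a maximum over the processors and so does not depend on their number, whereas work is a
sum of at most N terms. The additional 1 per instruction in `blockBound` pays for the step that the
semantics charges for each instruction. -/
lemma runBlock_of_wp (I : List ℤ) (hI : I.length ≤ V.N) (ss : List Instr) (Q : Mem → Prop) :
    ∀ (μ : Mem) (ρ : ℤ → Priv β), wp V I ss μ ρ Q →
      Q (runBlock V.E V.R I ss μ ρ).1 ∧
      (runBlock V.E V.R I ss μ ρ).2.1 ≤ blockBound ss * V.τ ∧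
      (runBlock V.E V.R I ss μ ρ).2.2 ≤ blockBound ss * (V.ω * V.N) := by
  induction ss with
  | nil => intro μ ρ h; exact ⟨h, by simp [runBlock], by simp [runBlock]⟩
  | cons s ss ih =>
    intro μ ρ h
    obtain ⟨hc, h⟩ := h
    obtain ⟨h1, h2, h3⟩ := ih _ _ h
    refine ⟨h1, ?_, ?_⟩
    · have : (I.map fun i => s.cost (V.R.time V.E) μ (ρ i) i).foldr max 0 ≤ s.bound * V.τ := by
        refine foldr_max_le fun x hx => ?_
        obtain ⟨i, hi, rfl⟩ := List.mem_map.1 hx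
        refine Instr.cost_le _ _ V.τ_pos _ _ _ _ fun hg => ?_
        have := hc i hi hg
        revert this
        cases s.op <;> simp +contextual
      have h0 := V.τ_pos
      simp only [runBlock, blockBound, List.map_cons, List.sum_cons, Nat.add_mul] at h2 ⊢
      omega
    · have : (I.map fun i => s.cost (V.R.work V.E) μ (ρ i) i).sum ≤ s.bound * (V.ω * V.N) := by
        have := List.sum_le_card_nsmul (I.map fun i => s.cost (V.R.work V.E) μ (ρ i) i)
          (s.bound * V.ω) (by
            intro x hx
            obtain ⟨i, hi, rfl⟩ := List.mem_map.1 hx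
            refine Instr.cost_le _ _ V.ω_pos _ _ _ _ fun hg => ?_
            have := hc i hi hg
            revert this
            cases s.op <;> simp +contextual)
        rw [List.length_map, smul_eq_mul] at this
        calc _ ≤ I.length * (s.bound * V.ω) := this
          _ ≤ V.N * (s.bound * V.ω) := Nat.mul_le_mul_right _ hI
          _ = _ := by ring
      have h0 : 1 ≤ V.ω * V.N := Nat.mul_pos V.ω_pos V.N_pos
      simp only [runBlock, blockBound, List.map_cons, List.sum_cons, Nat.add_mul] at h3 ⊢
      omega

/-- Started in `μ`, the program `c` halts within `n` units of time and work in a memory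
satisfying `Q`. -/
def Runs (c : Prog) (μ : Mem) (n : ℕ) (Q : Mem → Prop) : Prop :=
  ∃ μ' t w, Exec V.E V.R c μ μ' t w ∧ t ≤ n * V.τ ∧ w ≤ n * (V.ω * V.N) ∧ Q μ'

variable {V}

omit [DecidableEq β] in
lemma Env.le_time (n : ℕ) : n ≤ n * V.τ := le_mul_of_pos_bound V.τ_pos

omit [DecidableEq β] in
lemma Env.le_work (n : ℕ) : n ≤ n * (V.ω * V.N) :=
  le_mul_of_pos_bound (Nat.mul_pos V.ω_pos V.N_pos)

/-! ### Proof rules for the sequential constructs. -/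

lemma Runs.mono {c : Prog} {μ : Mem} {n K : ℕ} {Q Q' : Mem → Prop} (h : Runs V c μ n Q)
    (hn : n ≤ K) (hQ : ∀ μ', Q μ' → Q' μ') : Runs V c μ K Q' := by
  obtain ⟨μ', t, w, he, ht, hw, hq⟩ := h
  exact ⟨μ', t, w, he, ht.trans (Nat.mul_le_mul_right _ hn), hw.trans (Nat.mul_le_mul_right _ hn),
    hQ _ hq⟩

lemma Runs.le {c : Prog} {μ : Mem} {n K : ℕ} {Q : Mem → Prop} (h : Runs V c μ n Q)
    (hn : n ≤ K) : Runs V c μ K Q := h.mono hn fun _ => id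

lemma Runs.skip {μ : Mem} {n : ℕ} {Q : Mem → Prop} (h : Q μ) : Runs V .skip μ n Q :=
  ⟨μ, 0, 0, .skip μ, Nat.zero_le _, Nat.zero_le _, h⟩

lemma Runs.seq {c₁ c₂ : Prog} {μ : Mem} {n₁ n₂ : ℕ} {Q : Mem → Prop}
    (h : Runs V c₁ μ n₁ fun μ' => Runs V c₂ μ' n₂ Q) : Runs V (.seq c₁ c₂) μ (n₁ + n₂) Q := by
  obtain ⟨μ₁, t₁, w₁, he₁, ht₁, hw₁, μ₂, t₂, w₂, he₂, ht₂, hw₂, hq⟩ := h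
  refine ⟨μ₂, _, _, .seq _ _ _ _ _ _ _ _ _ he₁ he₂, ?_, ?_, hq⟩
  · rw [Nat.add_mul]; exact Nat.add_le_add ht₁ ht₂
  · rw [Nat.add_mul]; exact Nat.add_le_add hw₁ hw₂

lemma Runs.cons {c : Prog} {cs : List Prog} {μ : Mem} {n₁ n₂ : ℕ} {Q : Mem → Prop}
    (h : Runs V c μ n₁ fun μ' => Runs V (block cs) μ' n₂ Q) :
    Runs V (block (c :: cs)) μ (n₁ + n₂) Q := Runs.seq h

lemma Runs.last {c : Prog} {μ : Mem} {n : ℕ} {Q : Mem → Prop} (h : Runs V c μ n Q) :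
    Runs V (block [c]) μ n Q := by
  have h' : Runs V c μ n fun μ' => Runs V (block []) μ' 0 Q := h.mono le_rfl fun _ => Runs.skip
  exact Runs.cons h'

lemma Runs.ite {g : Cond} {c₁ c₂ : Prog} {μ : Mem} {n : ℕ} {Q : Mem → Prop}
    (h₁ : g.eval μ (Priv.init (β := β)) 0 = true → Runs V c₁ μ n Q)
    (h₂ : g.eval μ (Priv.init (β := β)) 0 = false → Runs V c₂ μ n Q) :
    Runs V (.ite g c₁ c₂) μ (g.size + n) Q := by
  cases hg : g.eval μ (Priv.init (β := β)) 0 with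
  | true =>
    obtain ⟨μ', t, w, he, ht, hw, hq⟩ := h₁ hg
    refine ⟨μ', _, _, .iteTrue _ _ _ _ _ _ _ hg he, ?_, ?_, hq⟩
    · rw [Nat.add_mul]; exact Nat.add_le_add (Env.le_time _) ht
    · rw [Nat.add_mul]; exact Nat.add_le_add (Env.le_work _) hw
  | false =>
    obtain ⟨μ', t, w, he, ht, hw, hq⟩ := h₂ hg
    refine ⟨μ', _, _, .iteFalse _ _ _ _ _ _ _ hg he, ?_, ?_, hq⟩
    · rw [Nat.add_mul]; exact Nat.add_le_add (Env.le_time _) ht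
    · rw [Nat.add_mul]; exact Nat.add_le_add (Env.le_work _) hw

/-- Loops: `Inv n` holds when at most `n` further iterations are needed. -/
lemma Runs.while {g : Cond} {c : Prog} {b : ℕ} {Q : Mem → Prop} (Inv : ℕ → Mem → Prop)
    (h0 : ∀ μ, Inv 0 μ → g.eval μ (Priv.init (β := β)) 0 = false)
    (hs : ∀ n μ, Inv (n + 1) μ → g.eval μ (Priv.init (β := β)) 0 = true →
      Runs V c μ b (Inv n))
    (hQ : ∀ n μ, Inv n μ → g.eval μ (Priv.init (β := β)) 0 = false → Q μ) :
    ∀ n μ, Inv n μ → Runs V (.while g c) μ (n * (g.size + b) + g.size) Q := by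
  intro n
  induction n with
  | zero =>
    intro μ h
    refine ⟨μ, _, _, .whileFalse _ _ _ (h0 μ h), ?_, ?_, hQ _ _ h (h0 μ h)⟩
    · simpa using Env.le_time (V := V) g.size
    · simpa using Env.le_work (V := V) g.size
  | succ n ih =>
    intro μ h
    cases hg : g.eval μ (Priv.init (β := β)) 0 with
    | false =>
      refine ⟨μ, _, _, .whileFalse _ _ _ hg, ?_, ?_, hQ _ _ h hg⟩
      · refine (Env.le_time (V := V) g.size).trans (Nat.mul_le_mul_right _ (Nat.le_add_left _ _))
      · refine (Env.le_work (V := V) g.size).trans (Nat.mul_le_mul_right _ (Nat.le_add_left _ _))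
    | true =>
      obtain ⟨μ₁, t₁, w₁, he₁, ht₁, hw₁, hi⟩ := hs n μ h hg
      obtain ⟨μ₂, t₂, w₂, he₂, ht₂, hw₂, hq⟩ := ih _ hi
      refine ⟨μ₂, _, _, .whileTrue _ _ _ _ _ _ _ _ _ hg he₁ he₂, ?_, ?_, hq⟩
      · have := Env.le_time (V := V) g.size
        calc _ ≤ g.size * V.τ + b * V.τ + (n * (g.size + b) + g.size) * V.τ := by omega
          _ = _ := by ring
      · have := Env.le_work (V := V) g.size
        calc _ ≤ g.size * (V.ω * V.N) + b * (V.ω * V.N)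
              + (n * (g.size + b) + g.size) * (V.ω * V.N) := by omega
          _ = _ := by ring

/-! ### Processors and priority writes. -/

lemma procs_eq (lo hi : ℤ) :
    procs lo hi = (List.range (hi + 1 - lo).toNat).map fun n : ℕ => lo + (n : ℤ) := by
  simp [procs, List.map_eq_flatMap, List.flatMap_assoc]

lemma length_procs (lo hi : ℤ) : (procs lo hi).length = (hi + 1 - lo).toNat := by
  simp [procs_eq]

lemma mem_procs {lo hi i : ℤ} : i ∈ procs lo hi ↔ lo ≤ i ∧ i ≤ hi := by
  simp only [procs_eq, List.mem_map, List.mem_range]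
  constructor
  · rintro ⟨n, hn, rfl⟩; omega
  · intro h; exact ⟨(i - lo).toNat, by omega, by omega⟩

lemma procs_sorted (lo hi : ℤ) : (procs lo hi).Pairwise (· ≤ ·) := by
  rw [procs_eq, List.pairwise_map]
  exact List.pairwise_lt_range.imp fun h => by omega

lemma Runs.par {lo hi : Expr} {ss : List Instr} {μ : Mem} {Q : Mem → Prop} (l h : ℤ)
    (hl : lo.eval μ (Priv.init (β := β)) 0 = l) (hh : hi.eval μ (Priv.init (β := β)) 0 = h)
    (hN : h + 1 - l ≤ V.N) (H : wp V (procs l h) ss μ (fun _ => Priv.init) Q) :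
    Runs V (.par lo hi ss) μ (lo.size + hi.size + blockBound ss) Q := by
  have := runBlock_of_wp V (procs l h) (by rw [length_procs]; omega) ss Q μ _ H
  refine ⟨_, _, _, .par lo hi ss μ _ _ _ rfl, ?_, ?_, ?_⟩
  · rw [hl, hh, Nat.add_mul]; exact Nat.add_le_add (Env.le_time _) this.2.1
  · rw [hl, hh, Nat.add_mul]; exact Nat.add_le_add (Env.le_work _) this.2.2
  · rw [hl, hh]; exact this.1

/-- Result of a parallel write. -/
lemma grant_filterMap (μ : Mem) {I : List ℤ} (hI : I.Pairwise (· ≤ ·))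
    (g : ℤ → Option (Name × ℤ × ℤ)) (a : Name) (j : ℤ) :
    ((∀ i ∈ I, ∀ v, g i ≠ some (a, j, v)) ∧ grant μ (I.filterMap g) a j = μ a j) ∨
    ∃ i ∈ I, g i = some (a, j, grant μ (I.filterMap g) a j) ∧
      ∀ i' ∈ I, ∀ v, g i' = some (a, j, v) → i ≤ i' := by
  induction I with
  | nil => left; simp [grant]
  | cons x I ih =>
    rw [List.pairwise_cons] at hI
    -- In a sorted list the head wins the cell whenever it requests it; otherwise it can be removed
    -- without changing the result at this cell.
    by_cases hx : ∃ v, g x = some (a, j, v)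
    · obtain ⟨v, hv⟩ := hx
      right
      refine ⟨x, by simp, ?_, ?_⟩
      · rw [List.filterMap_cons, hv]; simp [grant]
      · intro i' hi' v' _
        rcases List.mem_cons.1 hi' with rfl | h
        · exact le_rfl
        · exact hI.1 _ h
    · push Not at hx
      have hg : grant μ ((x :: I).filterMap g) a j = grant μ (I.filterMap g) a j := by
        rw [List.filterMap_cons]
        cases hgx : g x with
        | none => rfl
        | some q =>
          obtain ⟨a', j', v'⟩ := q
          have : ¬ (a' = a ∧ j' = j) := by
            rintro ⟨rfl, rfl⟩; exact hx v' hgx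
          simp [grant, this]
      rw [hg]
      rcases ih hI.2 with ⟨h1, h2⟩ | ⟨i, hi, h1, h2⟩
      · left
        refine ⟨fun i hi v => ?_, h2⟩
        rcases List.mem_cons.1 hi with rfl | h
        · exact hx v
        · exact h1 i h v
      · right
        refine ⟨i, by simp [hi], h1, fun i' hi' v hv => ?_⟩
        rcases List.mem_cons.1 hi' with rfl | h
        · exact absurd hv (hx v)
        · exact h2 i' h v hv

/-- A parallel write to a single array. -/
lemma grant_eq_update (μ : Mem) (I : List ℤ) (g : ℤ → Option (Name × ℤ × ℤ)) (a : Name)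
    (h : ∀ i ∈ I, ∀ q, g i = some q → q.1 = a) :
    grant μ (I.filterMap g) = Function.update μ a (grant μ (I.filterMap g) a) := by
  funext c
  by_cases hb : c = a
  · subst hb; simp
  · rw [Function.update_of_ne hb]
    funext j
    have : (I.filterMap g).find? (fun q => decide (q.1 = c ∧ q.2.1 = j)) = none := by
      rw [List.find?_eq_none]
      intro q hq
      obtain ⟨i, hi, hg⟩ := List.mem_filterMap.1 hq
      simp [h i hi q hg, Ne.symm hb]
    simp only [grant, this]

lemma grant_of_none (μ : Mem) (I : List ℤ) (g : ℤ → Option (Name × ℤ × ℤ))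
    (h : ∀ i ∈ I, g i = none) : grant μ (I.filterMap g) = μ := by
  rw [List.filterMap_eq_nil_iff.2 h]; rfl

/-- An instruction that writes nothing. -/
lemma wp_cons_of_no_write {I : List ℤ} {s : Instr} {ss : List Instr} {μ : Mem}
    {ρ : ℤ → Priv β} {Q : Mem → Prop} (hn : ∀ a e v, s.op ≠ .write a e v)
    (hc : ∀ i ∈ I, s.CallsLe V μ (ρ i) i)
    (h : wp V I ss μ (fun i => s.priv V.E V.R μ (ρ i) i) Q) : wp V I (s :: ss) μ ρ Q := by
  refine ⟨hc, ?_⟩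
  rwa [grant_of_none]
  intro i _
  unfold Instr.request
  obtain ⟨g, op⟩ := s
  cases op <;> simp at hn ⊢

/-- A parallel write to the array `a`; `F` is its new content. -/
lemma wp_cons_write {lo hi : ℤ} {g : Cond} {a : Name} {e v : Expr} {ss : List Instr} {μ : Mem}
    {ρ : ℤ → Priv β} {Q : Mem → Prop}
    (h : ∀ F : ℤ → ℤ,
      (∀ j, ((∀ i, lo ≤ i → i ≤ hi → g.eval μ (ρ i) i = true → e.eval μ (ρ i) i ≠ j) ∧
            F j = μ a j) ∨
          ∃ i, lo ≤ i ∧ i ≤ hi ∧ g.eval μ (ρ i) i = true ∧ e.eval μ (ρ i) i = j ∧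
            F j = v.eval μ (ρ i) i ∧
            ∀ i', lo ≤ i' → i' ≤ hi → g.eval μ (ρ i') i' = true → e.eval μ (ρ i') i' = j →
              i ≤ i') →
      wp V (procs lo hi) ss (Function.update μ a F) ρ Q) :
    wp V (procs lo hi) (⟨g, .write a e v⟩ :: ss) μ ρ Q := by
  refine ⟨fun i _ _ => trivial, ?_⟩
  have hpriv : (fun i => Instr.priv V.E V.R μ (ρ i) i ⟨g, .write a e v⟩) = ρ := by
    funext i; unfold Instr.priv; split_ifs <;> rfl
  rw [hpriv, grant_eq_update _ _ _ a]
  · apply h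
    intro j
    have hreq : ∀ (i u : ℤ), Instr.request μ (ρ i) i ⟨g, .write a e v⟩ = some (a, j, u) ↔
        g.eval μ (ρ i) i = true ∧ e.eval μ (ρ i) i = j ∧ v.eval μ (ρ i) i = u := by
      intro i u; unfold Instr.request; split_ifs with hg <;> simp [hg]
    rcases grant_filterMap μ (procs_sorted lo hi)
      (fun i => Instr.request μ (ρ i) i ⟨g, .write a e v⟩) a j with ⟨h1, h2⟩ | ⟨i, hi', h1, h2⟩
    · left
      refine ⟨fun i hl hh hg he => h1 i (mem_procs.2 ⟨hl, hh⟩) _ ((hreq i _).2 ⟨hg, he, rfl⟩), h2⟩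
    · right
      rw [hreq] at h1
      refine ⟨i, (mem_procs.1 hi').1, (mem_procs.1 hi').2, h1.1, h1.2.1, h1.2.2.symm, ?_⟩
      intro i' hl hh hg he
      exact h2 i' (mem_procs.2 ⟨hl, hh⟩) _ ((hreq i' _).2 ⟨hg, he, rfl⟩)
  · intro i _ q hq
    unfold Instr.request at hq
    split_ifs at hq
    simp only [Option.some.injEq] at hq
    rw [← hq]

lemma Runs.store {a : Name} {i e : Expr} {μ : Mem} {Q : Mem → Prop}
    (h : Q (Function.update μ a (Function.update (μ a) (i.eval μ (Priv.init (β := β)) 0)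
      (e.eval μ (Priv.init (β := β)) 0)))) :
    Runs V (store a i e) μ (i.size + e.size + 5) Q := by
  refine Runs.le (Runs.par 0 0 rfl rfl (by have := V.N_pos; omega) (wp_cons_write ?_)) ?_
  · intro F hF
    have : F = Function.update (μ a) (i.eval μ (Priv.init (β := β)) 0)
        (e.eval μ (Priv.init (β := β)) 0) := by
      funext j
      rcases hF j with ⟨h1, h2⟩ | ⟨x, hx1, hx2, -, he, hv, -⟩
      · rw [Function.update_of_ne, h2]
        rintro rfl
        exact h1 0 le_rfl le_rfl rfl rfl
      · obtain rfl : x = 0 := le_antisymm hx2 hx1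
        rw [hv, ← he]; simp
    rw [this]; exact h
  · simp [blockBound, Instr.bound, Op.bound, Expr.size, Cond.size]; omega

lemma Runs.assign {a : Name} {e : Expr} {μ : Mem} {Q : Mem → Prop}
    (h : Q (Function.update μ a (Function.update (μ a) 0 (e.eval μ (Priv.init (β := β)) 0)))) :
    Runs V (assign a e) μ (e.size + 6) Q := by
  refine (Runs.store (i := .lit 0) h).le ?_
  simp [Expr.size]; omega

/-- Programs are deterministic. -/
lemma Exec.det {E : List β} {R : Subroutine β} {c : Prog} {μ μ₁ μ₂ : Mem} {t₁ w₁ t₂ w₂ : ℕ}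
    (h₁ : Exec E R c μ μ₁ t₁ w₁) (h₂ : Exec E R c μ μ₂ t₂ w₂) : μ₁ = μ₂ := by
  induction h₁ generalizing μ₂ t₂ w₂ with
  | skip => cases h₂; rfl
  | par lo hi b μ μ' t w h =>
    cases h₂ with
    | par _ _ _ _ _ _ _ h' => rw [h] at h'; exact (Prod.ext_iff.1 h').1
  | seq _ _ _ _ _ _ _ _ _ _ _ ih₁ ih₂ =>
    cases h₂ with
    | seq _ _ _ _ _ _ _ _ _ a b => cases ih₁ a; exact ih₂ b
  | iteTrue _ _ _ _ _ _ _ hg _ ih =>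
    cases h₂ with
    | iteTrue _ _ _ _ _ _ _ _ a => exact ih a
    | iteFalse _ _ _ _ _ _ _ hg' a => simp [hg] at hg'
  | iteFalse _ _ _ _ _ _ _ hg _ ih =>
    cases h₂ with
    | iteTrue _ _ _ _ _ _ _ hg' a => simp [hg] at hg'
    | iteFalse _ _ _ _ _ _ _ _ a => exact ih a
  | whileTrue _ _ _ _ _ _ _ _ _ hg _ _ ih₁ ih₂ =>
    cases h₂ with
    | whileTrue _ _ _ _ _ _ _ _ _ _ a b => cases ih₁ a; exact ih₂ b
    | whileFalse _ _ _ hg' => simp [hg] at hg'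
  | whileFalse _ _ _ hg =>
    cases h₂ with
    | whileTrue _ _ _ _ _ _ _ _ _ hg' a b => simp [hg] at hg'
    | whileFalse => rfl

/-- `Runs` only provides some halting execution. By determinism its postcondition holds for every
execution, which is needed for the memories that `AtRound` describes. -/
lemma Runs.post {c : Prog} {μ μ' : Mem} {n t w : ℕ} {Q : Mem → Prop} (h : Runs V c μ n Q)
    (he : Exec V.E V.R c μ μ' t w) : Q μ' := by
  obtain ⟨μ₁, t₁, w₁, he₁, -, -, hq⟩ := h
  rwa [he.det he₁]

end Logic

/-! ## Witnesses -/

section Witnesses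

variable {β : Type*}

/-- `w` is a witness for the offset `a`, where `enc a w` is the symbol at position `w` of the
encoding of the suffix that starts after position `a` of a string of length `m`. -/
def Wit (enc : ℤ → ℤ → Option β) (m a w : ℤ) : Prop :=
  0 ≤ a ∧ 1 ≤ w ∧ a + w ≤ m ∧ enc a w ≠ enc 0 w

/-- Equality of symbols is inherited by suffixes. -/
def Transfers (enc : ℤ → ℤ → Option β) (m : ℤ) : Prop :=
  ∀ a b w j : ℤ, 0 ≤ a → 0 ≤ b → a + w ≤ m → b + w ≤ m → 0 ≤ j → j < w →
    enc a w = enc b w → enc (a + j) (w - j) = enc (b + j) (w - j)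

/-- `W'` arises from `W` by replacing zeros by witnesses. -/
def Ext (enc : ℤ → ℤ → Option β) (m : ℤ) (W W' : ℤ → ℤ) : Prop :=
  ∀ z, W' z = W z ∨ (W z = 0 ∧ Wit enc m z (W' z))

/-- The entry `i` of `W` is zero exactly if there is no witness, and a witness otherwise. -/
def Final (enc : ℤ → ℤ → Option β) (m : ℤ) (W : ℤ → ℤ) (i : ℤ) : Prop :=
  (W i = 0 → ∀ w, ¬ Wit enc m i w) ∧ (W i ≠ 0 → Wit enc m i (W i))

/-- `c` is the smallest witness for the offset `a`, or `0`. -/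
def IsCheck (enc : ℤ → ℤ → Option β) (m a c : ℤ) : Prop :=
  (c = 0 ∧ ∀ w, ¬ Wit enc m a w) ∨ (Wit enc m a c ∧ ∀ w, Wit enc m a w → c ≤ w)

variable {enc : ℤ → ℤ → Option β} {m : ℤ} {W W' W'' : ℤ → ℤ}

lemma Wit.pos {a w : ℤ} (h : Wit enc m a w) : 1 ≤ w := h.2.1

lemma not_wit_zero (w : ℤ) : ¬ Wit enc m 0 w := fun h => h.2.2.2 rfl

lemma Ext.refl (W : ℤ → ℤ) : Ext enc m W W := fun _ => .inl rfl

lemma Ext.trans (h : Ext enc m W W') (h' : Ext enc m W' W'') : Ext enc m W W'' := by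
  intro z
  rcases h' z with h2 | ⟨h2, h3⟩
  · rcases h z with h1 | ⟨h1, h4⟩
    · exact .inl (h2.trans h1)
    · exact .inr ⟨h1, h2 ▸ h4⟩
  · rcases h z with h1 | ⟨h1, h4⟩
    · exact .inr ⟨h1 ▸ h2, h3⟩
    · exact .inr ⟨h1, h3⟩

lemma Ext.zero (h : Ext enc m W W') {z : ℤ} (hz : W' z = 0) : W z = 0 := by
  rcases h z with h | ⟨h, -⟩
  · exact h ▸ hz
  · exact h

lemma Ext.valid (h : Ext enc m W W') {z : ℤ} (hv : W z ≠ 0 → Wit enc m z (W z)) :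
    W' z ≠ 0 → Wit enc m z (W' z) := by
  intro hz
  rcases h z with h | ⟨-, h⟩
  · rw [h] at hz ⊢; exact hv hz
  · exact h

lemma Ext.final (h : Ext enc m W W') {z : ℤ} (hv : Final enc m W z) : Final enc m W' z :=
  ⟨fun hz => hv.1 (h.zero hz), h.valid hv.2⟩

/-- Replacing one zero by a witness. -/
lemma Ext.update {z c : ℤ} (hz : W z = 0) (hc : c = 0 ∨ Wit enc m z c) :
    Ext enc m W (Function.update W z c) := by
  intro y
  by_cases hy : y = z
  · subst hy
    rcases hc with rfl | hc
    · left; simp [hz]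
    · right; simpa [hz] using hc
  · left; simp [hy]

lemma IsCheck.wit {a c : ℤ} (h : IsCheck enc m a c) : c = 0 ∨ Wit enc m a c := by
  rcases h with h | h
  · exact .inl h.1
  · exact .inr h.1

lemma IsCheck.eq_zero_iff {a c : ℤ} (h : IsCheck enc m a c) :
    c = 0 ↔ ∀ w, ¬ Wit enc m a w := by
  rcases h with h | h
  · exact ⟨fun _ => h.2, fun _ => h.1⟩
  · constructor
    · intro hc; have := h.1.pos; omega
    · intro hw; exact absurd h.1 (hw _)

/-- The duel: the witness `w` for the offset `a = j₂ - j₁` refutes `j₁` or `j₂`. -/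
lemma Wit.duel (hT : Transfers enc m) {j₁ j₂ w : ℤ} (hj₁ : 0 ≤ j₁)
    (hw : Wit enc m (j₂ - j₁) w) (hle : j₂ + w ≤ m) (he : enc j₂ w = enc 0 w) :
    Wit enc m j₁ (w + (j₂ - j₁)) := by
  obtain ⟨h0, h1, h2, h3⟩ := hw
  refine ⟨hj₁, by omega, by omega, fun h => h3 ?_⟩
  -- Agreement of `j₁` with the pattern at w + (j₂ - j₁) restricts to agreement of the suffixes
  -- after j₂ and after j₂ - j₁ at w. With `he`, the witness w for j₂ - j₁ would be refuted.
  have := hT j₁ 0 (w + (j₂ - j₁)) (j₂ - j₁) hj₁ le_rfl (by omega) (by omega) h0 (by omega) h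
  rw [add_sub_cancel, add_sub_cancel_right, zero_add] at this
  rw [← this, he]

/-- Induction on the multiple: the agreement with the shift p at position w + s * p, after s * p
symbols are dropped, identifies the offsets (s + 1) * p and s * p at w. -/
lemma enc_mul_period (hT : Transfers enc m) {p lcp : ℤ} (hp : 0 < p) (hpl : p + lcp ≤ m)
    (hl : ∀ v, 1 ≤ v → v ≤ lcp → enc p v = enc 0 v) (s : ℕ) :
    ∀ w, 1 ≤ w → w + s * p ≤ lcp + p → enc (s * p) w = enc 0 w := by
  induction s with
  | zero => intro w _ _; simp
  | succ s ih =>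
    intro w hw hle
    push_cast at hle ⊢
    have hsp : 0 ≤ (s : ℤ) * p := by positivity
    have hexp : ((s : ℤ) + 1) * p = s * p + p := by ring
    rw [hexp] at hle ⊢
    rw [← ih w hw (by omega)]
    have := hT p 0 (w + s * p) (s * p) hp.le le_rfl (by omega) (by omega) hsp (by omega)
      (hl _ (by omega) (by omega))
    rw [add_sub_cancel_right, zero_add, add_comm p] at this
    exact this

/-- Witnesses propagate to smaller offsets in the same class modulo `p`, if the string without
its first `p` symbols agrees with the string on the first `lcp ≥ m - i` symbols. -/
lemma Wit.of_dvd (hT : Transfers enc m) {p lcp i b w : ℤ} (hp : 0 < p) (hpl : p + lcp ≤ m)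
    (hl : ∀ v, 1 ≤ v → v ≤ lcp → enc p v = enc 0 v) (hi : 0 ≤ i) (hil : m - i ≤ lcp)
    (hib : i ≤ b) (hd : p ∣ b - i) (hw : Wit enc m b w) : Wit enc m i (w + b - i) := by
  obtain ⟨h0, h1, h2, h3⟩ := hw
  obtain ⟨s, hs⟩ := hd
  have hs0 : 0 ≤ s := by
    by_contra h
    have : p * s < 0 := mul_neg_of_pos_of_neg hp (by omega)
    omega
  lift s to ℕ using hs0
  refine ⟨hi, by omega, by omega, fun h => h3 ?_⟩
  -- If i agreed with the pattern at this position, dropping b - i symbols would make the offsets b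
  -- and b - i agree at w. The latter is a multiple of p and hence agrees there with the offset 0.
  have h4 := hT i 0 (w + b - i) (b - i) hi le_rfl (by omega) (by omega) (by omega) (by omega) h
  have h5 := enc_mul_period hT hp hpl hl s w h1 (by rw [mul_comm, ← hs]; omega)
  rw [mul_comm, ← hs] at h5
  rw [show i + (b - i) = b by ring, show w + b - i - (b - i) = w by ring, zero_add] at h4
  rw [h4, h5]

end Witnesses

/-! ## Sparse tables over the integers -/

section Sparse

/-- Every full `s`-block of `W[0 : h - 1]` has exactly one zero, and every block at most one. -/
structure ZSparse (W : ℤ → ℤ) (h s : ℤ) : Prop where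
  uniq : ∀ x y, 0 ≤ x → x < h → 0 ≤ y → y < h → x / s = y / s → W x = 0 → W y = 0 → x = y
  exist : ∀ c, 0 ≤ c → (c + 1) * s ≤ h → ∃ x, 0 ≤ x ∧ x / s = c ∧ W x = 0

/-- Positions share a block exactly if their quotients by s are equal, and the only block that can
be incomplete is the one with quotient h / s. Quotients turn all block bookkeeping into integer
division. -/
lemma isSparse_iff {W : ℤ → ℤ} {h s : ℕ} (hs : 0 < s) : IsSparse W h s ↔ ZSparse W h s := by
  have hblock : ∀ c i : ℕ, (c * s ≤ i ∧ i < (c + 1) * s) ↔ i / s = c := by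
    intro c i
    rw [Nat.div_eq_iff hs, Nat.add_mul]
    omega
  constructor
  · rintro ⟨h1, h2⟩
    constructor
    · intro x y hx0 hxh hy0 hyh hxy hx hy
      lift x to ℕ using hx0
      lift y to ℕ using hy0
      norm_cast at hxy hxh hyh ⊢
      by_cases hc : (x / s + 1) * s ≤ h
      · obtain ⟨z, -, hz⟩ := h1 (x / s) hc
        have a1 := (hblock (x / s) x).2 rfl
        have a2 := (hblock (x / s) y).2 hxy.symm
        rw [hz x ⟨a1.1, a1.2, hx⟩, hz y ⟨a2.1, a2.2, hy⟩]
      · have hb : x / s = h / s := by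
          apply le_antisymm (Nat.div_le_div_right hxh.le)
          rw [not_le, ← Nat.div_lt_iff_lt_mul hs] at hc
          omega
        have a1 := (hblock (h / s) x).2 hb
        have a2 := (hblock (h / s) y).2 (hxy ▸ hb)
        exact h2 x y a1.1 hxh a2.1 hyh hx hy
    · intro c hc hch
      lift c to ℕ using hc
      obtain ⟨z, ⟨a1, a2, a3⟩, -⟩ := h1 c (by exact_mod_cast hch)
      exact ⟨z, by omega, by exact_mod_cast (hblock c z).1 ⟨a1, a2⟩, a3⟩
  · rintro ⟨h1, h2⟩
    constructor
    · intro c hc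
      obtain ⟨x, hx0, hx1, hx2⟩ := h2 c (by omega) (by exact_mod_cast hc)
      lift x to ℕ using hx0
      have hx1 : x / s = c := by exact_mod_cast hx1
      have a1 := (hblock c x).2 hx1
      refine ⟨x, ⟨a1.1, a1.2, hx2⟩, ?_⟩
      rintro y ⟨b1, b2, b3⟩
      have hy1 := (hblock c y).1 ⟨b1, b2⟩
      have := h1 y x (by omega) (by omega) (by omega) (by omega)
        (by norm_cast; rw [hx1, hy1]) b3 hx2
      exact_mod_cast this
    · intro i j hi1 hi2 hj1 hj2 hi hj
      have hlt : h < (h / s + 1) * s := by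
        rw [← Nat.div_lt_iff_lt_mul hs]; omega
      have := h1 i j (by omega) (by omega) (by omega) (by omega)
        (by
          norm_cast
          rw [(hblock (h / s) i).1 ⟨hi1, by omega⟩, (hblock (h / s) j).1 ⟨hj1, by omega⟩]) hi hj
      exact_mod_cast this

end Sparse

/-! ## Encodings -/

section Encodings

variable {α β : Type*}

/-- The symbol at position `w` of the encoding of the suffix that starts after position `a`. -/
def suffixSym (f : List α → List β) (P : List α) (a w : ℤ) : Option β :=
  (f (P.drop a.toNat))[w.toNat - 1]?

lemma mem_witnesses_iff (f : List α → List β) (P : List α) (a w : ℕ) :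
    w ∈ witnesses f P a ↔ Wit (suffixSym f P) P.length a w := by
  simp only [witnesses, Wit, suffixSym, reencoded, Set.mem_ofPred_eq]
  simp
  omega

lemma exists_mem_witnesses_iff (f : List α → List β) (P : List α) (a : ℕ) (z : ℤ) :
    (∃ w ∈ witnesses f P a, z = w) ↔ Wit (suffixSym f P) P.length a z := by
  constructor
  · rintro ⟨w, hw, rfl⟩; exact (mem_witnesses_iff f P a w).1 hw
  · intro h
    have := h.pos
    lift z to ℕ using (by omega)
    exact ⟨z, (mem_witnesses_iff f P a z).2 h, rfl⟩

lemma witnesses_eq_empty_iff (f : List α → List β) (P : List α) (a : ℕ) :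
    witnesses f P a = ∅ ↔ ∀ w, ¬ Wit (suffixSym f P) P.length a w := by
  rw [Set.eq_empty_iff_forall_notMem]
  constructor
  · intro h w hw
    obtain ⟨v, hv, -⟩ := (exists_mem_witnesses_iff f P a w).2 hw
    exact h v hv
  · intro h w hw
    exact h w ((mem_witnesses_iff f P a w).1 hw)

lemma finalized_iff (f : List α → List β) (P : List α) (W : ℤ → ℤ) (i : ℕ) :
    Finalized f P W i ↔ Final (suffixSym f P) P.length W i := by
  rw [Finalized, Final, witnesses_eq_empty_iff, exists_mem_witnesses_iff]

variable {r : List α → List α → Prop} {f : List α → List β}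

/-- The suffix property of encodings for strings of different lengths. -/
lemma IsEncoding.suffix_eq_of_le (hf : IsEncoding r f) {X Y : List α} {w j : ℕ}
    (hX : w ≤ X.length) (hY : w ≤ Y.length) (hj : j < w)
    (h : (f X)[w - 1]? = (f Y)[w - 1]?) :
    (f (X.drop j))[w - j - 1]? = (f (Y.drop j))[w - j - 1]? := by
  -- By the prefix property, cutting both strings to the common length w changes none of the symbols
  -- involved.
  have key : ∀ Z : List α, w ≤ Z.length → (f (Z.take w))[w - 1]? = (f Z)[w - 1]? ∧
      (f ((Z.take w).drop j))[w - j - 1]? = (f (Z.drop j))[w - j - 1]? := by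
    intro Z hZ
    constructor
    · rw [hf.prefix_eq Z w hZ, List.getElem?_take_of_lt (by omega)]
    · rw [List.drop_take, hf.prefix_eq _ _ (by rw [List.length_drop]; omega),
        List.getElem?_take_of_lt (by omega)]
  rw [← (key X hX).2, ← (key Y hY).2]
  refine hf.suffix_eq _ _ ?_ w j hj ?_ ?_
  · simp; omega
  · simp; omega
  · rw [(key X hX).1, (key Y hY).1, h]

/-- This is the third encoding axiom for the suffixes after a and after b, whose lengths differ in
general; dropping j further symbols leads to the suffixes after a + j and b + j. -/
lemma IsEncoding.transfers (hf : IsEncoding r f) (P : List α) :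
    Transfers (suffixSym f P) P.length := by
  intro a b w j ha hb haw hbw hj hjw h
  lift a to ℕ using ha
  lift b to ℕ using hb
  lift w to ℕ using (by omega)
  lift j to ℕ using hj
  have := hf.suffix_eq_of_le (X := P.drop a) (Y := P.drop b) (w := w) (j := j)
    (by rw [List.length_drop]; omega) (by rw [List.length_drop]; omega) (by omega) h
  rw [List.drop_drop, List.drop_drop] at this
  have e : ((w : ℤ) - j).toNat = w - j := by omega
  simp only [suffixSym, e, ← Nat.cast_add, Int.toNat_natCast]
  exact this

/-- Equivalence of prefix and suffix is equality of their codes, and the code of the prefix is a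
prefix of the code. A witness is then precisely a position where the two codes differ. -/
lemma IsEncoding.isPeriod_iff (hf : IsEncoding r f) (P : List α) {a : ℕ} (ha : 0 < a)
    (haP : a < P.length) : IsPeriod r P a ↔ witnesses f P a = ∅ := by
  rw [IsPeriod, ← hf.eq_iff, hf.prefix_eq _ _ (by omega)]
  simp only [ha, haP, true_and]
  rw [Set.eq_empty_iff_forall_notMem]
  simp only [witnesses, reencoded, Set.mem_ofPred_eq, Nat.add_sub_cancel, not_and, not_not]
  constructor
  · intro h w hw hle
    rw [← h, List.getElem?_take_of_lt (by omega)]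
  · intro h
    apply List.ext_getElem?
    intro i
    by_cases hi : i < P.length - a
    · rw [List.getElem?_take_of_lt hi]
      exact (h (i + 1) (by omega) (by omega)).symm
    · rw [List.getElem?_eq_none, List.getElem?_eq_none]
      · rw [hf.length_eq, List.length_drop]; omega
      · rw [List.length_take]; omega

end Encodings

/-! ## Specifications of the basic procedures -/

section Procedures

variable {β : Type*} [DecidableEq β]

/-- The encoded input consists of the symbols `enc 0 w`, and the subroutine computes `enc`
within the bounds. -/
structure Oracle (V : Env β) (enc : ℤ → ℤ → Option β) (m : ℤ) : Prop where
  m_nonneg : 0 ≤ m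
  m_lt : m < V.N
  load : ∀ w, 1 ≤ w → w ≤ m → V.E[w.toNat - 1]? = enc 0 w
  call : ∀ x w, 0 ≤ x → 1 ≤ w → x + w ≤ m →
    V.R.val V.E (x + 1).toNat w.toNat = enc x w ∧
    V.R.time V.E (x + 1).toNat w.toNat ≤ V.τ ∧ V.R.work V.E (x + 1).toNat w.toNat ≤ V.ω

/-- Value of a scalar variable changed to `c`. -/
def setVar (μ : Mem) (a : Name) (c : ℤ) : Mem :=
  Function.update μ a (Function.update (μ a) 0 c)

@[simp] lemma setVar_self (μ : Mem) (a : Name) (c : ℤ) : setVar μ a c a 0 = c := by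
  simp [setVar]

@[simp] lemma setVar_of_ne (μ : Mem) {a a' : Name} (c : ℤ) (h : a' ≠ a) :
    setVar μ a c a' = μ a' := by
  simp [setVar, h]


variable {V : Env β} {enc : ℤ → ℤ → Option β} {m : ℤ}

lemma runs_assign {a : Name} {e : Expr} {μ : Mem} {Q : Mem → Prop} (c : ℤ)
    (he : e.eval μ (Priv.init (β := β)) 0 = c) (h : Q (setVar μ a c)) :
    Runs V (assign a e) μ (e.size + 6) Q := by
  apply Runs.assign
  rwa [he]

/-- The expression `e` has the value `c` in all memories that agree with `μ` outside `S`. -/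
def Expr.Stable (β : Type*) (e : Expr) (S : Set Name) (μ : Mem) (c : ℤ) : Prop :=
  ∀ (μ' : Mem), (∀ a ∉ S, μ' a = μ a) → ∀ (ρ : Priv β) (i : ℤ), e.eval μ' ρ i = c

/-- All processors that see a mismatch write their index to the same cell, and the priority rule
keeps the smallest: the tight witness costs a constant number of parallel steps. Stability of `x` is
required because it is evaluated after `check` has been reset. -/
lemma runs_checkParallel (H : Oracle V enc m) {x : Expr} {a : ℤ} {μ : Mem} {Q : Mem → Prop}
    (hm : μ .m 0 = m) (ha : 0 ≤ a) (hx : x.Stable β {.check} μ a)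
    (hQ : ∀ c, IsCheck enc m a c → Q (setVar μ .check c)) :
    Runs V (checkParallel x) μ (2 * x.size + 40) Q := by
  have hx1 : ∀ c ρ i, x.eval (β := β) (setVar μ .check c) ρ i = a := by
    intro c ρ i
    apply hx
    intro y hb
    exact setVar_of_ne _ _ hb
  refine Runs.le (Runs.cons (runs_assign 0 rfl (Runs.last (Runs.par 1 (m - a) rfl ?_ ?_ ?_)))) ?_
  · simp [Expr.eval, hx1, Name.val, hm]
  · have := H.m_lt; omega
  · refine wp_cons_of_no_write (by simp) (fun i _ _ => trivial) ?_
    refine wp_cons_of_no_write (by simp) (fun i hi _ => ?_) ?_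
    · rw [mem_procs] at hi
      simp only [Expr.eval, hx1]
      exact (H.call a i ha hi.1 (by omega)).2
    refine wp_cons_write fun F hF => ?_
    change Q _
    have key : ∀ i, 1 ≤ i → i ≤ m - a →
        (V.E[i.toNat - 1]? = V.R.val V.E (a + 1).toNat i.toNat ↔ ¬ Wit enc m a i) := by
      intro i h1 h2
      rw [H.load i h1 (by omega), (H.call a i ha h1 (by omega)).1]
      simp only [Wit, ha, h1, true_and]
      constructor
      · rintro h ⟨-, h'⟩; exact h' h.symm
      · intro h; by_contra h'; exact h ⟨by omega, Ne.symm h'⟩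
    simp only [Instr.priv, Cond.eval, Expr.eval, hx1, if_true, Function.update_self,
      ne_eq, reduceCtorEq, not_false_eq_true, Function.update_of_ne, Bool.not_eq_true',
      decide_eq_false_iff_not] at hF
    have hF' : Function.update (setVar μ .check 0) .check F = setVar μ .check (F 0) := by
      funext y
      by_cases hb : y = .check
      · subst hb
        simp only [Function.update_self, setVar]
        funext j
        by_cases hj : j = 0
        · subst hj; simp
        · rcases hF j with ⟨-, h⟩ | ⟨i, -, -, -, h, -⟩
          · simp [h, setVar, hj]
          · exact absurd h.symm hj
      · simp [setVar, hb]
    rw [hF']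
    apply hQ
    rcases hF 0 with ⟨h1, h2⟩ | ⟨i, h1, h2, h3, -, h4, h5⟩
    · left
      refine ⟨by rw [h2]; simp, fun w hw => ?_⟩
      have h3 : 1 ≤ w := hw.2.1
      have h4 : w ≤ m - a := by have := hw.2.2.1; omega
      exact h1 w h3 h4 (fun h => (key w h3 h4).1 h hw) rfl
    · right
      rw [h4]
      refine ⟨not_not.1 fun h => h3 ((key i h1 h2).2 h), fun w hw => ?_⟩
      have h3 : 1 ≤ w := hw.2.1
      have h4 : w ≤ m - a := by have := hw.2.2.1; omega
      exact h5 w h3 h4 (fun h => (key w h3 h4).1 h hw) rfl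
  · simp [blockBound, Instr.bound, Op.bound, Expr.size, Cond.size, Name.val]
    omega

/-- `A[0 : n - 1]` holds the zeros of `W[l : r]`, one per `s`-block, where `-1` stands for
none. -/
def IsZeros (W A : ℤ → ℤ) (l r s n : ℤ) : Prop :=
  ∀ t, 0 ≤ t → t < n →
    (A t = -1 ∧ ∀ z, l ≤ z → z ≤ r → z / s - l / s = t → W z ≠ 0) ∨
    (l ≤ A t ∧ A t ≤ r ∧ A t / s - l / s = t ∧ W (A t) = 0)

/-- Every zero announces itself in the cell of its block. Uniqueness of zeros in a block is not
needed here, since any recorded position is a zero; the range may even be empty. -/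
lemma runs_getZeros (H : Oracle V enc m) {le re : Expr} {l r s : ℤ} {μ : Mem} {Q : Mem → Prop}
    (hs : 0 < s) (hblock : μ .block 0 = s) (hl0 : 0 ≤ l) (hr0 : 0 ≤ r) (hrm : r < m)
    (hl : le.Stable β {.size, .A} μ l) (hr : re.Stable β {.size, .A} μ r)
    (hQ : ∀ A', IsZeros (μ .W) A' l r s (r / s - l / s + 1) →
      Q (Function.update (setVar μ .size (r / s - l / s + 1)) .A A')) :
    Runs V (getZeros le re) μ (3 * le.size + 2 * re.size + 60) Q := by
  set n := r / s - l / s + 1 with hn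
  have hNm := H.m_lt
  have hlE : ∀ ρ i, le.eval (β := β) μ ρ i = l := fun ρ i => hl _ (fun _ _ => rfl) ρ i
  have hrE : ∀ ρ i, re.eval (β := β) μ ρ i = r := fun ρ i => hr _ (fun _ _ => rfl) ρ i
  have hagree : ∀ F, ∀ a ∉ ({.size, .A} : Set Name),
      Function.update (setVar μ .size n) .A F a = μ a := by
    intro F a ha
    simp only [Set.mem_insert_iff, Set.mem_singleton_iff, not_or] at ha
    rw [Function.update_of_ne ha.2, setVar_of_ne _ _ ha.1]
  have hrs : r / s ≤ r := Int.ediv_le_self _ hr0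
  have hls : 0 ≤ l / s := Int.ediv_nonneg hl0 hs.le
  refine Runs.le (Runs.cons (runs_assign n ?_ (Runs.cons (n₂ := 2 * le.size + re.size + 20)
    (Runs.par 0 (n - 1) rfl ?_ ?_ ?_)))) ?_
  · simp [Expr.eval, hlE, hrE, Name.val, hblock, hn]
  · simp [Expr.eval, Name.val]
  · omega
  · refine wp_cons_write fun A₁ hA₁ => ?_
    simp only [Cond.eval, Expr.eval, forall_const, ne_eq] at hA₁
    have hA₁' : ∀ t, 0 ≤ t → t < n → A₁ t = -1 := by
      intro t h1 h2
      rcases hA₁ t with ⟨h, -⟩ | ⟨i, -, -, -, -, h, -⟩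
      · exact absurd rfl (h t h1 (by omega))
      · exact h
    refine Runs.le (Runs.last (Runs.par l r (hl _ (hagree _) _ _) (hr _ (hagree _) _ _) (by omega) ?_)) ?_
    rotate_left
    · simp [blockBound, Instr.bound, Op.bound, Expr.size, Cond.size, Name.val]
      omega
    refine wp_cons_write fun A₂ hA₂ => ?_
    change Q _
    rw [Function.update_idem]
    apply hQ
    intro t h1 h2
    simp only [Cond.eval, Expr.eval, Name.val, hl _ (hagree _) _ _, ne_eq, reduceCtorEq,
      not_false_eq_true, Function.update_of_ne, setVar_of_ne, hblock, decide_eq_true_eq] at hA₂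
    rcases hA₂ t with ⟨h3, h4⟩ | ⟨i, h3, h4, h5, h6, h7, -⟩
    · left
      refine ⟨by rw [h4]; simp [hA₁' t h1 h2], fun z hz1 hz2 hz3 hz0 => h3 z hz1 hz2 hz0 hz3⟩
    · right
      rw [h7]
      exact ⟨h3, h4, h6, h5⟩
  · simp [blockBound, Instr.bound, Op.bound, Expr.size, Cond.size, Name.val]
    omega

/-- Loops over the positions found by `getZeros`. -/
lemma runs_forFound {c : Prog} {b : ℕ} {μ : Mem} {Q : Mem → Prop} (n : ℕ)
    (hn : μ .size 0 ≤ n) (J : ℤ → Mem → Prop)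
    (hJ0 : J 0 (setVar μ .count 0))
    (hsize : ∀ i μ', J i μ' → μ' .size 0 = μ .size 0)
    (hfound : ∀ i μ', 0 ≤ i → i < μ .size 0 → J i μ' → μ' .count 0 = i → μ' .A i ≠ -1 →
      Runs V c (setVar μ' .z (μ' .A i)) b fun μ'' =>
        J (i + 1) (setVar μ'' .count (i + 1)) ∧ μ'' .count 0 = i)
    (hnone : ∀ i μ', 0 ≤ i → i < μ .size 0 → J i μ' → μ' .count 0 = i → μ' .A i = -1 →
      J (i + 1) (setVar (setVar μ' .z (-1)) .count (i + 1)))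
    (hQ : ∀ i μ', J i μ' → μ .size 0 ≤ i → Q μ') :
    Runs V (forFound c) μ (n * (b + 60) + 20) Q := by
  refine Runs.le (Runs.cons (runs_assign 0 rfl (Runs.last (Runs.while
    (b := b + 40)
    -- The loop counter i is recovered from the memory; k bounds the number of entries still to be
    -- visited.
    (fun k μ' => ∃ i, 0 ≤ i ∧ J i μ' ∧ μ' .count 0 = i ∧ μ .size 0 ≤ i + k) ?_ ?_ ?_ n _ ?_)))) ?_
  · rintro μ' ⟨i, hi, hJ, hc, hk⟩
    simp [Cond.eval, Expr.eval, Name.val, hc, hsize i μ' hJ]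
    omega
  · rintro k μ' ⟨i, hi, hJ, hc, hk⟩ hg
    have hlt : i < μ .size 0 := by
      simpa [Cond.eval, Expr.eval, Name.val, hc, hsize i μ' hJ] using hg
    refine Runs.le (Runs.cons (runs_assign (μ' .A i) (by simp [Expr.eval, Name.val, hc])
      (Runs.cons (n₂ := 10) (Runs.ite (n := b) ?_ ?_)))) ?_
    rotate_left
    · intro hg
      have hA : μ' .A i = -1 := by
        simpa [Cond.ne, Cond.eval, Expr.eval, Name.val] using hg
      refine Runs.skip ((Runs.last (runs_assign (i + 1) ?_ ?_)).le (by simp [Expr.size, Name.val]))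
      · simp [Expr.eval, Name.val, hc]
      · refine ⟨i + 1, by omega, ?_, by simp, by push_cast at hk; omega⟩
        rw [hA]
        exact hnone i μ' hi hlt hJ hc hA
    · simp [Expr.size, Cond.size, Cond.ne, Name.val]; omega
    · intro hg
      have hA : μ' .A i ≠ -1 := by
        simpa [Cond.ne, Cond.eval, Expr.eval, Name.val] using hg
      refine (hfound i μ' hi hlt hJ hc hA).mono le_rfl ?_
      rintro μ'' ⟨h1, h2⟩
      refine (Runs.last (runs_assign (i + 1) ?_ ?_)).le (by simp [Expr.size, Name.val])
      · simp [Expr.eval, Name.val, h2]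
      · exact ⟨i + 1, by omega, h1, by simp, by push_cast at hk; omega⟩
  · rintro k μ' ⟨i, hi, hJ, hc, hk⟩ hg
    refine hQ i μ' hJ ?_
    simpa [Cond.eval, Expr.eval, Name.val, hc, hsize i μ' hJ] using hg
  · exact ⟨0, le_rfl, hJ0, by simp, by simpa using hn⟩
  · simp [Expr.size, Cond.size, Name.val]
    ring_nf
    omega

end Procedures

/-! ## Duels -/

lemma ediv_eq_iff_mul_le {x s c : ℤ} (hs : 0 < s) : x / s = c ↔ c * s ≤ x ∧ x < c * s + s := by
  have := Int.ediv_eq_iff_of_pos (x := x) (y := c) hs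
  rw [this]

lemma ediv_two_mul (x s : ℤ) (hs : 0 < s) : x / (2 * s) = x / s / 2 := by
  rw [mul_comm, Int.ediv_ediv_of_nonneg hs.le]

section Duels

variable {β : Type*} [DecidableEq β]

/-- Private registers of the processor `i` after the instructions `ss`, in a fixed memory. -/
def privs (V : Env β) (μ : Mem) (i : ℤ) : List Instr → Priv β → Priv β
  | [], ρ => ρ
  | s :: ss, ρ => privs V μ i ss (s.priv V.E V.R μ ρ i)

/-- The subroutine calls in the instructions `ss` are within the bounds, in a fixed memory. -/
def CallsAlong (V : Env β) (μ : Mem) (i : ℤ) : List Instr → Priv β → Prop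
  | [], _ => True
  | s :: ss, ρ => s.CallsLe V μ ρ i ∧ CallsAlong V μ i ss (s.priv V.E V.R μ ρ i)

variable {V : Env β} {enc : ℤ → ℤ → Option β} {m : ℤ}

/-- As long as nothing is written, the shared memory is constant, so the lockstep run splits into
independent computations of the single processors. -/
lemma wp_append {I : List ℤ} {ss rest : List Instr} {μ : Mem} {Q : Mem → Prop}
    (hn : ∀ s ∈ ss, ∀ a e v, s.op ≠ .write a e v) :
    ∀ {ρ : ℤ → Priv β}, (∀ i ∈ I, CallsAlong V μ i ss (ρ i)) →
      wp V I rest μ (fun i => privs V μ i ss (ρ i)) Q → wp V I (ss ++ rest) μ ρ Q := by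
  induction ss with
  | nil => intro ρ _ h; exact h
  | cons s ss ih =>
    intro ρ hc h
    refine wp_cons_of_no_write (hn s (by simp)) (fun i hi => (hc i hi).1) ?_
    exact ih (fun t ht => hn t (by simp [ht])) (fun i hi => (hc i hi).2) h

/-- The instructions of a duel that precede the writes. -/
def duel : List Instr := [
  ⟨.always, .set .j₁ (.get .A (.mul (.lit 2) .idx))⟩,
  ⟨.always, .set .j₂ (.get .A (.add (.mul (.lit 2) .idx) (.lit 1)))⟩,
  ⟨bothFound, .set .w (.get .W (.sub (.reg .j₂) (.reg .j₁)))⟩,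
  ⟨bothFound, .load .p (.reg .w)⟩,
  ⟨bothFound, .reenc .q (.add (.reg .j₂) (.lit 1)) (.reg .w)⟩,
  ⟨.and bothFound (.symEq .p .q), .set .surv (.reg .j₂)⟩,
  ⟨.and bothFound (.not (.symEq .p .q)), .set .surv (.reg .j₁)⟩,
  ⟨bothFound, .set .a (.sub (.reg .j₂) (.reg .j₁))⟩]

/-- The result of the duel of `i`: whether the second position survives. -/
def SecondWins (V : Env β) (μ : Mem) (i : ℤ) : Prop :=
  V.E[(μ .W (μ .A (2 * i + 1) - μ .A (2 * i))).toNat - 1]? =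
    V.R.val V.E (μ .A (2 * i + 1) + 1).toNat (μ .W (μ .A (2 * i + 1) - μ .A (2 * i))).toNat

lemma privs_duel_of_found (μ : Mem) (i : ℤ) (h₁ : μ .A (2 * i) ≠ -1)
    (h₂ : μ .A (2 * i + 1) ≠ -1) :
    (privs V μ i duel Priv.init).int .j₁ = μ .A (2 * i) ∧
    (privs V μ i duel Priv.init).int .j₂ = μ .A (2 * i + 1) ∧
    (privs V μ i duel Priv.init).int .a = μ .A (2 * i + 1) - μ .A (2 * i) ∧
    (SecondWins V μ i → (privs V μ i duel Priv.init).int .surv = μ .A (2 * i + 1)) ∧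
    (¬ SecondWins V μ i → (privs V μ i duel Priv.init).int .surv = μ .A (2 * i)) := by
  by_cases hw : SecondWins V μ i <;>
  · have hw' := hw
    unfold SecondWins at hw'
    simp [duel, privs, Instr.priv, Cond.eval, Expr.eval, bothFound, Cond.ne, h₁, h₂, hw, hw']

/-- Private registers in a duel after the first two instructions. -/
def duelStart (μ : Mem) (i : ℤ) : Priv β :=
  ⟨Function.update (Function.update (fun _ => 0) .j₁ (μ .A (2 * i))) .j₂ (μ .A (2 * i + 1)),
    fun _ => none⟩

lemma privs_duel (μ : Mem) (i : ℤ) :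
    privs V μ i duel Priv.init = privs V μ i (duel.drop 2) (duelStart μ i) := rfl

lemma bothFound_duelStart (μ μ' : Mem) (i : ℤ) : bothFound.eval μ' (duelStart (β := β) μ i) i =
    decide (μ .A (2 * i) ≠ -1 ∧ μ .A (2 * i + 1) ≠ -1) := by
  simp [bothFound, Cond.ne, Cond.eval, Expr.eval, duelStart]

lemma privs_duel_of_not_found (μ : Mem) (i : ℤ)
    (h : ¬ (μ .A (2 * i) ≠ -1 ∧ μ .A (2 * i + 1) ≠ -1)) :
    (privs V μ i duel Priv.init).int .j₁ = μ .A (2 * i) ∧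
    (privs V μ i duel Priv.init).int .j₂ = μ .A (2 * i + 1) := by
  have hb := bothFound_duelStart (β := β) μ μ i
  rw [decide_eq_false h] at hb
  have : privs V μ i (duel.drop 2) (duelStart μ i) = duelStart μ i := by
    simp only [duel, List.drop_succ_cons, List.drop_zero, privs, Instr.priv, Cond.eval, hb,
      Bool.false_and, Bool.false_eq_true, if_false]
  rw [privs_duel, this]
  simp [duelStart]

lemma callsAlong_duel (μ : Mem) (i : ℤ)
    (h : μ .A (2 * i) ≠ -1 → μ .A (2 * i + 1) ≠ -1 →
      V.R.time V.E (μ .A (2 * i + 1) + 1).toNat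
        (μ .W (μ .A (2 * i + 1) - μ .A (2 * i))).toNat ≤ V.τ ∧
      V.R.work V.E (μ .A (2 * i + 1) + 1).toNat
        (μ .W (μ .A (2 * i + 1) - μ .A (2 * i))).toNat ≤ V.ω) :
    CallsAlong V μ i duel Priv.init := by
  refine ⟨fun _ => trivial, fun _ => trivial, fun _ => trivial, fun _ => trivial, ?_,
    fun _ => trivial, fun _ => trivial, fun _ => trivial, trivial⟩
  change Instr.CallsLe V μ (privs V μ i ((duel.drop 2).take 2) (duelStart μ i)) i _
  have hb := bothFound_duelStart (β := β) μ μ i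
  by_cases hf : μ .A (2 * i) ≠ -1 ∧ μ .A (2 * i + 1) ≠ -1
  · intro _
    rw [decide_eq_true hf] at hb
    have := h hf.1 hf.2
    simp [duel, privs, Instr.priv, Cond.eval, Expr.eval, bothFound, Cond.ne, hf.1, hf.2,
      duelStart, this]
  · rw [decide_eq_false hf] at hb
    have : privs V μ i ((duel.drop 2).take 2) (duelStart μ i) = duelStart μ i := by
      simp only [duel, List.drop_succ_cons, List.drop_zero, List.take_succ_cons, List.take_zero,
        privs, Instr.priv, hb, Bool.false_eq_true, if_false]
    rw [this]
    intro hg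
    exact absurd hg (by rw [hb]; simp)

/-- The pair of positions `j₁ = A[2i]` and `j₂ = A[2i+1]`, found in neighbouring `s`-blocks. -/
structure IsPair (W A : ℤ → ℤ) (h s i : ℤ) : Prop where
  nonneg : 0 ≤ i
  ge : 2 * s ≤ A (2 * i)
  lt : A (2 * i + 1) < h
  div₁ : A (2 * i) / s = 2 * i + 2
  div₂ : A (2 * i + 1) / s = 2 * i + 3
  zero₁ : W (A (2 * i)) = 0
  zero₂ : W (A (2 * i + 1)) = 0

lemma IsPair.bounds {W A : ℤ → ℤ} {h s i : ℤ} (hs : 0 < s) (hp : IsPair W A h s i) :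
    A (2 * i) < A (2 * i + 1) ∧ A (2 * i + 1) - A (2 * i) < 2 * s := by
  have h1 := (ediv_eq_iff_mul_le hs).1 hp.div₁
  have h2 := (ediv_eq_iff_mul_le hs).1 hp.div₂
  have e : (2 * i + 3) * s = (2 * i + 2) * s + s := by ring
  rw [e] at h2
  omega

/-- The list of zeros starts with the s-block of index 2, so its entries 2i and 2i + 1 belong to the
two halves of the 2s-block of index i + 1. -/
lemma IsZeros.isPair {W A : ℤ → ℤ} {h s i : ℤ} (hs : 0 < s)
    (hA : IsZeros W A (2 * s) (h - 1) s ((h - 1) / s - 2 * s / s + 1))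
    (hi0 : 0 ≤ i) (hi : i ≤ ((h - 1) / s - 2 * s / s + 1) / 2 - 1)
    (h₁ : A (2 * i) ≠ -1) (h₂ : A (2 * i + 1) ≠ -1) : IsPair W A h s i := by
  have e : 2 * s / s = 2 := Int.mul_ediv_cancel _ hs.ne'
  rw [e] at hA hi
  rcases hA (2 * i) (by omega) (by omega) with a | a
  · exact absurd a.1 h₁
  rcases hA (2 * i + 1) (by omega) (by omega) with b | b
  · exact absurd b.1 h₂
  exact ⟨hi0, a.1, by omega, by omega, by omega, a.2.2.2, b.2.2.2⟩

/-- Effect of the duels on the table. -/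
def IsDuelResult (enc : ℤ → ℤ → Option β) (W A W' : ℤ → ℤ) (h s : ℤ) (found : ℤ → Prop) : Prop :=
  ∀ z,
    (W' z = W z ∧ ∀ i, found i → ¬ (A (2 * i) = z ∧
        enc (A (2 * i + 1)) (W (A (2 * i + 1) - A (2 * i))) =
          enc 0 (W (A (2 * i + 1) - A (2 * i)))) ∧
      ¬ (A (2 * i + 1) = z ∧ enc (A (2 * i + 1)) (W (A (2 * i + 1) - A (2 * i))) ≠
          enc 0 (W (A (2 * i + 1) - A (2 * i))))) ∨
    (∃ i, found i ∧ IsPair W A h s i ∧ z = A (2 * i + 1) ∧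
      enc (A (2 * i + 1)) (W (A (2 * i + 1) - A (2 * i))) ≠
        enc 0 (W (A (2 * i + 1) - A (2 * i))) ∧ W' z = W (A (2 * i + 1) - A (2 * i))) ∨
    (∃ i, found i ∧ IsPair W A h s i ∧ z = A (2 * i) ∧
      enc (A (2 * i + 1)) (W (A (2 * i + 1) - A (2 * i))) =
        enc 0 (W (A (2 * i + 1) - A (2 * i))) ∧
      W' z = W (A (2 * i + 1) - A (2 * i)) + (A (2 * i + 1) - A (2 * i)))

/-- What `satisfySparsity` guarantees for the new table `W'`. -/
structure IsSparsified (enc : ℤ → ℤ → Option β) (m : ℤ) (W W' : ℤ → ℤ) (h s : ℤ) : Prop where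
  ext : Ext enc m W W'
  frame : ∀ z, z < 2 * s ∨ h ≤ z → W' z = W z
  le : ∀ z, W' z = W z ∨ W' z ≤ m - h + 2 * s
  uniq : ∀ x y, 2 * s ≤ x → x < h → 2 * s ≤ y → y < h → x / (2 * s) = y / (2 * s) →
    W' x = 0 → W' y = 0 → x = y
  exist : ∀ z, 2 * s ≤ z → z < h → W z = 0 → ∃ z', z' / (2 * s) = z / (2 * s) ∧ W' z' = 0 ∧ 0 ≤ z'

omit [DecidableEq β] in
-- Each duel eliminates exactly one of its two zeros, and distinct duels concern distinct 2s-blocks.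
-- The bound m - h + 1 on the entries below 2s keeps the duelled position inside the string, as j₂ <
-- h; adding j₂ - j₁ < 2s to it gives the new bound m - h + 2s.
lemma IsDuelResult.isSparsified (hT : Transfers enc m) {W A W' : ℤ → ℤ} {h s : ℤ} (hs : 0 < s)
    (hW : ∀ a, 0 < a → a < 2 * s → a < h → Wit enc m a (W a) ∧ W a ≤ m - h + 1)
    (huniq : ∀ x y, 2 * s ≤ x → x < h → 2 * s ≤ y → y < h → x / s = y / s →
      W x = 0 → W y = 0 → x = y)
    (hA : IsZeros W A (2 * s) (h - 1) s ((h - 1) / s - 2 * s / s + 1))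
    (hR : IsDuelResult enc W A W' h s fun i =>
      0 ≤ i ∧ i ≤ ((h - 1) / s - 2 * s / s + 1) / 2 - 1 ∧
        A (2 * i) ≠ -1 ∧ A (2 * i + 1) ≠ -1) :
    IsSparsified enc m W W' h s := by
  have hwit : ∀ i, IsPair W A h s i → Wit enc m (A (2 * i + 1) - A (2 * i))
      (W (A (2 * i + 1) - A (2 * i))) ∧ W (A (2 * i + 1) - A (2 * i)) ≤ m - h + 1 := by
    intro i hp
    have := hp.bounds hs
    have := hp.lt
    have := hp.ge
    exact hW _ (by omega) (by omega) (by omega)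
  have hext : Ext enc m W W' := by
    intro z
    rcases hR z with h1 | ⟨i, -, hp, rfl, hne, he⟩ | ⟨i, -, hp, rfl, heq, he⟩
    · exact .inl h1.1
    · right
      have a1 := hwit i hp
      have a2 := hp.lt
      have a3 := hp.ge
      have a4 := hp.bounds hs
      have a5 := a1.1.pos
      rw [he]
      exact ⟨hp.zero₂, by omega, a5, by omega, hne⟩
    · right
      have a1 := hwit i hp
      have a2 := hp.lt
      have a3 := hp.ge
      rw [he]
      exact ⟨hp.zero₁, Wit.duel hT (by omega) a1.1 (by omega) heq⟩
  refine ⟨hext, ?_, ?_, ?_, ?_⟩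
  · intro z hz
    rcases hR z with h1 | ⟨i, -, hp, rfl, -⟩ | ⟨i, -, hp, rfl, -⟩
    · exact h1.1
    · have a2 := hp.lt
      have a3 := hp.ge
      have a4 := hp.bounds hs
      omega
    · have a2 := hp.lt
      have a3 := hp.ge
      have a4 := hp.bounds hs
      omega
  · intro z
    rcases hR z with h1 | ⟨i, -, hp, rfl, -, he⟩ | ⟨i, -, hp, rfl, -, he⟩
    · exact .inl h1.1
    · have a1 := hwit i hp
      right; omega
    · have a1 := hwit i hp
      have a4 := hp.bounds hs
      right; omega
  -- Zeros left in both halves of one 2s-block were already zeros before, hence were the two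
  -- contestants of a duel, and one of them should have been overwritten.
  · have key : ∀ x y, 2 * s ≤ x → x < h → 2 * s ≤ y → y < h →
        (∃ c, 0 ≤ c ∧ x / s = 2 * c + 2 ∧ y / s = 2 * c + 3) → W' x = 0 → W' y = 0 → False := by
      rintro x y hx1 hx2 hy1 hy2 ⟨c, hc, hcx, hcy⟩ hx hy
      have e : 2 * s / s = 2 := Int.mul_ediv_cancel _ hs.ne'
      have hdiv : y / s ≤ (h - 1) / s := Int.ediv_le_ediv hs (by omega)
      have hAx : A (2 * c) = x := by
        rcases hA (2 * c) (by omega) (by omega) with a | a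
        · exact absurd (hext.zero hx) (a.2 x hx1 (by omega) (by omega))
        · exact huniq _ _ a.1 (by omega) hx1 hx2 (by omega) a.2.2.2 (hext.zero hx)
      have hAy : A (2 * c + 1) = y := by
        rcases hA (2 * c + 1) (by omega) (by omega) with a | a
        · exact absurd (hext.zero hy) (a.2 y hy1 (by omega) (by omega))
        · exact huniq _ _ a.1 (by omega) hy1 hy2 (by omega) a.2.2.2 (hext.zero hy)
      -- Duels write positive values only, so a remaining zero cannot have lost one.
      have hpos : ∀ z, W' z = 0 → (W' z = W z ∧ _) := fun z hz => (hR z).resolve_right (by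
        rintro (⟨i, -, hp, -, -, he⟩ | ⟨i, -, hp, -, -, he⟩)
        · have := (hwit i hp).1.pos; omega
        · have := (hwit i hp).1.pos; have := hp.bounds hs; omega)
      have hf : 0 ≤ c ∧ c ≤ ((h - 1) / s - 2 * s / s + 1) / 2 - 1 ∧
          A (2 * c) ≠ -1 ∧ A (2 * c + 1) ≠ -1 := by omega
      exact ((hpos y hy).2 c hf).2 ⟨hAy, fun heq => ((hpos x hx).2 c hf).1 ⟨hAx, heq⟩⟩
    intro x y hx1 hx2 hy1 hy2 hxy hx hy
    by_contra hne
    have hne' : x / s ≠ y / s := fun he =>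
      hne (huniq x y hx1 hx2 hy1 hy2 he (hext.zero hx) (hext.zero hy))
    rw [ediv_two_mul _ _ hs, ediv_two_mul _ _ hs] at hxy
    have hx3 : 2 ≤ x / s := by rw [Int.le_ediv_iff_mul_le hs]; exact hx1
    rcases lt_or_gt_of_ne hne' with hlt | hlt
    · exact key x y hx1 hx2 hy1 hy2 ⟨x / s / 2 - 1, by omega, by omega, by omega⟩ hx hy
    · exact key y x hy1 hy2 hx1 hx2 ⟨x / s / 2 - 1, by omega, by omega, by omega⟩ hy hx
  · intro z hz1 hz2 hz
    -- If z lost, its opponent is the required zero: its s-block determines the duel it takes part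
    -- in, so no other duel overwrites it.
    rcases hR z with h1 | ⟨i, hf, hp, rfl, hne, he⟩ | ⟨i, hf, hp, rfl, heq, he⟩
    · exact ⟨z, rfl, by rw [h1.1, hz], by omega⟩
    · refine ⟨A (2 * i), ?_, ?_, ?_⟩
      · rw [ediv_two_mul _ _ hs, ediv_two_mul _ _ hs, hp.div₁, hp.div₂]; omega
      · rcases hR (A (2 * i)) with h1 | ⟨i', -, hp', hz', -⟩ | ⟨i', -, hp', hz', heq', -⟩
        · rw [h1.1, hp.zero₁]
        · have := hp'.div₂; rw [← hz', hp.div₁] at this; omega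
        · have := hp'.div₁; rw [← hz', hp.div₁] at this
          obtain rfl : i = i' := by omega
          exact absurd heq' hne
      · have := hp.ge; omega
    · refine ⟨A (2 * i + 1), ?_, ?_, ?_⟩
      · rw [ediv_two_mul _ _ hs, ediv_two_mul _ _ hs, hp.div₁, hp.div₂]; omega
      · rcases hR (A (2 * i + 1)) with h1 | ⟨i', -, hp', hz', hne', -⟩ | ⟨i', -, hp', hz', -⟩
        · rw [h1.1, hp.zero₂]
        · have := hp'.div₂; rw [← hz', hp.div₂] at this
          obtain rfl : i = i' := by omega
          exact absurd heq hne'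
        · have := hp'.div₁; rw [← hz', hp.div₂] at this; omega
      · have := hp.ge; have := hp.bounds hs; omega

lemma runs_satisfySparsity (H : Oracle V enc m) (hT : Transfers enc m) {xe : Expr} {h s : ℤ}
    {μ : Mem} {Q : Mem → Prop} (hs : 0 < s) (hblock : μ .block 0 = s) (hh0 : 1 ≤ h) (hhm : h ≤ m)
    (hx : xe.Stable β {.size, .A} μ (h - 1))
    (hW : ∀ a, 0 < a → a < 2 * s → a < h → Wit enc m a (μ .W a) ∧ μ .W a ≤ m - h + 1)
    (huniq : ∀ x y, 2 * s ≤ x → x < h → 2 * s ≤ y → y < h → x / s = y / s →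
      μ .W x = 0 → μ .W y = 0 → x = y)
    (hQ : ∀ n A W', IsSparsified enc m (μ .W) W' h s →
      Q (Function.update (Function.update (setVar μ .size n) .A A) .W W')) :
    Runs V (satisfySparsity xe) μ (2 * xe.size + 400) Q := by
  set n := (h - 1) / s - 2 * s / s + 1 with hn
  have hNm := H.m_lt
  have hns : n ≤ m := by
    have h1 : (h - 1) / s ≤ h - 1 := Int.ediv_le_self _ (by omega)
    have h2 : 2 * s / s = 2 := Int.mul_ediv_cancel _ hs.ne'
    omega
  refine Runs.le (Runs.cons (n₂ := 250) (runs_getZeros H (l := 2 * s) (r := h - 1) hs hblock (by omega)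
    (by omega) (by omega) ?_ hx ?_)) ?_
  · intro μ' hμ' ρ i
    simp [Expr.eval, Name.val, hμ' .block (by simp), hblock]
  · intro A hA
    set μ₁ := Function.update (setVar μ .size n) .A A with hμ₁
    have hμA : μ₁ .A = A := by simp [hμ₁]
    have hμW : μ₁ .W = μ .W := by simp [hμ₁]
    have hmain : ∀ i, 0 ≤ i → i ≤ n / 2 - 1 → A (2 * i) ≠ -1 → A (2 * i + 1) ≠ -1 →
        IsPair (μ .W) A h s i ∧ 1 ≤ μ .W (A (2 * i + 1) - A (2 * i)) ∧
        0 ≤ A (2 * i + 1) ∧ A (2 * i + 1) + μ .W (A (2 * i + 1) - A (2 * i)) ≤ m := by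
      intro i h1 h2 h3 h4
      have hp := hA.isPair hs h1 h2 h3 h4
      have a1 := hp.bounds hs
      have a2 := hp.lt
      have a3 := hp.ge
      have a4 := hW _ (by omega : 0 < A (2 * i + 1) - A (2 * i)) (by omega) (by omega)
      have a5 := a4.1.pos
      exact ⟨hp, a5, by omega, by omega⟩
    have hwins : ∀ i, 0 ≤ i → i ≤ n / 2 - 1 → A (2 * i) ≠ -1 → A (2 * i + 1) ≠ -1 →
        (SecondWins V μ₁ i ↔ enc (A (2 * i + 1)) (μ .W (A (2 * i + 1) - A (2 * i))) =
          enc 0 (μ .W (A (2 * i + 1) - A (2 * i)))) := by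
      intro i h1 h2 h3 h4
      obtain ⟨-, a1, a2, a3⟩ := hmain i h1 h2 h3 h4
      rw [SecondWins, hμA, hμW, H.load _ a1 (by omega), (H.call _ _ a2 a1 (by omega)).1]
      exact eq_comm
    refine Runs.le (Runs.last (Runs.par 0 (n / 2 - 1) rfl ?_ (by omega)
      (wp_append (ss := duel) (rest := [
        ⟨.and bothFound (.eq (.reg .surv) (.reg .j₁)), .write .W (.reg .j₂) (.get .W (.reg .a))⟩,
        ⟨.and bothFound (.eq (.reg .surv) (.reg .j₂)),
          .write .W (.reg .j₁) (.add (.get .W (.reg .a)) (.reg .a))⟩]) ?_ ?_ ?_))) ?_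
    · simp [Expr.eval, Name.val, hμ₁]
    · simp [duel]
    · intro i hi
      rw [mem_procs] at hi
      apply callsAlong_duel
      rw [hμA, hμW]
      intro h3 h4
      obtain ⟨-, a1, a2, a3⟩ := hmain i hi.1 hi.2 h3 h4
      exact (H.call _ _ a2 a1 (by omega)).2
    · have hbf : ∀ (μ' : Mem) i, bothFound.eval μ' (privs V μ₁ i duel Priv.init) i = true ↔
          A (2 * i) ≠ -1 ∧ A (2 * i + 1) ≠ -1 := by
        intro μ' i
        by_cases hb : μ₁ .A (2 * i) ≠ -1 ∧ μ₁ .A (2 * i + 1) ≠ -1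
        · have := privs_duel_of_found (V := V) μ₁ i hb.1 hb.2
          simp [bothFound, Cond.ne, Cond.eval, Expr.eval, this.1, this.2.1, hμA]
        · have := privs_duel_of_not_found (V := V) μ₁ i hb
          simp [bothFound, Cond.ne, Cond.eval, Expr.eval, this.1, this.2, hμA]
      have hpriv := fun i => privs_duel_of_found (V := V) μ₁ i
      rw [hμA] at hpriv
      have hg₁ : ∀ (μ' : Mem) i, 0 ≤ i → i ≤ n / 2 - 1 →
          (Cond.eval μ' (privs V μ₁ i duel Priv.init) i
            (.and bothFound (.eq (.reg .surv) (.reg .j₁))) = true ↔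
          (A (2 * i) ≠ -1 ∧ A (2 * i + 1) ≠ -1) ∧
            enc (A (2 * i + 1)) (μ .W (A (2 * i + 1) - A (2 * i))) ≠
              enc 0 (μ .W (A (2 * i + 1) - A (2 * i)))) := by
        intro μ' i h1 h2
        rw [Cond.eval, Bool.and_eq_true, hbf]
        refine and_congr_right fun hb => ?_
        have hp := ((hmain i h1 h2 hb.1 hb.2).1.bounds hs).1
        obtain ⟨b1, b2, b3, b4, b5⟩ := hpriv i hb.1 hb.2
        rw [ne_eq, ← hwins i h1 h2 hb.1 hb.2]
        simp only [Cond.eval, Expr.eval, b1, decide_eq_true_eq]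
        constructor
        · intro e hw; rw [b4 hw] at e; omega
        · exact b5
      have hg₂ : ∀ (μ' : Mem) i, 0 ≤ i → i ≤ n / 2 - 1 →
          (Cond.eval μ' (privs V μ₁ i duel Priv.init) i
            (.and bothFound (.eq (.reg .surv) (.reg .j₂))) = true ↔
          (A (2 * i) ≠ -1 ∧ A (2 * i + 1) ≠ -1) ∧
            enc (A (2 * i + 1)) (μ .W (A (2 * i + 1) - A (2 * i))) =
              enc 0 (μ .W (A (2 * i + 1) - A (2 * i)))) := by
        intro μ' i h1 h2
        rw [Cond.eval, Bool.and_eq_true, hbf]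
        refine and_congr_right fun hb => ?_
        have hp := ((hmain i h1 h2 hb.1 hb.2).1.bounds hs).1
        obtain ⟨b1, b2, b3, b4, b5⟩ := hpriv i hb.1 hb.2
        rw [← hwins i h1 h2 hb.1 hb.2]
        simp only [Cond.eval, Expr.eval, b2, decide_eq_true_eq]
        constructor
        · intro e; by_contra hw; rw [b5 hw] at e; omega
        · exact b4
      refine wp_cons_write fun W₁ hW₁ => wp_cons_write fun W₂ hW₂ => ?_
      change Q _
      rw [Function.update_idem]
      apply hQ
      refine IsDuelResult.isSparsified hT hs hW huniq hA ?_
      rw [← hn]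
      -- The second write instruction reads W[a] after the first has been executed. This does no
      -- harm: a < 2s, while the losers of duels lie at or beyond 2s.
      have hW₁' : ∀ z, z < 2 * s → W₁ z = μ .W z := by
        intro z hz
        rcases hW₁ z with ⟨-, h2⟩ | ⟨i, h1, h2, h3, h4, -⟩
        · rw [h2, hμW]
        · rw [hg₁ _ _ h1 h2] at h3
          have hp := (hmain i h1 h2 h3.1.1 h3.1.2).1
          have h5 := (hpriv i h3.1.1 h3.1.2).2.1
          simp only [Expr.eval] at h4
          have := hp.bounds hs
          have := hp.ge
          omega
      intro z
      rcases hW₂ z with ⟨h1, h2⟩ | ⟨i, h1, h2, h3, h4, h5, -⟩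
      · rw [Function.update_self] at h2
        rcases hW₁ z with ⟨h3, h4⟩ | ⟨i, h3, h4, h5, h6, h7, -⟩
        · left
          refine ⟨by rw [h2, h4, hμW], fun i hf => ⟨?_, ?_⟩⟩
          · rintro ⟨hz, heq⟩
            refine h1 i hf.1 hf.2.1 ((hg₂ _ _ hf.1 hf.2.1).2 ⟨hf.2.2, heq⟩) ?_
            simp only [Expr.eval]
            rw [(hpriv i hf.2.2.1 hf.2.2.2).1, hz]
          · rintro ⟨hz, hne⟩
            refine h3 i hf.1 hf.2.1 ((hg₁ _ _ hf.1 hf.2.1).2 ⟨hf.2.2, hne⟩) ?_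
            simp only [Expr.eval]
            rw [(hpriv i hf.2.2.1 hf.2.2.2).2.1, hz]
        · right; left
          rw [hg₁ _ _ h3 h4] at h5
          have hp := (hmain i h3 h4 h5.1.1 h5.1.2).1
          obtain ⟨-, b2, b3, -, -⟩ := hpriv i h5.1.1 h5.1.2
          simp only [Expr.eval, b2, b3, hμW] at h6 h7
          exact ⟨i, ⟨h3, h4, h5.1⟩, hp, h6.symm, h5.2, by rw [h2, h7]⟩
      · right; right
        rw [hg₂ _ _ h1 h2] at h3
        have hp := (hmain i h1 h2 h3.1.1 h3.1.2).1
        obtain ⟨b1, -, b3, -, -⟩ := hpriv i h3.1.1 h3.1.2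
        simp only [Expr.eval, b1, b3, Function.update_self] at h4 h5
        rw [hW₁' _ (hp.bounds hs).2] at h5
        exact ⟨i, ⟨h1, h2, h3.1⟩, hp, h4.symm, h3.2, h5⟩
    · simp [blockBound, Instr.bound, Op.bound, Expr.size, Cond.size, Name.val, bothFound,
        Cond.ne]
  · simp [Expr.size, Name.val]
    omega

end Duels

/-! ## Finalizing a residue class by binary search -/

section Classes

variable {β : Type*} [DecidableEq β]

/-- The memories `μ` and `μ'` agree on all arrays outside `S`. -/
def Agree (S : Set Name) (μ μ' : Mem) : Prop := ∀ a ∉ S, μ' a = μ a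

lemma Agree.refl (S : Set Name) (μ : Mem) : Agree S μ μ := fun _ _ => rfl

lemma Agree.update {S : Set Name} {μ μ' : Mem} (h : Agree S μ μ') {a : Name} (ha : a ∈ S)
    (F : ℤ → ℤ) : Agree S μ (Function.update μ' a F) := by
  intro x hx
  rw [Function.update_of_ne (by rintro rfl; exact hx ha), h x hx]

lemma Agree.setVar {S : Set Name} {μ μ' : Mem} (h : Agree S μ μ') {a : Name} (ha : a ∈ S)
    (c : ℤ) : Agree S μ (setVar μ' a c) := h.update ha _

lemma Agree.trans {S : Set Name} {μ μ' μ'' : Mem} (h : Agree S μ μ') (h' : Agree S μ' μ'') :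
    Agree S μ μ'' := fun a ha => (h' a ha).trans (h a ha)

lemma Agree.mono {S S' : Set Name} {μ μ' : Mem} (h : Agree S μ μ') (hS : S ⊆ S') :
    Agree S' μ μ' := fun a ha => h a fun h' => ha (hS h')

omit [DecidableEq β] in
lemma stable_val (a : Name) (S : Set Name) (ha : a ∉ S) (μ : Mem) :
    a.val.Stable β S μ (μ a 0) := by
  intro μ' h ρ i
  simp [Name.val, Expr.eval, h a ha]

/-- Inside a string of length `m`, the suffix after the first `p` symbols agrees with the string on
the first `m - h` symbols. -/
structure AgreesShifted (enc : ℤ → ℤ → Option β) (m p h : ℤ) : Prop where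
  pos : 0 < p
  le : p ≤ h
  eq : ∀ v, 1 ≤ v → v ≤ m - h → enc p v = enc 0 v

variable {V : Env β} {enc : ℤ → ℤ → Option β} {m : ℤ}

omit [DecidableEq β] in
-- Within a residue class modulo p, the offsets from h on that have a witness form an initial
-- segment. This justifies both copying witnesses along a class and searching it by bisection.
lemma AgreesShifted.wit {p h : ℤ} (hp : AgreesShifted enc m p h) (hT : Transfers enc m)
    {i b w : ℤ} (hi : h ≤ i) (hib : i ≤ b) (hd : p ∣ b - i) (hw : Wit enc m b w) :
    Wit enc m i (w + b - i) :=
  Wit.of_dvd hT hp.pos (lcp := m - h) (by have := hp.le; omega) hp.eq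
    (by have := hp.le; have := hp.pos; omega) (by omega) hib hd hw

/-- The numbers `k` such that `k * p + ρ` lies in `[h, o)` are the numbers between the bounds with
which the binary search starts. -/
lemma class_bounds {p ρ h o : ℤ} (hp : 0 < p) (k : ℤ) :
    ((h - ρ + p - 1) / p - 1 < k ↔ h ≤ k * p + ρ) ∧
      (k < (o - 1 - ρ) / p + 1 ↔ k * p + ρ < o) := by
  constructor
  · rw [Int.sub_one_lt_iff, ← Int.lt_add_one_iff, Int.ediv_lt_iff_lt_mul hp, Int.add_mul]
    omega
  · rw [Int.lt_add_one_iff, Int.le_ediv_iff_mul_le hp]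
    omega

/-- Variables used while a residue class is finalized. -/
def searchVars : Set Name := {.check, .rem, .l, .r, .mid, .j, .b}

/-- State of the binary search. -/
structure SearchInv (enc : ℤ → ℤ → Option β) (m p ρ h o : ℤ) (μ₀ : Mem) (n : ℕ) (μ : Mem) :
    Prop where
  agree : Agree searchVars μ₀ μ
  rem : μ .rem 0 = ρ
  lt : μ .l 0 < μ .r 0
  width : μ .r 0 - μ .l 0 ≤ 2 ^ n
  nonneg : 0 ≤ μ .l 0
  le : μ .r 0 ≤ (o - 1 - ρ) / p + 1
  ge : (h - ρ + p - 1) / p - 1 ≤ μ .l 0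
  left : h ≤ μ .l 0 * p + ρ → ∃ w, Wit enc m (μ .l 0 * p + ρ) w
  right : ∀ k, μ .r 0 ≤ k → k * p + ρ < o → ∀ w, ¬ Wit enc m (k * p + ρ) w

/-- The search loop of `finalizeClass`. -/
def searchLoop : Prog :=
  .while (.lt (.lit 1) (.sub Name.r.val Name.l.val)) (block [
    assign .mid (.div (.add Name.l.val Name.r.val) (.lit 2)),
    assign .j (.add (.mul Name.mid.val Name.p.val) Name.rem.val),
    checkParallel Name.j.val,
    .ite (.eq Name.check.val (.lit 0)) (assign .r Name.mid.val) (assign .l Name.mid.val)])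

/-- The class member with index l has a witness unless it lies below h, and no member from index r
on has one. One check in the middle decides which bound moves, by monotonicity along the class. -/
lemma runs_searchLoop (H : Oracle V enc m) (hT : Transfers enc m) {p ρ h o : ℤ}
    (hp : AgreesShifted enc m p h) {μ₀ : Mem}
    (hm : μ₀ .m 0 = m) (hμp : μ₀ .p 0 = p) (n : ℕ) (μ : Mem)
    (hI : SearchInv enc m p ρ h o μ₀ n μ) :
    Runs V searchLoop μ (n * 120 + 10) fun μ' =>
      ∃ k, SearchInv enc m p ρ h o μ₀ k μ' ∧ μ' .r 0 = μ' .l 0 + 1 := by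
  refine Runs.le (Runs.while (b := 100) (SearchInv enc m p ρ h o μ₀) ?_ ?_ ?_ n μ hI) ?_
  · intro μ' h
    have := h.width
    simp [Cond.eval, Expr.eval, Name.val]
    simpa using this
  · intro n μ' hI hg
    have hlr : 1 < μ' .r 0 - μ' .l 0 := by simpa [Cond.eval, Expr.eval, Name.val] using hg
    have hpe : μ' .p 0 = p := by rw [hI.agree .p (by simp [searchVars]), hμp]
    have hme : μ' .m 0 = m := by rw [hI.agree .m (by simp [searchVars]), hm]
    have hw := hI.width
    -- The width is at most twice 2 ^ n, so either half of the interval has width at most 2 ^ n.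
    rw [pow_succ] at hw
    have hge := hI.ge
    have hle := hI.le
    have hnn := hI.nonneg
    set M := (μ' .l 0 + μ' .r 0) / 2 with hM
    have hM1 : μ' .l 0 < M := by omega
    have hM2 : M < μ' .r 0 := by omega
    have hMh := ((class_bounds (ρ := ρ) (h := h) (o := o) hp.pos M).1).1 (by omega)
    have hMo := ((class_bounds (ρ := ρ) (h := h) (o := o) hp.pos M).2).1 (by omega)
    have hM0 : 0 ≤ M * p + ρ := by have := hp.le; have := hp.pos; omega
    refine Runs.le (Runs.cons (n₂ := 80) (runs_assign M (by simp [Expr.eval, Name.val, hM])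
      (Runs.le (Runs.cons (n₂ := 60) (runs_assign (M * p + ρ)
        (by simp [Expr.eval, Name.val, hpe, hI.rem])
      (Runs.le (Runs.cons (n₂ := 15) (runs_checkParallel H (a := M * p + ρ) (by simp [hme]) hM0
        ?_ fun c hc => ?_)) ?_))) ?_))) ?_
    · simpa using stable_val (β := β) .j {.check} (by simp)
        (setVar (setVar μ' .mid M) .j (M * p + ρ))
    · have hag : Agree searchVars μ₀ (setVar (setVar (setVar μ' .mid M) .j (M * p + ρ)) .check c) :=
        ((hI.agree.setVar (by simp [searchVars]) _).setVar (by simp [searchVars]) _).setVar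
          (by simp [searchVars]) _
      refine Runs.le (Runs.last (Runs.ite (n := 10) ?_ ?_)) ?_
      · intro hg
        have hc0 : c = 0 := by simpa [Cond.eval, Expr.eval, Name.val] using hg
        refine (runs_assign M (by simp [Expr.eval, Name.val]) ?_).le (by simp [Expr.size, Name.val])
        refine ⟨hag.setVar (by simp [searchVars]) _, ?_, ?_, ?_, ?_, ?_, ?_, ?_, ?_⟩
        · simpa using hI.rem
        · simpa using hM1
        · simp; omega
        · simpa using hnn
        · simp; omega
        · simpa using hge
        · simpa using hI.left
        · simp only [setVar_self]
          intro k hk hko w hw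
          -- A witness for a larger member of the class would propagate down to the middle one,
          -- where the check found none.
          have hkp : M * p ≤ k * p := mul_le_mul_of_nonneg_right hk hp.pos.le
          refine hc.eq_zero_iff.1 hc0 _ (hp.wit hT hMh (by omega) ⟨k - M, ?_⟩ hw)
          ring
      · intro hg
        have hc0 : c ≠ 0 := by simpa [Cond.eval, Expr.eval, Name.val] using hg
        refine (runs_assign M (by simp [Expr.eval, Name.val]) ?_).le (by simp [Expr.size, Name.val])
        refine ⟨hag.setVar (by simp [searchVars]) _, ?_, ?_, ?_, ?_, ?_, ?_, ?_, ?_⟩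
        · simpa using hI.rem
        · simpa using hM2
        · simp; omega
        · simp; omega
        · simpa using hle
        · simp; omega
        · simp only [setVar_self]
          exact fun _ => ⟨c, hc.wit.resolve_left hc0⟩
        · simpa using hI.right
      · simp [Cond.size, Expr.size, Name.val]
    · simp [Expr.size, Name.val]
    · simp [Expr.size, Name.val]
    · simp [Expr.size, Name.val]
  · intro k μ' hI hg
    refine ⟨k, hI, ?_⟩
    have hlr : ¬ 1 < μ' .r 0 - μ' .l 0 := by simpa [Cond.eval, Expr.eval, Name.val] using hg
    have := hI.lt
    omega
  · simp [Cond.size, Expr.size, Name.val]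
    omega

lemma finalizeClass_eq : finalizeClass = block [
    assign .rem (.mod Name.z.val Name.p.val),
    assign .l (.sub (.div (.sub (.add (.sub Name.tail.val Name.rem.val) Name.p.val) (.lit 1))
      Name.p.val) (.lit 1)),
    assign .r (.add (.div (.sub (.sub Name.oldTail.val (.lit 1)) Name.rem.val) Name.p.val)
      (.lit 1)),
    searchLoop,
    assign .b (.add (.mul Name.l.val Name.p.val) Name.rem.val),
    checkParallel Name.b.val,
    .par Name.tail.val Name.b.val [
      ⟨.and (.eq (.get .W .idx) (.lit 0))
          (.eq (.mod .idx Name.p.val) (.mod Name.b.val Name.p.val)),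
        .write .W .idx (.sub (.add Name.check.val Name.b.val) .idx)⟩]] := rfl

/-- What the procedures that finalize positions in `[h, o)` guarantee for the new table. -/
structure TailExt (enc : ℤ → ℤ → Option β) (m h o : ℤ) (W W' : ℤ → ℤ) : Prop where
  ext : Ext enc m W W'
  frame : ∀ z, z < h ∨ o ≤ z → W' z = W z

/-- The search ends at adjacent bounds: class members above b have no witness, and those in [h, b]
inherit the one found for b. If b < h, no member of the class in [h, o) has a witness and the final
write has no processors. -/
lemma runs_finalizeClass (H : Oracle V enc m) (hT : Transfers enc m) {p h o z : ℤ} {L : ℕ}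
    (hp : AgreesShifted enc m p h) (hho : h < o) (ho : o ≤ m) (hL : m ≤ 2 ^ L) {μ : Mem}
    (hm : μ .m 0 = m) (hμp : μ .p 0 = p) (hμt : μ .tail 0 = h) (hμo : μ .oldTail 0 = o)
    (hμz : μ .z 0 = z) (hz0 : 0 ≤ z)
    (hv : ∀ y, h ≤ y → y < o → μ .W y ≠ 0 → Wit enc m y (μ .W y)) :
    Runs V finalizeClass μ (L * 120 + 250) fun μ' => Agree (insert .W searchVars) μ μ' ∧
      TailExt enc m h o (μ .W) (μ' .W) ∧
      ∀ y, h ≤ y → y < o → p ∣ y - z → Final enc m (μ' .W) y := by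
  have hp0 := hp.pos
  have hph := hp.le
  have hNm := H.m_lt
  set ρ := z % p with hρ
  have hρ0 : 0 ≤ ρ := Int.emod_nonneg _ hp0.ne'
  have hρp : ρ < p := Int.emod_lt_of_pos _ hp0
  have hρz : ρ ≤ z := by
    have h1 := Int.mul_ediv_add_emod z p
    have h2 : 0 ≤ p * (z / p) := mul_nonneg hp0.le (Int.ediv_nonneg hz0 hp0.le)
    omega
  set l₀ := (h - ρ + p - 1) / p - 1 with hl₀
  set r₀ := (o - 1 - ρ) / p + 1 with hr₀
  -- Because ρ < p ≤ h, the lower bound is nonnegative. Thus b ≥ 0 and the last check is a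
  -- legitimate one even if the search ends below h.
  have hl₀0 : 0 ≤ l₀ := by
    have : 1 ≤ (h - ρ + p - 1) / p := by rw [Int.le_ediv_iff_mul_le hp0]; omega
    omega
  have hlr : l₀ < r₀ := by
    have : (h - ρ + p - 1) / p ≤ (o - 1 - ρ + p) / p := Int.ediv_le_ediv hp0 (by omega)
    have h2 := Int.add_mul_ediv_right (o - 1 - ρ) 1 hp0.ne'
    rw [one_mul] at h2
    rw [h2] at this
    omega
  have hr₀m : r₀ ≤ o := by
    have : (o - 1 - ρ) / p ≤ o - 1 - ρ := Int.ediv_le_self _ (by omega)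
    omega
  have hcb := fun k => class_bounds (ρ := ρ) (h := h) (o := o) hp0 k
  rw [finalizeClass_eq]
  refine Runs.le (Runs.cons (n₂ := L * 120 + 220) (runs_assign ρ
    (by simp [Expr.eval, Name.val, hμz, hμp, hρ])
    (Runs.le (Runs.cons (n₂ := L * 120 + 180) (runs_assign l₀
      (by simp [Expr.eval, Name.val, hμt, hμp, hl₀])
      (Runs.le (Runs.cons (n₂ := L * 120 + 140) (runs_assign r₀
        (by simp [Expr.eval, Name.val, hμo, hμp, hr₀])
        (Runs.le (Runs.cons (n₂ := 110) ((runs_searchLoop (ρ := ρ) (o := o) H hT hp hm hμp L _ ?_).mono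
          le_rfl ?_)) ?_))) ?_))) ?_))) ?_
  -- Initially both search conditions hold vacuously, as the bounds lie just outside the range of
  -- the class. The width is at most o ≤ m ≤ 2 ^ L.
  · refine ⟨(((Agree.refl _ _).setVar (by simp [searchVars]) _).setVar
      (by simp [searchVars]) _).setVar (by simp [searchVars]) _, ?_, ?_, ?_, ?_, ?_, ?_, ?_, ?_⟩
    · simp
    · simpa using hlr
    · simp; omega
    · simpa using hl₀0
    · simp [hr₀]
    · simp [hl₀]
    · simp only [ne_eq, reduceCtorEq, not_false_eq_true, setVar_of_ne, setVar_self]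
      intro hl
      have := ((hcb l₀).1).2 hl
      omega
    · simp only [setVar_self]
      intro k hk hko
      have := ((hcb k).2).2 hko
      omega
  · rintro μ' ⟨n, hI, hr⟩
    have hpe : μ' .p 0 = p := by rw [hI.agree .p (by simp [searchVars]), hμp]
    have hme : μ' .m 0 = m := by rw [hI.agree .m (by simp [searchVars]), hm]
    have hte : μ' .tail 0 = h := by rw [hI.agree .tail (by simp [searchVars]), hμt]
    have hWe : μ' .W = μ .W := hI.agree .W (by simp [searchVars])
    set b := μ' .l 0 * p + ρ with hb
    have hb0 : 0 ≤ b := by have := mul_nonneg hI.nonneg hp0.le; omega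
    have hbo : b < o := ((hcb _).2).1 (by have := hI.le; omega)
    have hbmod : b % p = ρ := by
      rw [hb, Int.mul_add_emod_self_right]; exact Int.emod_eq_of_lt hρ0 hρp
    refine Runs.le (Runs.cons (n₂ := 90) (runs_assign b (by simp [Expr.eval, Name.val, hpe, hI.rem, hb])
      (Runs.le (Runs.cons (n₂ := 40) (runs_checkParallel H (a := b) (by simp [hme]) hb0
        ?_ fun c hc => Runs.le (Runs.last (Runs.par h b ?_ ?_ (by omega)
          (wp_cons_write fun F hF => ?_))) ?_)) ?_))) ?_
    · simpa using stable_val (β := β) .b {.check} (by simp) (setVar μ' .b b)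
    · simp [Expr.eval, Name.val, hte]
    · simp [Expr.eval, Name.val]
    · change _ ∧ _
      rw [Function.update_self]
      simp only [Cond.eval, Expr.eval, Name.val, ne_eq, reduceCtorEq, not_false_eq_true,
        setVar_of_ne, setVar_self, hWe, hpe, hbmod, Bool.and_eq_true, decide_eq_true_eq] at hF
      have hbw : h ≤ b → Wit enc m b c := fun hhb => by
        refine hc.wit.resolve_left fun hc0 => ?_
        obtain ⟨w, hw⟩ := hI.left hhb
        exact hc.eq_zero_iff.1 hc0 w hw
      have hmod : ∀ y, y % p = ρ → p ∣ b - y := fun y hy =>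
        Int.dvd_of_emod_eq_zero (Int.emod_eq_emod_iff_emod_sub_eq_zero.1 (by rw [hbmod, hy]))
      have hext : Ext enc m (μ .W) F := by
        intro y
        rcases hF y with ⟨-, h2⟩ | ⟨i, h1, h2, h3, rfl, h5, -⟩
        · exact .inl h2
        · right
          rw [h5]
          exact ⟨h3.1, hp.wit hT h1 h2 (hmod _ h3.2) (hbw (by omega))⟩
      refine ⟨?_, ⟨hext, ?_⟩, ?_⟩
      · exact ((((hI.agree.mono (Set.subset_insert _ _)).setVar (by simp [searchVars]) _).setVar
          (by simp [searchVars]) _).update (by simp) _)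
      · intro y hy
        rcases hF y with ⟨-, h2⟩ | ⟨i, h1, h2, h3, rfl, h5, -⟩
        · exact h2
        · omega
      · intro y hy1 hy2 hyz
        refine ⟨fun hFy => ?_, hext.valid (hv y hy1 hy2)⟩
        have hymod : y % p = ρ := by
          rw [hρ]; exact Int.emod_eq_emod_iff_emod_sub_eq_zero.2 (Int.emod_eq_zero_of_dvd hyz)
        have hyk : y / p * p + ρ = y := by
          have := Int.mul_ediv_add_emod y p
          rw [hymod, mul_comm] at this
          exact this
        -- Above b the search has excluded witnesses; at or below b a zero would have been
        -- overwritten by a positive value.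
        rcases lt_or_ge (μ' .l 0) (y / p) with hlt | hge
        · rw [← hyk]
          exact hI.right _ (by omega) (by omega)
        · have hyb : y ≤ b := by
            have := mul_le_mul_of_nonneg_right hge hp0.le
            omega
          rcases hF y with ⟨h1, -⟩ | ⟨i, h1, h2, h3, rfl, h5, -⟩
          · exact absurd rfl (h1 y hy1 hyb ⟨hext.zero hFy, hymod⟩)
          · have := (hbw (by omega)).pos
            omega
    · simp [blockBound, Instr.bound, Op.bound, Expr.size, Cond.size, Name.val]
    · simp [Expr.size, Name.val]
    · simp [Expr.size, Name.val]
  · omega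
  · simp [Expr.size, Name.val]; omega
  · simp [Expr.size, Name.val]; omega
  · simp [Expr.size, Name.val]; omega

end Classes

/-! ## Finalizing the new part of the tail -/

section Tail

variable {β : Type*} [DecidableEq β] {V : Env β} {enc : ℤ → ℤ → Option β} {m : ℤ}

/-- Variables used while the new part of the tail is finalized. -/
def tailVars : Set Name :=
  {.check, .rem, .l, .r, .mid, .j, .b, .W, .count, .z, .size, .A}

/-- Variables used in the loops over the zeros found by `getZeros`. -/
def loopVars : Set Name := {.check, .rem, .l, .r, .mid, .j, .b, .W, .count, .z}

omit [DecidableEq β] in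
lemma TailExt.refl (W : ℤ → ℤ) (h o : ℤ) : TailExt enc m h o W W := ⟨.refl _, fun _ _ => rfl⟩

omit [DecidableEq β] in
lemma TailExt.trans {W W' W'' : ℤ → ℤ} {h o : ℤ} (a : TailExt enc m h o W W')
    (b : TailExt enc m h o W' W'') : TailExt enc m h o W W'' :=
  ⟨a.ext.trans b.ext, fun z hz => (b.frame z hz).trans (a.frame z hz)⟩

lemma setVar_W {μ : Mem} {a : Name} {c : ℤ} (h : Name.W ≠ a) : setVar μ a c .W = μ .W :=
  setVar_of_ne _ _ h

/-- The positions found by `getZeros` include every zero, if every block has at most one. -/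
lemma IsZeros.mem {W A : ℤ → ℤ} {l r s z : ℤ} (hs : 0 < s)
    (hA : IsZeros W A l r s (r / s - l / s + 1))
    (huniq : ∀ x y, l ≤ x → x ≤ r → l ≤ y → y ≤ r → x / s = y / s → W x = 0 → W y = 0 → x = y)
    (hlz : l ≤ z) (hzr : z ≤ r) (hz : W z = 0) :
    ∃ t, 0 ≤ t ∧ t < r / s - l / s + 1 ∧ A t = z := by
  have h1 : l / s ≤ z / s := Int.ediv_le_ediv hs hlz
  have h2 : z / s ≤ r / s := Int.ediv_le_ediv hs hzr
  refine ⟨z / s - l / s, by omega, by omega, ?_⟩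
  rcases hA (z / s - l / s) (by omega) (by omega) with a | a
  · exact absurd hz (a.2 z hlz hzr rfl)
  · exact huniq _ _ a.1 a.2.1 hlz hzr (by omega) a.2.2.2 hz

/-- Find the zeros of `W[l : r]` and treat each of them by the program `c`, which makes `D z` true
for the zero `z`. -/
lemma runs_getZeros_forFound (H : Oracle V enc m) {le re : Expr} {c : Prog} {l r s h o : ℤ}
    {μ : Mem} {k n : ℕ} {D : ℤ → (ℤ → ℤ) → Prop} (hs : 0 < s)
    (hblock : μ .block 0 = s) (hl0 : 0 ≤ l) (hr0 : 0 ≤ r) (hrm : r < m)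
    (hl : le.Stable β {.size, .A} μ l) (hr : re.Stable β {.size, .A} μ r)
    (huniq : ∀ x y, l ≤ x → x ≤ r → l ≤ y → y ≤ r → x / s = y / s → μ .W x = 0 → μ .W y = 0 →
      x = y)
    (hk : r / s - l / s + 1 ≤ k)
    (hc : ∀ μ', Agree tailVars μ μ' → TailExt enc m h o (μ .W) (μ' .W) → l ≤ μ' .z 0 →
      μ' .z 0 ≤ r → μ .W (μ' .z 0) = 0 →
      Runs V c μ' n fun μ'' =>
        Agree {.check, .rem, .l, .r, .mid, .j, .b, .W} μ' μ'' ∧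
        TailExt enc m h o (μ .W) (μ'' .W) ∧ D (μ' .z 0) (μ'' .W) ∧
        ∀ z, D z (μ' .W) → D z (μ'' .W)) :
    Runs V (block [getZeros le re, forFound c]) μ
        (3 * le.size + 2 * re.size + 60 + (k * (n + 60) + 20)) fun μ' =>
      Agree tailVars μ μ' ∧ TailExt enc m h o (μ .W) (μ' .W) ∧
        ∀ z, l ≤ z → z ≤ r → μ .W z = 0 → D z (μ' .W) := by
  refine Runs.cons (runs_getZeros H hs hblock hl0 hr0 hrm hl hr fun A hA => Runs.last ?_)
  set N := r / s - l / s + 1 with hN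
  set μ₁ := Function.update (setVar μ .size N) .A A with hμ₁
  have hsz : μ₁ .size 0 = N := by simp [hμ₁]
  have hA₁ : μ₁ .A = A := by simp [hμ₁]
  have hW₁ : μ₁ .W = μ .W := by simp [hμ₁]
  have hag₁ : Agree tailVars μ μ₁ :=
    ((Agree.refl _ _).setVar (by simp [tailVars]) _).update (by simp [tailVars]) _
  have hsub : loopVars ⊆ tailVars := by
    intro a ha
    simp only [loopVars, tailVars, Set.mem_insert_iff, Set.mem_singleton_iff] at ha ⊢
    tauto
  have hsub' : ({.check, .rem, .l, .r, .mid, .j, .b, .W} : Set Name) ⊆ loopVars := by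
    intro a ha
    simp only [loopVars, Set.mem_insert_iff, Set.mem_singleton_iff] at ha ⊢
    tauto
  -- The zeros listed before index i have been treated; `hc` guarantees that treating the next one
  -- does not undo `D` for them.
  refine runs_forFound k (hsz ▸ hk)
    (fun i μ' => Agree loopVars μ₁ μ' ∧ TailExt enc m h o (μ .W) (μ' .W) ∧
      ∀ t, 0 ≤ t → t < i → A t ≠ -1 → D (A t) (μ' .W)) ?_ ?_ ?_ ?_ ?_
  · refine ⟨(Agree.refl _ _).setVar (by simp [loopVars]) _, ?_, ?_⟩
    · rw [setVar_W (by decide), hW₁]; exact .refl _ _ _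
    · intro t h1 h2; omega
  · rintro i μ' ⟨h1, -⟩
    rw [h1 .size (by simp [loopVars])]
  · rintro i μ' hi0 hi ⟨h1, h2, h3⟩ hcount hAi
    have hAe : μ' .A = A := by rw [h1 .A (by simp [loopVars]), hA₁]
    rw [hAe] at hAi ⊢
    rw [hsz] at hi
    have hb : l ≤ A i ∧ A i ≤ r ∧ μ .W (A i) = 0 := by
      rcases hA i hi0 hi with a | a
      · exact absurd a.1 hAi
      · exact ⟨a.1, a.2.1, a.2.2.2⟩
    have hag : Agree loopVars μ₁ (setVar μ' .z (A i)) := h1.setVar (by simp [loopVars]) _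
    refine (hc _ (hag₁.trans (hag.mono hsub)) (by rwa [setVar_W (by decide)])
      (by simpa using hb.1) (by simpa using hb.2.1)
      (by simpa using hb.2.2)).mono le_rfl ?_
    rintro μ'' ⟨h4, h5, h6, h7⟩
    rw [setVar_W (by decide)] at h7
    refine ⟨⟨(hag.trans (h4.mono hsub')).setVar (by simp [loopVars]) _, ?_, ?_⟩, ?_⟩
    · rw [setVar_W (by decide)]; exact h5
    · rw [setVar_W (by decide)]
      intro t ht0 hti hAt
      rcases lt_or_eq_of_le (Int.lt_add_one_iff.1 hti) with hlt | rfl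
      · exact h7 _ (h3 t ht0 hlt hAt)
      · simpa using h6
    · rw [h4 .count (by simp), setVar_of_ne _ _ (by decide), hcount]
  · rintro i μ' hi0 hi ⟨h1, h2, h3⟩ hcount hAi
    have hAe : μ' .A = A := by rw [h1 .A (by simp [loopVars]), hA₁]
    rw [hAe] at hAi
    refine ⟨(h1.setVar (by simp [loopVars]) _).setVar (by simp [loopVars]) _, ?_, ?_⟩
    · rwa [setVar_W (by decide), setVar_W (by decide)]
    · rw [setVar_W (by decide), setVar_W (by decide)]
      intro t ht0 hti hAt
      rcases lt_or_eq_of_le (Int.lt_add_one_iff.1 hti) with hlt | rfl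
      · exact h3 t ht0 hlt hAt
      · exact absurd hAi hAt
  · rintro i μ' ⟨h1, h2, h3⟩ hi
    rw [hsz] at hi
    refine ⟨hag₁.trans (h1.mono hsub), h2, fun z hlz hzr hz => ?_⟩
    obtain ⟨t, ht0, htN, rfl⟩ := hA.mem hs huniq hlz hzr hz
    exact h3 t ht0 (by omega) (by omega)

/-- The first case: at most two positions remain to be checked. -/
lemma runs_finalizeShort (H : Oracle V enc m) {h o s : ℤ} {μ : Mem} (hs : 0 < s)
    (hblock : μ .block 0 = s) (hm : μ .m 0 = m) (hμt : μ .tail 0 = h) (hμo : μ .oldTail 0 = o)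
    (hh : 0 ≤ h) (hos : o - h = s) (ho : o ≤ m)
    (hv : ∀ y, h ≤ y → y < o → μ .W y ≠ 0 → Wit enc m y (μ .W y))
    (huniq : ∀ x y, 0 ≤ x → x < o → 0 ≤ y → y < o → x / s = y / s →
      μ .W x = 0 → μ .W y = 0 → x = y) :
    Runs V (block [
      getZeros Name.tail.val (.sub Name.oldTail.val (.lit 1)),
      forFound (block [checkParallel Name.z.val, store .W Name.z.val Name.check.val])]) μ 400
      fun μ' => Agree tailVars μ μ' ∧ TailExt enc m h o (μ .W) (μ' .W) ∧
        ∀ y, h ≤ y → y < o → Final enc m (μ' .W) y := by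
  -- An interval of s positions meets at most two s-blocks.
  have hk : (o - 1) / s - h / s + 1 ≤ (2 : ℕ) := by
    have h1 : (o - 1) / s ≤ (h + 1 * s) / s := Int.ediv_le_ediv hs (by omega)
    rw [Int.add_mul_ediv_right _ _ hs.ne'] at h1
    push_cast
    omega
  refine (runs_getZeros_forFound H (l := h) (r := o - 1) (h := h) (o := o) (n := 62)
    (D := fun z W => Final enc m W z) hs hblock hh
    (by omega) (by omega) ?_ ?_ ?_ hk ?_).mono ?_ ?_
  · exact hμt ▸ stable_val .tail _ (by simp) μ
  · intro μ' h1 ρ i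
    simp [Expr.eval, Name.val, h1 .oldTail (by simp), hμo]
  · intro x y h1 h2 h3 h4
    exact huniq x y (by omega) (by omega) (by omega) (by omega)
  · intro μ' hag hext hz1 hz2 hWz
    set z := μ' .z 0 with hz
    have hme : μ' .m 0 = m := by rw [hag .m (by simp [tailVars]), hm]
    refine Runs.le (Runs.cons (n₂ := 15) (runs_checkParallel H hme (hh.trans hz1)
      (hz ▸ stable_val .z _ (by simp) μ') fun c hc => Runs.le (Runs.last (Runs.store ?_)) ?_)) ?_
    · have e1 : Name.z.val.eval (setVar μ' .check c) (Priv.init (β := β)) 0 = z := by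
        simp [Name.val, Expr.eval, hz]
      have e2 : Name.check.val.eval (setVar μ' .check c) (Priv.init (β := β)) 0 = c := by
        simp [Name.val, Expr.eval]
      rw [e1, e2, setVar_W (by decide), Function.update_self]
      have hfin : Final enc m (Function.update (μ' .W) z c) z := by
        refine ⟨?_, ?_⟩ <;> rw [Function.update_self]
        · exact hc.eq_zero_iff.1
        · exact hc.wit.resolve_left
      refine ⟨((Agree.refl _ _).setVar (by simp) _).update (by simp) _, ⟨fun y => ?_, fun y hy => ?_⟩,
        hfin, fun y hy => ?_⟩
      · by_cases hyz : y = z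
        · subst hyz
          rw [Function.update_self, hWz]
          exact hc.wit.imp_right fun h => ⟨rfl, h⟩
        · rw [Function.update_of_ne hyz]
          exact hext.ext y
      · rw [Function.update_of_ne (by omega)]
        exact hext.frame y hy
      · by_cases hyz : y = z
        · rw [hyz]; exact hfin
        · rwa [Final, Function.update_of_ne hyz]
    · simp [Expr.size, Name.val]
    · simp [Expr.size, Name.val]
  · simp [Expr.size, Name.val]
  · rintro μ' ⟨h1, h2, h3⟩
    refine ⟨h1, h2, fun y hy1 hy2 => ?_⟩
    by_cases hy : μ .W y = 0
    · exact h3 y hy1 (by omega) hy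
    · exact h2.ext.final ⟨fun h => absurd h hy, hv y hy1 hy2⟩

/-- The second case: extend witnesses along residue classes and search each remaining class. -/
lemma runs_finalizeLong (H : Oracle V enc m) (hT : Transfers enc m) {p h o s : ℤ} {L : ℕ}
    {μ : Mem} (hs : 0 < s) (hp : AgreesShifted enc m p h) (hps : p < 2 * s) (hL : m ≤ 2 ^ L)
    (hblock : μ .block 0 = s) (hm : μ .m 0 = m) (hμp : μ .p 0 = p) (hμt : μ .tail 0 = h)
    (hμo : μ .oldTail 0 = o) (hho : h < o) (ho : o ≤ m)
    (hv : ∀ y, 0 ≤ y → y < o → μ .W y ≠ 0 → Wit enc m y (μ .W y))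
    (huniq : ∀ x y, 0 ≤ x → x < o → 0 ≤ y → y < o → x / s = y / s →
      μ .W x = 0 → μ .W y = 0 → x = y) :
    Runs V (block [
      .par Name.tail.val (.sub Name.oldTail.val (.lit 1)) [
        ⟨.always, .set .q (.sub (.sub Name.oldTail.val (.lit 1))
          (.mod (.sub (.sub Name.oldTail.val (.lit 1)) .idx) Name.p.val))⟩,
        ⟨.and (.eq (.get .W .idx) (.lit 0)) (.ne (.get .W (.reg .q)) (.lit 0)),
          .write .W .idx (.sub (.add (.get .W (.reg .q)) (.reg .q)) .idx)⟩],
      getZeros (.sub Name.oldTail.val Name.p.val) (.sub Name.oldTail.val (.lit 1)),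
      forFound finalizeClass]) μ (L * 360 + 1200)
      fun μ' => Agree tailVars μ μ' ∧ TailExt enc m h o (μ .W) (μ' .W) ∧
        ∀ y, h ≤ y → y < o → Final enc m (μ' .W) y := by
  have hp0 := hp.pos
  have hph := hp.le
  have hNm := H.m_lt
  refine Runs.le (Runs.cons (n₂ := L * 360 + 1100) (Runs.par h (o - 1) ?_ ?_ (by omega)
    (wp_cons_of_no_write (by simp) (fun i _ _ => trivial) (wp_cons_write fun F hF => ?_)))) ?_
  · simp [Expr.eval, Name.val, hμt]
  · simp [Expr.eval, Name.val, hμo]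
  · change Runs _ _ _ _ _
    set q : ℤ → ℤ := fun y => o - 1 - (o - 1 - y) % p with hq
    have hF : ∀ j, ((∀ i, h ≤ i → i ≤ o - 1 → μ .W i = 0 ∧ μ .W (q i) ≠ 0 → i ≠ j) ∧
          F j = μ .W j) ∨
        ∃ i, h ≤ i ∧ i ≤ o - 1 ∧ (μ .W i = 0 ∧ μ .W (q i) ≠ 0) ∧ i = j ∧
          F j = μ .W (q i) + q i - i := by
      intro j
      have hj := hF j
      simp only [Instr.priv, Cond.ne, Cond.eval, Expr.eval, Name.val, if_true,
        Function.update_self, hμo, hμp, Bool.and_eq_true, Bool.not_eq_true',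
        decide_eq_false_iff_not] at hj
      rcases hj with ⟨h1, h2⟩ | ⟨i, h1, h2, h3, h4, h5, -⟩
      · exact .inl ⟨fun i h3 h4 h5 => h1 i h3 h4 ⟨decide_eq_true h5.1, h5.2⟩, h2⟩
      · exact .inr ⟨i, h1, h2, ⟨of_decide_eq_true h3.1, h3.2⟩, h4, h5⟩
    have hqb : ∀ y, y ≤ o - 1 → y ≤ q y ∧ o - p ≤ q y ∧ q y ≤ o - 1 := by
      intro y hy
      have h1 := Int.emod_nonneg (o - 1 - y) hp0.ne'
      have h2 := Int.emod_lt_of_pos (o - 1 - y) hp0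
      have h3 : (o - 1 - y) % p ≤ o - 1 - y := by
        have h4 := Int.mul_ediv_add_emod (o - 1 - y) p
        have h5 : 0 ≤ p * ((o - 1 - y) / p) :=
          mul_nonneg hp0.le (Int.ediv_nonneg (by omega) hp0.le)
        omega
      simp only [hq]
      omega
    have hqd : ∀ y, p ∣ q y - y := by
      intro y
      refine ⟨(o - 1 - y) / p, ?_⟩
      have h4 := Int.mul_ediv_add_emod (o - 1 - y) p
      simp only [hq]
      omega
    have hqq : ∀ y, o - p ≤ y → y ≤ o - 1 → q y = y := by
      intro y h1 h2
      simp only [hq]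
      rw [Int.emod_eq_of_lt (by omega) (by omega)]
      omega
    have hext : Ext enc m (μ .W) F := by
      intro y
      rcases hF y with ⟨-, h2⟩ | ⟨i, h1, h2, h3, rfl, h5⟩
      · exact .inl h2
      · right
        have hb := hqb i h2
        refine ⟨h3.1, ?_⟩
        rw [h5]
        exact hp.wit hT h1 hb.1 (hqd i) (hv _ (by omega) (by omega) h3.2)
    have hTE : TailExt enc m h o (μ .W) F := by
      refine ⟨hext, fun y hy => ?_⟩
      rcases hF y with ⟨-, h2⟩ | ⟨i, h1, h2, h3, rfl, h5⟩
      · exact h2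
      · omega
    -- A position that is still zero after copying has a representative among the last p positions
    -- that is zero too, so its class is one of those searched below.
    have hzero : ∀ y, h ≤ y → y < o → F y = 0 → F (q y) = 0 := by
      intro y hy1 hy2 hy
      have hb := hqb y (by omega)
      have hWq : μ .W (q y) = 0 := by
        by_contra hne
        rcases hF y with ⟨h1, -⟩ | ⟨i, h1, h2, h3, rfl, h5⟩
        · exact h1 y hy1 (by omega) ⟨hext.zero hy, hne⟩ rfl
        · have h6 := (hv _ (by omega) (by omega) h3.2).pos
          omega
      rcases hF (q y) with ⟨-, h2⟩ | ⟨i, h1, h2, h3, hi, h5⟩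
      · rw [h2, hWq]
      · exfalso
        apply h3.2
        rw [hi, hqq _ hb.2.1 hb.2.2, hWq]
    set μ₁ := Function.update μ .W F with hμ₁
    have hWe : μ₁ .W = F := by simp [hμ₁]
    have hag₁ : Agree tailVars μ μ₁ := (Agree.refl _ _).update (by simp [tailVars]) _
    -- Since p < 2s, the last p positions meet at most three s-blocks, so at most three classes are
    -- searched.
    have hk : (o - 1) / s - (o - p) / s + 1 ≤ (3 : ℕ) := by
      have h1 : (o - 1) / s ≤ (o - p + 2 * s) / s := Int.ediv_le_ediv hs (by omega)
      rw [Int.add_mul_ediv_right _ _ hs.ne'] at h1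
      push_cast
      omega
    have hoe : μ₁ .oldTail 0 = o := by simp [hμ₁, hμo]
    have hpe : μ₁ .p 0 = p := by simp [hμ₁, hμp]
    refine (runs_getZeros_forFound H (l := o - p) (r := o - 1) (h := h) (o := o)
      (n := L * 120 + 250) (D := fun z W => ∀ y, h ≤ y → y < o → p ∣ y - z → Final enc m W y)
      (s := s) hs (by simp [hμ₁, hblock]) (by omega) (by omega) (by omega) ?_ ?_ ?_ hk ?_).mono ?_ ?_
    · intro μ' h1 ρ i
      simp [Expr.eval, Name.val, h1 .oldTail (by simp), h1 .p (by simp), hoe, hpe]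
    · intro μ' h1 ρ i
      simp [Expr.eval, Name.val, h1 .oldTail (by simp), hoe]
    · intro x y h1 h2 h3 h4 h5 h6 h7
      rw [hWe] at h6 h7
      exact huniq x y (by omega) (by omega) (by omega) (by omega) h5 (hext.zero h6) (hext.zero h7)
    · intro μ' hag hTE' hz1 hz2 _
      have hag' := hag₁.trans hag
      refine (runs_finalizeClass H hT hp hho ho hL (z := μ' .z 0)
        (by rw [hag' .m (by simp [tailVars]), hm]) (by rw [hag' .p (by simp [tailVars]), hμp])
        (by rw [hag' .tail (by simp [tailVars]), hμt])
        (by rw [hag' .oldTail (by simp [tailVars]), hμo]) rfl (by omega) ?_).mono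
        le_rfl ?_
      · intro y h1 h2
        rw [hWe] at hTE'
        exact (hext.trans hTE'.ext).valid (hv y (by omega) h2)
      · rintro μ'' ⟨h1, h2, h3⟩
        refine ⟨h1.mono ?_, hTE'.trans h2, h3, fun z hz y h4 h5 h6 => h2.ext.final (hz y h4 h5 h6)⟩
        intro a ha
        simp only [searchVars, Set.mem_insert_iff, Set.mem_singleton_iff] at ha ⊢
        tauto
    · simp [Expr.size, Name.val]
      omega
    · rintro μ' ⟨h1, h2, h3⟩
      rw [hWe] at h2 h3
      refine ⟨hag₁.trans h1, hTE.trans h2, fun y hy1 hy2 => ?_⟩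
      by_cases hy : F y = 0
      · have hb := hqb y (by omega)
        refine h3 (q y) hb.2.1 hb.2.2 (hzero y hy1 hy2 hy) y hy1 hy2 ?_
        rw [← neg_sub, dvd_neg]
        exact hqd y
      · exact h2.ext.final ⟨fun h => absurd h hy, hext.valid (hv y (by omega) hy2)⟩
  · simp [blockBound, Instr.bound, Op.bound, Expr.size, Cond.size, Name.val, Cond.ne]
    omega

/-- The agreement under the shift by p is assumed only when more than s positions have to be
finalized: only then is h = m - lcp, so that the common prefix reaches far enough. -/
lemma runs_finalizeTail (H : Oracle V enc m) (hT : Transfers enc m) {h o s : ℤ} {L : ℕ}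
    {μ : Mem} (hs : 0 < s) (hL : m ≤ 2 ^ L) (hblock : μ .block 0 = s) (hm : μ .m 0 = m)
    (hμt : μ .tail 0 = h) (hμo : μ .oldTail 0 = o) (hh : 0 ≤ h) (hos : h ≤ o - s) (ho : o ≤ m)
    (hp : h ≠ o - s → AgreesShifted enc m (μ .p 0) h ∧ μ .p 0 < 2 * s)
    (hv : ∀ y, 0 ≤ y → y < o → μ .W y ≠ 0 → Wit enc m y (μ .W y))
    (huniq : ∀ x y, 0 ≤ x → x < o → 0 ≤ y → y < o → x / s = y / s →
      μ .W x = 0 → μ .W y = 0 → x = y) :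
    Runs V finalizeTail μ (L * 360 + 1220)
      fun μ' => Agree tailVars μ μ' ∧ TailExt enc m h o (μ .W) (μ' .W) ∧
        ∀ y, h ≤ y → y < o → Final enc m (μ' .W) y := by
  refine Runs.le (Runs.ite (n := L * 360 + 1200) ?_ ?_) ?_
  · intro hg
    have hg : o - h = s := by simpa [Cond.eval, Expr.eval, Name.val, hμt, hμo, hblock] using hg
    exact (runs_finalizeShort H hs hblock hm hμt hμo hh hg ho
      (fun y h1 => hv y (by omega)) huniq).le (by omega)
  · intro hg
    have hg : ¬ o - h = s := by simpa [Cond.eval, Expr.eval, Name.val, hμt, hμo, hblock] using hg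
    obtain ⟨h1, h2⟩ := hp (by omega)
    exact runs_finalizeLong H hT hs h1 h2 hL hblock hm rfl hμt hμo (by omega) ho hv huniq
  · simp [Cond.size, Expr.size, Name.val]
    omega

end Tail

/-! ## Rounds -/

section Rounds

variable {β : Type*} [DecidableEq β] {V : Env β} {enc : ℤ → ℤ → Option β} {m : ℤ}

/-- The invariant of the main loop after `k` rounds. -/
structure RoundInv (enc : ℤ → ℤ → Option β) (m : ℤ) (k : ℕ) (μ : Mem) : Prop where
  m_eq : μ .m 0 = m
  tail_nonneg : 0 ≤ μ .tail 0
  tail_le : μ .tail 0 ≤ m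
  block_eq : μ .block 0 = 2 ^ k
  sparse : ZSparse (μ .W) (μ .tail 0) (2 ^ k)
  valid : ∀ i, 0 ≤ i → i < μ .tail 0 → μ .W i ≠ 0 → Wit enc m i (μ .W i)
  le : ∀ i, 0 ≤ i → i < μ .tail 0 → μ .W i ≤ m - μ .tail 0 + 2 ^ k
  final : ∀ i, μ .tail 0 ≤ i → i < m → Final enc m (μ .W) i

lemma runs_setup (H : Oracle V enc m) {μ : Mem} (hm : μ .m 0 = m) :
    Runs V setup μ 40 (RoundInv enc m 0) := by
  have hm0 := H.m_nonneg
  have hNm := H.m_lt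
  refine Runs.le (Runs.cons (n₂ := 20) (Runs.par 0 (m - 1) rfl (by simp [Expr.eval, Name.val, hm])
    (by omega) (wp_cons_write fun F hF => ?_))) ?_
  · have hF0 : ∀ z, 0 ≤ z → z < m → F z = 0 := by
      intro z h1 h2
      rcases hF z with ⟨h, -⟩ | ⟨i, -, -, -, -, h, -⟩
      · exact absurd rfl (h z h1 (by omega) rfl)
      · exact h
    refine Runs.le (Runs.cons (n₂ := 7) (runs_assign m (by simp [Expr.eval, Name.val, hm])
      (Runs.le (Runs.last (runs_assign 1 rfl ?_)) (by simp [Expr.size])))) (by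
        simp [Expr.size, Name.val])
    refine ⟨by simpa using hm, by simpa using hm0, by simp, by simp, ?_, ?_, ?_, ?_⟩
    · constructor
      · intro x y _ _ _ _ hxy _ _
        simpa using hxy
      · intro c hc hcm
        simp only [pow_zero, mul_one, ne_eq, reduceCtorEq, not_false_eq_true, setVar_of_ne,
          setVar_self] at hcm
        exact ⟨c, hc, by simp, by simpa using hF0 c hc (by omega)⟩
    · intro i h1 h2 h3
      simp only [ne_eq, reduceCtorEq, not_false_eq_true, setVar_of_ne, setVar_self,
        Function.update_self] at h2 h3
      exact absurd (hF0 i h1 h2) h3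
    · intro i h1 h2
      simp only [ne_eq, reduceCtorEq, not_false_eq_true, setVar_of_ne, setVar_self,
        Function.update_self] at h2 ⊢
      rw [hF0 i h1 h2]
      simp
    · intro i h1 h2
      simp only [ne_eq, reduceCtorEq, not_false_eq_true, setVar_of_ne, setVar_self] at h1
      omega
  · simp [blockBound, Instr.bound, Op.bound, Expr.size, Cond.size, Name.val]

/-- The first part of a round. -/
def findPeriod : Prog := getZeros Name.block.val
    (.sub (.min (.mul (.lit 2) Name.block.val) Name.tail.val) (.lit 1))

/-- The second part of a round, if there is a suspected period. -/
def treatPeriod : Prog := block [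
  checkParallel Name.p.val,
  store .W Name.p.val Name.check.val,
  .ite (.eq (.get .W Name.p.val) (.lit 0))
    (assign .lcp (.sub Name.m.val Name.p.val))
    (assign .lcp (.sub (.get .W Name.p.val) (.lit 1))),
  assign .oldTail Name.tail.val,
  assign .tail (.min (.sub Name.oldTail.val Name.block.val) (.sub Name.m.val Name.lcp.val)),
  satisfySparsity (.sub Name.tail.val (.lit 1)),
  finalizeTail]

omit [DecidableEq β] in
/-- A table in which no zero lies in the second block. -/
lemma RoundInv.succ_of_not_found {k : ℕ} {μ μ' : Mem} (hI : RoundInv enc m k μ)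
    (hm : μ' .m = μ .m) (ht : μ' .tail = μ .tail) (hW : μ' .W = μ .W)
    (hb : μ' .block 0 = 2 * 2 ^ k)
    (hz : ∀ z, 2 ^ k ≤ z → z < 2 * 2 ^ k → z < μ .tail 0 → μ .W z ≠ 0) :
    RoundInv enc m (k + 1) μ' := by
  have hs : (0 : ℤ) < 2 ^ k := by positivity
  obtain ⟨h1, h2, h3, h4, h5, h6, h7, h8⟩ := hI
  have hpow : (2 : ℤ) ^ (k + 1) = 2 * 2 ^ k := by rw [pow_succ, mul_comm]
  -- A full second block would contain a zero. Hence the head is shorter than one block of the next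
  -- length, and all its zeros lie in the first old block.
  have hlt : μ .tail 0 < 2 * 2 ^ k := by
    by_contra hle
    obtain ⟨x, hx0, hx1, hx2⟩ := h5.exist 1 (by norm_num) (by omega)
    rw [ediv_eq_iff_mul_le hs] at hx1
    exact hz x (by omega) (by omega) (by omega) hx2
  refine ⟨hm ▸ h1, ht ▸ h2, ht ▸ h3, hpow ▸ hb, ?_, ht ▸ hW ▸ h6, ?_, ht ▸ hW ▸ h8⟩
  · rw [hW, ht, hpow]
    constructor
    · intro x y hx1 hx2 hy1 hy2 _ hx hy
      have hxs : x < 2 ^ k := by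
        by_contra hge
        exact hz x (by omega) (by omega) hx2 hx
      have hys : y < 2 ^ k := by
        by_contra hge
        exact hz y (by omega) (by omega) hy2 hy
      refine h5.uniq x y hx1 hx2 hy1 hy2 ?_ hx hy
      rw [Int.ediv_eq_zero_of_lt hx1 hxs, Int.ediv_eq_zero_of_lt hy1 hys]
    · intro c hc hch
      have : 1 * (2 * 2 ^ k) ≤ (c + 1) * (2 * (2 : ℤ) ^ k) :=
        mul_le_mul_of_nonneg_right (by omega) (by positivity)
      omega
  · rw [hW, ht, hpow]
    intro i hi0 hi
    have := h7 i hi0 hi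
    omega

/-- The tables during a round with the suspected period `p`; `c` is the result of `Check(p)`. -/
structure RoundTables (enc : ℤ → ℤ → Option β) (m p c h h' s : ℤ) (W₀ W₁ W₂ W₃ : ℤ → ℤ) :
    Prop where
  first : W₁ = Function.update W₀ p c
  second : IsSparsified enc m W₁ W₂ h' s
  third : TailExt enc m h' h W₂ W₃
  final : ∀ y, h' ≤ y → y < h → Final enc m W₃ y

/-- The suspected period `p`, the result `c` of `Check(p)`, the length `lcp` of the common prefix
and the new border `h'` of the head. -/
structure Suspected (enc : ℤ → ℤ → Option β) (m p c lcp h h' s : ℤ) (W : ℤ → ℤ) : Prop where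
  s_pos : 0 < s
  ge : s ≤ p
  lt : p < 2 * s
  lt_tail : p < h
  zero : W p = 0
  check : IsCheck enc m p c
  lcp_of_zero : c = 0 → lcp = m - p
  lcp_of_ne_zero : c ≠ 0 → lcp = c - 1
  tail_eq : h' = min (h - s) (m - lcp)
  tail_le : h ≤ m

namespace Suspected

variable {p c lcp h h' s : ℤ} {W : ℤ → ℤ}

omit [DecidableEq β] in
lemma lcp_le (S : Suspected enc m p c lcp h h' s W) : p + lcp ≤ m := by
  by_cases hc : c = 0
  · have := S.lcp_of_zero hc; omega
  · have h1 := S.lcp_of_ne_zero hc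
    have h2 := (S.check.wit.resolve_left hc).2.2.1
    omega

omit [DecidableEq β] in
-- The check returns the smallest witness, so there is no mismatch at or before lcp. Here tightness
-- of the witness matters.
lemma enc_eq (S : Suspected enc m p c lcp h h' s W) (v : ℤ) (h1 : 1 ≤ v) (h2 : v ≤ lcp) :
    enc p v = enc 0 v := by
  by_contra hne
  have h3 := S.lcp_le
  have h4 := S.s_pos
  have h5 := S.ge
  have hw : Wit enc m p v := ⟨by omega, h1, by omega, hne⟩
  rcases S.check with ⟨-, h⟩ | ⟨h6, h⟩
  · exact h v hw
  · have h7 := h v hw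
    have h8 := S.lcp_of_ne_zero (by have := h6.pos; omega)
    omega

omit [DecidableEq β] in
-- The head always keeps position 0: h - s > 0 because s ≤ p < h, and m - lcp ≥ p > 0.
lemma one_le_tail (S : Suspected enc m p c lcp h h' s W) : 1 ≤ h' := by
  have h1 := S.lcp_le
  have h2 := S.s_pos
  have h3 := S.ge
  have h4 := S.lt_tail
  rw [S.tail_eq]
  exact le_min (by omega) (by omega)

omit [DecidableEq β] in
lemma tail_le_sub (S : Suspected enc m p c lcp h h' s W) : h' ≤ h - s ∧ h' ≤ m - lcp := by
  rw [S.tail_eq]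
  exact ⟨min_le_left _ _, min_le_right _ _⟩

omit [DecidableEq β] in
lemma agreesShifted (S : Suspected enc m p c lcp h h' s W) (hne : h' ≠ h - s) :
    AgreesShifted enc m p h' := by
  have h1 := S.lcp_le
  have h2 := S.s_pos
  have h3 := S.ge
  have h4 : h' = m - lcp := by
    have := S.tail_eq
    omega
  exact ⟨by omega, by omega, fun v hv1 hv2 => S.enc_eq v hv1 (by omega)⟩

omit [DecidableEq β] in
lemma ext (S : Suspected enc m p c lcp h h' s W) : Ext enc m W (Function.update W p c) :=
  .update S.zero S.check.wit

end Suspected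

omit [DecidableEq β] in
lemma RoundInv.zero {k : ℕ} {μ : Mem} (hI : RoundInv enc m k μ) (ht : 0 < μ .tail 0) :
    μ .W 0 = 0 := by
  by_contra hne
  exact not_wit_zero _ (hI.valid 0 le_rfl ht hne)

omit [DecidableEq β] in
/-- After `Check(p)`, all entries in the first two blocks but the first are witnesses. -/
lemma RoundInv.first_blocks {k : ℕ} {μ : Mem} {p c lcp h' : ℤ} (hI : RoundInv enc m k μ)
    (S : Suspected enc m p c lcp (μ .tail 0) h' (2 ^ k) (μ .W)) (a : ℤ) (ha0 : 0 < a)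
    (ha : a < 2 * 2 ^ k) (hah : a < h') :
    Wit enc m a (Function.update (μ .W) p c a) ∧ Function.update (μ .W) p c a ≤ m - h' + 1 := by
  have hs := S.s_pos
  have h1 := S.tail_le_sub
  by_cases hap : a = p
  · subst hap
    rw [Function.update_self]
    -- If p is a period, then lcp = m - p and p itself moves to the tail; a position p < h'
    -- therefore has a witness.
    have hc : c ≠ 0 := fun hc => by
      have := S.lcp_of_zero hc
      omega
    refine ⟨S.check.wit.resolve_left hc, ?_⟩
    have := S.lcp_of_ne_zero hc
    omega
  · rw [Function.update_of_ne hap]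
    have hne : μ .W a ≠ 0 := by
      intro hz
      by_cases has : a < 2 ^ k
      · have := hI.sparse.uniq a 0 ha0.le (by omega) le_rfl (by omega)
          (by rw [Int.ediv_eq_zero_of_lt ha0.le has, Int.zero_ediv]) hz (hI.zero (by omega))
        omega
      · apply hap
        have hp1 := S.ge
        have hp2 := S.lt
        refine hI.sparse.uniq a p ha0.le (by omega) (by omega) S.lt_tail ?_ hz S.zero
        have e1 : a / 2 ^ k = 1 := (ediv_eq_iff_mul_le hs).2 (by omega)
        have e2 : p / 2 ^ k = 1 := (ediv_eq_iff_mul_le hs).2 (by omega)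
        rw [e1, e2]
    refine ⟨hI.valid a ha0.le (by omega) hne, ?_⟩
    -- The old bound m - h + 2 ^ k is at most m - h', precisely because the head shrinks by at least
    -- 2 ^ k.
    have := hI.le a ha0.le (by omega)
    omega

omit [DecidableEq β] in
-- In the first doubled block only offset 0 remains zero; the other blocks are sparse by the duels.
-- Tables only change by replacing zeros with witnesses, so validity and finality persist.
lemma RoundInv.succ_of_found {k : ℕ} {μ μ' : Mem} {p c lcp h' : ℤ} {W₁ W₂ : ℤ → ℤ}
    (hI : RoundInv enc m k μ) (S : Suspected enc m p c lcp (μ .tail 0) h' (2 ^ k) (μ .W))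
    (hT : RoundTables enc m p c (μ .tail 0) h' (2 ^ k) (μ .W) W₁ W₂ (μ' .W))
    (hm : μ' .m 0 = m) (ht : μ' .tail 0 = h') (hb : μ' .block 0 = 2 * 2 ^ k) :
    RoundInv enc m (k + 1) μ' := by
  have hs := S.s_pos
  have h1 := S.tail_le_sub
  have h2 := S.one_le_tail
  have hpow : (2 : ℤ) ^ (k + 1) = 2 * 2 ^ k := by rw [pow_succ, mul_comm]
  obtain ⟨hW₁, hW₂, hW₃, hfin⟩ := hT
  have e₁ : Ext enc m (μ .W) W₁ := hW₁ ▸ S.ext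
  have e₂ : Ext enc m (μ .W) W₂ := e₁.trans hW₂.ext
  have e₃ : Ext enc m (μ .W) (μ' .W) := e₂.trans hW₃.ext
  have hfb := hI.first_blocks S
  rw [← hW₁] at hfb
  have hsmall : ∀ a, 0 ≤ a → a < 2 * 2 ^ k → a < h' → μ' .W a = 0 → a = 0 := by
    intro a h3 h4 h5 h6
    by_contra hne
    have h7 := (hfb a (by omega) h4 h5).1.pos
    have := hW₂.ext.zero (hW₃.ext.zero h6)
    omega
  have hzero : μ' .W 0 = 0 := by
    by_contra hne
    exact not_wit_zero _ (e₃.valid (hI.valid 0 le_rfl (by omega)) hne)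
  refine ⟨hm, by omega, by have := S.tail_le; omega, by rw [hb, hpow], ?_, ?_, ?_, ?_⟩
  · rw [ht, hpow]
    constructor
    · intro x y hx1 hx2 hy1 hy2 hxy hx hy
      have h2s : (0 : ℤ) < 2 * 2 ^ k := by omega
      by_cases hxs : x < 2 * 2 ^ k
      · rw [Int.ediv_eq_zero_of_lt hx1 hxs] at hxy
        have hys := (ediv_eq_iff_mul_le h2s).1 hxy.symm
        rw [hsmall x hx1 hxs hx2 hx, hsmall y hy1 (by omega) hy2 hy]
      · by_cases hys : y < 2 * 2 ^ k
        · rw [Int.ediv_eq_zero_of_lt hy1 hys] at hxy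
          have := (ediv_eq_iff_mul_le h2s).1 hxy
          omega
        · exact hW₂.uniq x y (by omega) hx2 (by omega) hy2 hxy (hW₃.ext.zero hx) (hW₃.ext.zero hy)
    · intro d hd hdh
      rcases hd.eq_or_lt with rfl | hd
      · exact ⟨0, le_rfl, by simp, hzero⟩
      · have e : (d + 1) * (2 * 2 ^ k) = (2 * d + 1) * 2 ^ k + (2 : ℤ) ^ k := by ring
        rw [e] at hdh
        -- The left half of a full doubled block was a full old block. Its zero differs from p as d
        -- ≥ 1, and it or its opponent survives the duel.
        obtain ⟨x, hx0, hx1, hx2⟩ := hI.sparse.exist (2 * d) (by omega) (by omega)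
        have hxb := (ediv_eq_iff_mul_le hs).1 hx1
        have e' : (2 * d + 1) * (2 : ℤ) ^ k = 2 * d * 2 ^ k + 2 ^ k := by ring
        have e'' : 2 * 1 * (2 : ℤ) ^ k ≤ 2 * d * 2 ^ k :=
          mul_le_mul_of_nonneg_right (by omega) hs.le
        have hp := S.lt
        have hW₁x : W₁ x = 0 := by
          rw [hW₁, Function.update_of_ne (by omega), hx2]
        obtain ⟨z, hz1, hz2, hz3⟩ := hW₂.exist x (by omega) (by omega) hW₁x
        rw [ediv_two_mul x _ hs, hx1, Int.mul_ediv_cancel_left _ two_ne_zero] at hz1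
        refine ⟨z, hz3, hz1, ?_⟩
        have hzb := (ediv_eq_iff_mul_le (by omega)).1 hz1
        have e3 : d * (2 * 2 ^ k) = 2 * d * (2 : ℤ) ^ k := by ring
        rw [hW₃.frame z (by omega), hz2]
  · intro i hi0 hi
    exact e₃.valid (hI.valid i hi0 (by omega))
  · rw [ht, hpow]
    intro i hi0 hi
    rw [hW₃.frame i (.inl hi)]
    rcases hW₂.le i with h | h
    · rw [h, hW₁]
      by_cases hip : i = p
      · subst hip
        rw [Function.update_self]
        by_cases hc : c = 0
        · have := S.tail_le; omega
        · have := S.lcp_of_ne_zero hc; omega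
      · rw [Function.update_of_ne hip]
        have := hI.le i hi0 (by omega)
        omega
    · exact h
  · rw [ht]
    intro i hi him
    by_cases hih : i < μ .tail 0
    · exact hfin i hi hih
    · exact e₃.final (hI.final i (by omega) him)

lemma runs_treatPeriod (H : Oracle V enc m) (hT : Transfers enc m) {k L : ℕ} {μ μ₁ : Mem}
    {p : ℤ} (hL : m ≤ 2 ^ L) (hI : RoundInv enc m k μ) (hag : Agree {.size, .A, .p} μ μ₁)
    (hμp : μ₁ .p 0 = p) (hge : 2 ^ k ≤ p) (hlt : p < 2 * 2 ^ k) (hlt' : p < μ .tail 0)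
    (hz : μ .W p = 0) :
    Runs V treatPeriod μ₁ (L * 360 + 1900) fun μ' =>
      ∃ c lcp h' W₁ W₂, Suspected enc m p c lcp (μ .tail 0) h' (2 ^ k) (μ .W) ∧
        RoundTables enc m p c (μ .tail 0) h' (2 ^ k) (μ .W) W₁ W₂ (μ' .W) ∧
        μ' .m 0 = m ∧ μ' .tail 0 = h' ∧ μ' .block 0 = 2 ^ k := by
  have hs : (0 : ℤ) < 2 ^ k := by positivity
  have hme : μ₁ .m 0 = m := by rw [hag .m (by simp), hI.m_eq]
  have hbe : μ₁ .block 0 = 2 ^ k := by rw [hag .block (by simp), hI.block_eq]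
  have hte : μ₁ .tail 0 = μ .tail 0 := by rw [hag .tail (by simp)]
  have hWe : μ₁ .W = μ .W := hag .W (by simp)
  set h := μ .tail 0 with hh
  refine Runs.le (Runs.cons (n₂ := L * 360 + 1850) (runs_checkParallel H (a := p) hme (by omega)
    (hμp ▸ stable_val .p _ (by simp) μ₁) fun c hc =>
    Runs.le (Runs.cons (n₂ := L * 360 + 1830) (Runs.store ?_)) ?_)) ?_
  · have e1 : Name.p.val.eval (setVar μ₁ .check c) (Priv.init (β := β)) 0 = p := by
      simp [Name.val, Expr.eval, hμp]
    have e2 : Name.check.val.eval (setVar μ₁ .check c) (Priv.init (β := β)) 0 = c := by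
      simp [Name.val, Expr.eval]
    rw [e1, e2, setVar_W (by decide), hWe]
    set W₁ := Function.update (μ .W) p c with hW₁
    set μ₂ := Function.update (setVar μ₁ .check c) .W W₁ with hμ₂
    set lcp := if c = 0 then m - p else c - 1 with hlcp
    set h' := min (h - 2 ^ k) (m - lcp) with hh'
    have S : Suspected enc m p c lcp h h' (2 ^ k) (μ .W) :=
      ⟨hs, hge, hlt, hlt', hz, hc, fun h => by simp [hlcp, h], fun h => by simp [hlcp, h], rfl,
        hI.tail_le⟩
    have h1 := S.tail_le_sub
    have h2 := S.one_le_tail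
    have htl := S.tail_le
    have hW₂ : μ₂ .W = W₁ := by simp [hμ₂]
    have hWp : W₁ p = c := by simp [hW₁]
    have hlcpR : Runs V (.ite (.eq (.get .W Name.p.val) (.lit 0))
        (assign .lcp (.sub Name.m.val Name.p.val))
        (assign .lcp (.sub (.get .W Name.p.val) (.lit 1)))) μ₂ 30
        fun μ' => μ' = setVar μ₂ .lcp lcp := by
      have hp₂ : μ₂ .p 0 = p := by simp [hμ₂, hμp]
      have hm₂ : μ₂ .m 0 = m := by simp [hμ₂, hme]
      refine Runs.le (Runs.ite (n := 15) ?_ ?_) ?_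
      · intro hg
        have hc0 : c = 0 := by
          simpa [Cond.eval, Expr.eval, Name.val, hp₂, hW₂, hWp] using hg
        refine (runs_assign lcp ?_ ?_).le (by simp [Expr.size, Name.val])
        rotate_left
        · rfl
        simp [Expr.eval, Name.val, hlcp, hc0, hm₂, hp₂]
      · intro hg
        have hc0 : c ≠ 0 := by
          simpa [Cond.eval, Expr.eval, Name.val, hp₂, hW₂, hWp] using hg
        refine (runs_assign lcp ?_ ?_).le (by simp [Expr.size, Name.val])
        rotate_left
        · rfl
        simp [Expr.eval, Name.val, hlcp, hc0, hp₂, hW₂, hWp]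
      · simp [Cond.size, Expr.size, Name.val]
    refine Runs.le (Runs.cons (n₂ := L * 360 + 1760) (hlcpR.mono le_rfl ?_)) (by omega)
    rintro _ rfl
    set μ₄ := setVar (setVar (setVar μ₂ .lcp lcp) .oldTail h) .tail h' with hμ₄
    refine Runs.le (Runs.cons (n₂ := L * 360 + 1740) (runs_assign h
      (by simp [Expr.eval, Name.val, hμ₂, hte])
      (Runs.le (Runs.cons (n₂ := L * 360 + 1700) (runs_assign h'
        (by simp [Expr.eval, Name.val, hμ₂, hbe, hme, hh'])
        (Runs.le (Runs.cons (n₂ := L * 360 + 1220) (runs_satisfySparsity H hT (h := h') (μ := μ₄) hs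
          (by simp [hμ₄, hμ₂, hbe]) h2 (by omega) ?_ ?_ ?_ fun n A W₂ hSp => ?_)) ?_))) ?_))) ?_
    · intro μ' hμ' ρ i
      simp [Expr.eval, Name.val, hμ' .tail (by simp), hμ₄]
    · intro a ha0 ha hah
      have hWe₄ : μ₄ .W = W₁ := by simp [hμ₄, hW₂]
      rw [hWe₄]
      exact hI.first_blocks S a ha0 ha hah
    · intro x y hx1 hx2 hy1 hy2 hxy hx hy
      have hWe₄ : μ₄ .W = W₁ := by simp [hμ₄, hW₂]
      rw [hWe₄] at hx hy
      exact hI.sparse.uniq x y (by omega) (by omega) (by omega) (by omega) hxy (S.ext.zero hx)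
        (S.ext.zero hy)
    · have hWe₄ : μ₄ .W = W₁ := by simp [hμ₄, hW₂]
      rw [hWe₄] at hSp
      have e₂ : Ext enc m (μ .W) W₂ := S.ext.trans hSp.ext
      refine (Runs.last (runs_finalizeTail H hT (h := h') (o := h) (s := 2 ^ k) hs hL
        (by simp [hμ₄, hμ₂, hbe]) (by simp [hμ₄, hμ₂, hme]) (by simp [hμ₄]) (by simp [hμ₄])
        (by omega) h1.1 htl ?_ ?_ ?_)).mono le_rfl ?_
      · intro hne
        have hp₅ : Function.update (Function.update (setVar μ₄ .size n) .A A) .W W₂ .p 0 = p := by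
          simp [hμ₄, hμ₂, hμp]
        rw [hp₅]
        exact ⟨S.agreesShifted hne, hlt⟩
      · rw [Function.update_self]
        intro y hy0 hy
        exact e₂.valid (hI.valid y hy0 hy)
      · rw [Function.update_self]
        intro x y hx1 hx2 hy1 hy2 hxy hx hy
        exact hI.sparse.uniq x y hx1 hx2 hy1 hy2 hxy (e₂.zero hx) (e₂.zero hy)
      · rintro μ' ⟨h3, h4, h5⟩
        rw [Function.update_self] at h4
        refine ⟨c, lcp, h', W₁, W₂, S, ⟨rfl, hSp, h4, h5⟩, ?_, ?_, ?_⟩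
        · rw [h3 .m (by simp [tailVars])]; simp [hμ₄, hμ₂, hme]
        · rw [h3 .tail (by simp [tailVars])]; simp [hμ₄]
        · rw [h3 .block (by simp [tailVars])]; simp [hμ₄, hμ₂, hbe]
    · simp [Expr.size, Name.val]; omega
    · simp [Expr.size, Name.val]; omega
    · simp [Expr.size, Name.val]; omega
  · simp [Expr.size, Name.val]; omega
  · simp [Expr.size, Name.val]; omega

lemma roundBody_eq : roundBody = block [
    findPeriod,
    assign .p (.get .A (.lit 0)),
    .ite (.ne Name.p.val (.lit (-1))) treatPeriod .skip,
    assign .block (.mul (.lit 2) Name.block.val)] := rfl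

lemma runs_roundBody (H : Oracle V enc m) (hT : Transfers enc m) {k L : ℕ} {μ : Mem}
    (hL : m ≤ 2 ^ L) (hI : RoundInv enc m k μ) (hg : 2 ^ k < μ .tail 0) :
    Runs V roundBody μ (L * 360 + 2100) (RoundInv enc m (k + 1)) := by
  have hs : (0 : ℤ) < 2 ^ k := by positivity
  have htl := hI.tail_le
  rw [roundBody_eq]
  set h := μ .tail 0 with hh
  set r := min (2 * 2 ^ k) h - 1 with hr
  -- Both ends of the range lie in the block of index 1, so the list of zeros has a single entry.
  have hrs : r / 2 ^ k = 1 := (ediv_eq_iff_mul_le hs).2 (by omega)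
  have hss : (2 : ℤ) ^ k / 2 ^ k = 1 := Int.ediv_self hs.ne'
  refine Runs.le (Runs.cons (n₂ := L * 360 + 2000) (runs_getZeros H (l := 2 ^ k) (r := r)
    (s := 2 ^ k) hs hI.block_eq hs.le (by omega) (by omega)
    (hI.block_eq ▸ stable_val .block _ (by simp) μ) ?_ fun A hA => ?_)) ?_
  · intro μ' h1 ρ i
    simp [Expr.eval, Name.val, h1 .block (by simp), h1 .tail (by simp), hI.block_eq, hr, hh]
  · rw [hrs, hss] at hA ⊢
    set μ₁ := Function.update (setVar μ .size (1 - 1 + 1)) .A A with hμ₁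
    have hag : Agree {.size, .A, .p} μ (setVar μ₁ .p (A 0)) :=
      (((Agree.refl _ _).setVar (by simp) _).update (by simp) _).setVar (by simp) _
    have hA0 := hA 0 le_rfl (by norm_num)
    refine Runs.le (Runs.cons (n₂ := L * 360 + 1950) (runs_assign (A 0)
      (by simp [Expr.eval, hμ₁]) (Runs.le (Runs.cons (n₂ := 10)
        (Runs.ite (n := L * 360 + 1900) ?_ ?_)) ?_))) ?_
    · intro hg
      have hp : A 0 ≠ -1 := by simpa [Cond.ne, Cond.eval, Expr.eval, Name.val] using hg
      obtain ⟨h1, h2, -, h3⟩ := hA0.resolve_left fun h => hp h.1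
      refine (runs_treatPeriod H hT hL hI hag (by simp) h1 (by omega) (by omega) h3).mono
        le_rfl ?_
      rintro μ' ⟨c, lcp, h', W₁, W₂, S, hRT, hm, ht, hb⟩
      refine Runs.le (Runs.last (runs_assign (2 * 2 ^ k) (by simp [Expr.eval, Name.val, hb]) ?_))
        (by simp [Expr.size, Name.val])
      refine hI.succ_of_found S (W₁ := W₁) (W₂ := W₂) ?_ ?_ ?_ ?_
      · rwa [setVar_W (by decide)]
      · simpa using hm
      · simpa using ht
      · simp
    · intro hg
      have hp : A 0 = -1 := by simpa [Cond.ne, Cond.eval, Expr.eval, Name.val] using hg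
      have h1 := (hA0.resolve_right fun h => by omega).2
      refine Runs.skip (Runs.le (Runs.last (runs_assign (2 * 2 ^ k)
        (by simp [Expr.eval, Name.val, hμ₁, hI.block_eq]) ?_)) (by simp [Expr.size, Name.val]))
      refine hI.succ_of_not_found (by simp [hμ₁]) (by simp [hμ₁]) (by simp [hμ₁]) (by simp) ?_
      intro z hz1 hz2 hz3
      refine h1 z hz1 (by omega) ?_
      rw [(ediv_eq_iff_mul_le hs (c := 1)).2 (by omega)]
      norm_num
    · simp [Cond.size, Expr.size, Name.val, Cond.ne]; omega
    · simp [Expr.size]; omega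
  · simp [Expr.size, Name.val]; omega

omit [DecidableEq β] in
/-- When the loop stops after `k` rounds, all positions are finalized. -/
lemma RoundInv.final_of_le {k : ℕ} {μ : Mem} (hI : RoundInv enc m k μ) (hle : μ .tail 0 ≤ 2 ^ k)
    (i : ℤ) (hi0 : 0 ≤ i) (him : i < m) : Final enc m (μ .W) i := by
  by_cases hi : i < μ .tail 0
  · refine ⟨fun hz => ?_, hI.valid i hi0 hi⟩
    have : i = 0 := hI.sparse.uniq i 0 hi0 hi le_rfl (by omega)
      (by rw [Int.ediv_eq_zero_of_lt hi0 (by omega), Int.zero_ediv]) hz (hI.zero (by omega))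
    rw [this]
    exact not_wit_zero
  · exact hI.final i (by omega) him

lemma roundGuard_eval {k : ℕ} {μ : Mem} (hI : RoundInv enc m k μ) :
    roundGuard.eval μ (Priv.init (β := β)) 0 = true ↔ 2 ^ k < μ .tail 0 := by
  simp [roundGuard, Cond.eval, Expr.eval, Name.val, hI.block_eq]

/-- The guard 2 ^ k < tail ≤ m ≤ 2 ^ L fails at k = L, so L rounds suffice. -/
lemma runs_preprocessing (H : Oracle V enc m) (hT : Transfers enc m) {L : ℕ} {μ : Mem}
    (hL : m ≤ 2 ^ L) (hm : μ .m 0 = m) :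
    Runs V preprocessing μ (40 + (L * (L * 360 + 2110) + 10)) fun μ' =>
      ∀ i, 0 ≤ i → i < m → Final enc m (μ' .W) i := by
  refine Runs.seq ((runs_setup H hm).mono le_rfl fun μ₀ h₀ => ?_)
  refine Runs.le (Runs.while (b := L * 360 + 2100)
    (fun n μ' => ∃ k, k + n = L ∧ RoundInv enc m k μ') ?_ ?_ ?_ L μ₀ ⟨0, by simp, h₀⟩) ?_
  · rintro μ' ⟨k, hk, hI⟩
    rw [Bool.eq_false_iff, ne_eq, roundGuard_eval hI]
    obtain rfl : k = L := hk
    have := hI.tail_le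
    omega
  · rintro n μ' ⟨k, hk, hI⟩ hg
    refine (runs_roundBody H hT hL hI ((roundGuard_eval hI).1 hg)).mono le_rfl fun μ'' h => ?_
    exact ⟨k + 1, by omega, h⟩
  · rintro n μ' ⟨k, hk, hI⟩ hg
    rw [Bool.eq_false_iff, ne_eq, roundGuard_eval hI, not_lt] at hg
    exact hI.final_of_le hg
  · have : roundGuard.size = 5 := rfl
    rw [this]
    nlinarith

lemma AtRound.roundInv (H : Oracle V enc m) (hT : Transfers enc m) {L : ℕ} {μ : Mem}
    (hL : m ≤ 2 ^ L) (hm : μ .m 0 = m) {k : ℕ} {μ' : Mem} (h : AtRound V.E V.R μ k μ') :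
    RoundInv enc m k μ' := by
  induction h with
  | zero μ' t w h => exact (runs_setup H hm).post h
  | succ k μ₁ μ₂ t w _ hg he ih =>
    exact (runs_roundBody H hT hL ih ((roundGuard_eval ih).1 hg)).post he

end Rounds

/-! ## The theorem -/

section Main

variable {α β : Type*}

lemma RoundInv.roundInvariant {f : List α → List β} {P : List α} {k : ℕ} {μ : Mem}
    (hI : RoundInv (suffixSym f P) P.length k μ) : RoundInvariant f P k μ := by
  obtain ⟨-, h2, h3, h4, h5, h6, h7, h8⟩ := hI
  obtain ⟨h, hh⟩ := Int.eq_ofNat_of_zero_le h2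
  rw [hh] at h3 h5 h6 h7 h8
  refine ⟨h, hh, by exact_mod_cast h3, h4, ?_, fun i hi => ⟨fun hz => ?_, ?_⟩, fun i hi hiP => ?_⟩
  · rw [isSparse_iff (by positivity)]
    exact_mod_cast h5
  · rw [exists_mem_witnesses_iff]
    exact h6 i (by omega) (by omega) hz
  · have := h7 i (by omega) (by omega)
    have e : ((P.length - h + 2 ^ k : ℕ) : ℤ) = P.length - h + 2 ^ k := by
      rw [Nat.cast_add, Nat.cast_sub (by omega)]
      norm_cast
    rw [e]
    exact this
  · rw [finalized_iff]
    exact h8 i (by omega) (by omega)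

/-- The bounds within which the algorithm is run on the encoded pattern. -/
def patternEnv (f : List α → List β) (R : Subroutine β) (ξt ξw : ℕ → ℕ) (P : List α) : Env β where
  E := f P
  R := R
  -- The added 1 keeps the unit positive even for the empty pattern, where no call is made.
  τ := ξt P.length + 1
  ω := ξw P.length + 1
  N := P.length + 1
  τ_pos := by omega
  ω_pos := by omega
  N_pos := by omega

lemma Subroutine.Reencodes.oracle [DecidableEq β] {f : List α → List β} {R : Subroutine β}
    {ξt ξw : ℕ → ℕ} (hR : R.Reencodes f ξt ξw) (P : List α) :
    Oracle (patternEnv f R ξt ξw P) (suffixSym f P) P.length where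
  m_nonneg := by omega
  m_lt := by simp [patternEnv]
  load w _ _ := by simp [patternEnv, suffixSym]
  call x w hx hw hxw := by
    have h1 : 1 ≤ (x + 1).toNat := by omega
    have h2 : 1 ≤ w.toNat := by omega
    have h3 : (x + 1).toNat + w.toNat ≤ P.length + 1 := by omega
    refine ⟨?_, ?_, ?_⟩
    · change R.val (f P) _ _ = _
      rw [hR.val_eq P _ _ h1 h2 h3, reencoded, suffixSym, show (x + 1).toNat - 1 = x.toNat by omega]
    · exact (hR.time_le P _ _ h1 h2 h3).trans (Nat.le_succ _)
    · exact (hR.work_le P _ _ h1 h2 h3).trans (Nat.le_succ _)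

lemma clog_le_two_mul_logb {n : ℕ} (hn : 2 ≤ n) :
    1 ≤ Nat.clog 2 n ∧ (Nat.clog 2 n : ℝ) ≤ 2 * Real.logb 2 n := by
  have h1 : 1 ≤ Nat.clog 2 n := Nat.clog_pos (by norm_num) hn
  have hn0 : (0 : ℝ) < n := by positivity
  refine ⟨h1, ?_⟩
  have h2 : 2 ^ (Nat.clog 2 n).pred < n := Nat.pow_pred_clog_lt_self (by norm_num) hn
  have h3 : ((Nat.clog 2 n - 1 : ℕ) : ℝ) ≤ Real.logb 2 n := by
    rw [Real.le_logb_iff_rpow_le (by norm_num) hn0, Real.rpow_natCast]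
    exact_mod_cast h2.le
  have h4 : 1 ≤ Real.logb 2 n := by
    rw [Real.le_logb_iff_rpow_le (by norm_num) hn0, Real.rpow_one]
    exact_mod_cast hn
  rw [Nat.cast_sub h1, Nat.cast_one] at h3
  linarith

/-- As L ≥ 1, the polynomial in L is at most 2560 L². The factor 4 in `hK` absorbs the added ones in
the units, and L ≤ 2 log₂ n contributes another 4, for a total of 40960. -/
lemma cost_le_logb_sq {n : ℕ} (hn : 2 ≤ n) {x t K : ℕ} (hK : K ≤ 4 * x)
    (ht : t ≤ (40 + (Nat.clog 2 n * (Nat.clog 2 n * 360 + 2110) + 10)) * K) :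
    (t : ℝ) ≤ 41000 * (x * Real.logb 2 n ^ 2) := by
  obtain ⟨h1, h2⟩ := clog_le_two_mul_logb hn
  set L := Nat.clog 2 n
  have h3 : 40 + (L * (L * 360 + 2110) + 10) ≤ 2560 * L ^ 2 := by nlinarith
  have h4 : t ≤ 2560 * L ^ 2 * (4 * x) := ht.trans (Nat.mul_le_mul h3 hK)
  have h5 : (L : ℝ) ^ 2 ≤ (2 * Real.logb 2 n) ^ 2 := pow_le_pow_left₀ (by positivity) h2 2
  have h6 : (t : ℝ) ≤ 2560 * (L : ℝ) ^ 2 * (4 * x) := by exact_mod_cast h4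
  calc (t : ℝ) ≤ 2560 * (L : ℝ) ^ 2 * (4 * x) := h6
    _ ≤ 2560 * (2 * Real.logb 2 n) ^ 2 * (4 * x) := by gcongr
    _ = 40960 * (x * Real.logb 2 n ^ 2) := by ring
    _ ≤ 41000 * (x * Real.logb 2 n ^ 2) := by gcongr; norm_num

end Main

end WitnessPRAM

theorem mainTheorem2 :
    ∃ C : ℝ, ∀ (α : Type*) (β : Type*) [DecidableEq β]
      (r : List α → List α → Prop) (f : List α → List β) (ξt ξw : ℕ → ℕ) (R : Subroutine β),
      IsSCER r → IsEncoding r f → R.Reencodes f ξt ξw →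
      ∀ (P : List α) (μ : Mem), μ .m 0 = P.length →
        (∃ (μ' : Mem) (t w : ℕ), Exec (f P) R preprocessing μ μ' t w ∧
          IsWitnessTable f P (μ' .W) ∧
          (∀ a : ℕ, a < P.length →
            ((a = 0 ∨ IsPeriod r P a) → μ' .W a = 0) ∧
            (¬ (a = 0 ∨ IsPeriod r P a) → ∃ v ∈ witnesses f P a, μ' .W a = v)) ∧
          (2 ≤ P.length →
            (t : ℝ) ≤ C * ξt P.length * Real.logb 2 P.length ^ 2 ∧
            (w : ℝ) ≤ C * (ξw P.length * P.length * Real.logb 2 P.length ^ 2))) ∧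
        (∀ (k : ℕ) (μ' : Mem), AtRound (f P) R μ k μ' → RoundInvariant f P k μ') := by
  refine ⟨41000, ?_⟩
  intro α β _ r f ξt ξw R _ hf hR P μ hm
  have H := hR.oracle P
  have hT := hf.transfers P
  have hL : (P.length : ℤ) ≤ 2 ^ Nat.clog 2 P.length := by
    exact_mod_cast Nat.le_pow_clog (by norm_num) P.length
  refine ⟨?_, fun k μ' h => (AtRound.roundInv H hT hL hm h).roundInvariant⟩
  obtain ⟨μ', t, w, he, ht, hw, hfin⟩ := runs_preprocessing H hT hL hm
  have hfin' : ∀ a : ℕ, a < P.length →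
      (witnesses f P a = ∅ → μ' .W a = 0) ∧
      (witnesses f P a ≠ ∅ → ∃ v ∈ witnesses f P a, μ' .W a = v) := by
    intro a ha
    have h := (finalized_iff f P (μ' .W) a).2 (hfin a (by omega) (by omega))
    constructor
    · intro h0
      by_contra hne
      obtain ⟨v, hv, -⟩ := h.2 hne
      rw [h0] at hv
      exact hv
    · intro h0
      exact h.2 fun hz => h0 (h.1 hz)
  refine ⟨μ', t, w, he, hfin', fun a ha => ?_, fun hP => ?_⟩
  · have hiff : (a = 0 ∨ IsPeriod r P a) ↔ witnesses f P a = ∅ := by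
      rcases Nat.eq_zero_or_pos a with rfl | h0
      · simp only [true_or, true_iff]
        rw [witnesses_eq_empty_iff]
        exact not_wit_zero
      · rw [hf.isPeriod_iff P h0 ha]
        simp [h0.ne']
    rw [hiff]
    exact hfin' a ha
  -- The call with arguments 1 and 1 is legitimate and takes at least one step, so both bounds are
  -- positive and the added ones cost only constant factors.
  · have hx : 1 ≤ ξt P.length ∧ 1 ≤ ξw P.length :=
      ⟨(hR.time_pos _ _ _).trans (hR.time_le P 1 1 le_rfl le_rfl (by omega)),
        (hR.work_pos _ _ _).trans (hR.work_le P 1 1 le_rfl le_rfl (by omega))⟩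
    constructor
    · rw [mul_assoc]
      refine cost_le_logb_sq hP ?_ ht
      change ξt P.length + 1 ≤ _
      omega
    · have := cost_le_logb_sq hP (x := ξw P.length * P.length) ?_ hw
      · rwa [Nat.cast_mul] at this
      · change (ξw P.length + 1) * (P.length + 1) ≤ _
        nlinarith
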